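/- Let $\Omega\subseteq\mathbb C$ be a simply connected domain and let $\mu:\Omega\to\mathbb C$ be piecewise continuous (up to a Lebesgue-null set, $\Omega$ is a disjoint union of open pieces on each of which $\mu$ is continuous) with $\|\mu\|_{L^\infty(\Omega)}<1$. A function $f:\Omega\to\mathbb C$ is called a solution of the Beltrami equation with coefficient $\mu$ if $f\in W^{1,2}_{\mathrm{loc}}(\Omega)$ and its weak derivatives satisfy $\partial_{\bar z}f=\mu\,\partial_z f$ almost everywhere in $\Omega$. Let $\varphi_0:\Omega\to\mathbb C$ be a continuous injective (that is, quasiconformal) solution of this equation, and let $\varphi:\Omega\to\mathbb C$ be continuous and injective. For a Jordan curve $\gamma:[0,1]\to\Omega$, let $\oint_\gamma\varphi\,d\varphi_0$ denote the Riemann–Stieltjes integral $\int_0^1\varphi(\gamma(t))\,d(\varphi_0(\gamma(t)))$ (the limit of tagged-partition sums as the mesh tends to $0$), when it exists. Then the following are equivalent: 1. $\varphi$ is a solution of the Beltrami equation with coefficient $\mu$; 2. for every Jordan curve $\gamma$ in $\Omega$ such that $\varphi_0\circ\gamma$ is rectifiable, $\oint_\gamma\varphi\,d\varphi_0$ exists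 and equals $0$; 3. for every Jordan curve $\gamma$ in $\Omega$ for which $\oint_\gamma\varphi\,d\varphi_0$ exists, it equals $0$. Moreover, $$\oint_\gamma\varphi\,d\varphi_0=\oint_\gamma\varphi(z)\,\partial_z\varphi_0(z)\,[dz+\mu(z)\,d\bar z]$$ for every Jordan curve $\gamma$ in $\Omega$ along which the right-hand side makes sense, that is, such that $\gamma$ and $\varphi_0\circ\gamma$ are absolutely continuous and, for almost every $t\in[0,1]$, $\varphi_0$ is real-differentiable at $\gamma(t)$ with $\partial_{\bar z}\varphi_0(\gamma(t))=\mu(\gamma(t))\,\partial_z\varphi_0(\gamma(t))$; both integrals then exist. -/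

import Mathlib

open MeasureTheory Set

noncomputable section

/-- The Wirtinger derivative `∂f/∂z = (∂f/∂x - i ∂f/∂y) / 2`. -/
def dz (f : ℂ → ℂ) (z : ℂ) : ℂ :=
  (fderiv ℝ f z 1 - Complex.I * fderiv ℝ f z Complex.I) / 2

/-- The Wirtinger derivative `∂f/∂z̄ = (∂f/∂x + i ∂f/∂y) / 2`. -/
def dzbar (f : ℂ → ℂ) (z : ℂ) : ℂ :=
  (fderiv ℝ f z 1 + Complex.I * fderiv ℝ f z Complex.I) / 2

/-- Test functions on `Ω`: smooth functions with compact support contained in `Ω`. -/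
def IsTestFunction (Ω : Set ℂ) (ψ : ℂ → ℂ) : Prop :=
  ContDiff ℝ ((⊤ : ℕ∞) : WithTop ℕ∞) ψ ∧ HasCompactSupport ψ ∧ tsupport ψ ⊆ Ω

/-- `g` belongs to `L²_loc(Ω)`. -/
def MemL2Loc (Ω : Set ℂ) (g : ℂ → ℂ) : Prop :=
  ∀ K : Set ℂ, IsCompact K → K ⊆ Ω → MemLp g 2 (volume.restrict K)

/-- `p` is the weak (distributional) derivative `∂f/∂z` on `Ω`. -/
def IsWeakDz (Ω : Set ℂ) (f p : ℂ → ℂ) : Prop :=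
  ∀ ψ : ℂ → ℂ, IsTestFunction Ω ψ → ∫ z in Ω, f z * dz ψ z = - ∫ z in Ω, p z * ψ z

/-- `q` is the weak (distributional) derivative `∂f/∂z̄` on `Ω`. -/
def IsWeakDzbar (Ω : Set ℂ) (f q : ℂ → ℂ) : Prop :=
  ∀ ψ : ℂ → ℂ, IsTestFunction Ω ψ → ∫ z in Ω, f z * dzbar ψ z = - ∫ z in Ω, q z * ψ z

/-- `f` is a solution on `Ω` of the Beltrami equation `∂f/∂z̄ = μ ∂f/∂z`: it lies in the Sobolev
space `W^{1,2}_loc(Ω)` and its weak derivatives satisfy the equation almost everywhere in `Ω`. -/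
def IsBeltramiSolution (Ω : Set ℂ) (μ f : ℂ → ℂ) : Prop :=
  MemL2Loc Ω f ∧ ∃ p q : ℂ → ℂ, MemL2Loc Ω p ∧ MemL2Loc Ω q ∧
    IsWeakDz Ω f p ∧ IsWeakDzbar Ω f q ∧ ∀ᵐ z ∂(volume.restrict Ω), q z = μ z * p z

/-- `μ` is piecewise continuous on `Ω`: up to a null set, `Ω` is a disjoint union of open pieces
on each of which `μ` is continuous. No regularity of the boundaries of the pieces, no finiteness
and no one-sided limits are required, so that this is implied by the more restrictive variants. -/
def IsPiecewiseContinuousOn (μ : ℂ → ℂ) (Ω : Set ℂ) : Prop :=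
  ∃ P : Set (Set ℂ), (∀ U ∈ P, IsOpen U ∧ U ⊆ Ω ∧ ContinuousOn μ U) ∧
    P.PairwiseDisjoint id ∧ volume (Ω \ ⋃₀ P) = 0

/-- `γ`, restricted to `[0, 1]`, parametrizes a Jordan curve (simple closed curve) in `Ω`. -/
def IsJordanCurveIn (γ : ℝ → ℂ) (Ω : Set ℂ) : Prop :=
  ContinuousOn γ (Icc 0 1) ∧ γ 0 = γ 1 ∧ InjOn γ (Ico 0 1) ∧ MapsTo γ (Icc 0 1) Ω

/-- The contour integral `∮_γ f dg` exists and equals `I`, as a Riemann-Stieltjes integral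
`∫₀¹ f(γ(t)) d(g(γ(t)))`: the sums over tagged partitions `0 = t₀ ≤ s₀ ≤ t₁ ≤ ... ≤ tₙ = 1`
converge to `I` as the mesh of the partition tends to `0`. -/
def HasContourIntegral (f g : ℂ → ℂ) (γ : ℝ → ℂ) (I : ℂ) : Prop :=
  ∀ ε : ℝ, 0 < ε → ∃ δ : ℝ, 0 < δ ∧ ∀ (n : ℕ) (t s : ℕ → ℝ), t 0 = 0 → t n = 1 →
    (∀ i < n, s i ∈ Icc (t i) (t (i + 1)) ∧ t (i + 1) - t i < δ) →
    ‖(∑ i ∈ Finset.range n, f (γ (s i)) * (g (γ (t (i + 1))) - g (γ (t i)))) - I‖ < ε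

end

open Filter Topology
open scoped ComplexConjugate

/-! ### Wirtinger calculus -/

/-! The idea is to transport the problem by `φ₀`. An injective continuous solution is an open map,
so `h = φ ∘ φ₀⁻¹` is continuous and injective on the open set `V = φ₀(Ω)`, and `∮_γ φ dφ₀` becomes
`∮ h(w) dw` along `φ₀ ∘ γ`. Once Stoilow's factorization is known (`φ` is a solution iff `h` is
holomorphic), the equivalences are Cauchy's and Morera's theorems for `h`.

Stoilow's factorization is obtained without any regularity of `φ₀⁻¹`. If `a` solves the same
equation as `f = φ₀`, then `da ∧ df = 0`, so for smooth `η` the form `d(a η(f) df)` is a multiple of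
`a η_w̄(f) J_f`, where `J_f` is the Jacobian; Stokes' theorem makes its integral vanish when `η ∘ f`
has compact support (`integral_mul_dzbar_comp_mul_jacobian`). With a mollifying kernel `ρ` for `η`,
this says that `T(w) = ∫ ρ(w - f(z)) a(z) J_f(z) dz` is holomorphic near a given value of `f`. For
`a = 1`, `T` is real, hence constant, and it is positive because otherwise `f` would be locally
constant. A positive weight forces every nearby `w` to be a value of `f`, which gives openness;
after division by the weight, `T` is an average of `h` near `w`, so `h` is a uniform limit of
holomorphic functions. The converse is the weak chain rule for `h ∘ φ₀`.

For Cauchy's theorem, a null homotopy cut into small cells shows that the segment integrals of `h`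
over any fine inscribed polygon add up to zero. If `φ₀ ∘ γ` is rectifiable, Riemann–Stieltjes sums
differ from these by a small multiple of its length. If the integral is merely known to exist,
injectivity of `φ` enters: `h' ≠ 0`, so the error on a segment is at most `3 |Δh| |Δw|`, and moving
the tags shows that existence forces `∑ |Δh| |Δw|` to tend to zero.

Morera's theorem needs only rectangles in `V`. Their preimages are Jordan curves with rectifiable
image along which the integral exists, so one argument serves both converses. The line integral
formula is the chain rule along an absolutely continuous curve. -/

theorem ContinuousLinearMap.apply_eq_re_im (L : ℂ →L[ℝ] ℂ) (v : ℂ) :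
    L v = v.re * L 1 + v.im * L Complex.I := by
  have : v = v.re • (1 : ℂ) + v.im • Complex.I := by
    simp [Complex.re_add_im]
  conv_lhs => rw [this, map_add, map_smul, map_smul]
  simp

theorem fderiv_eq_dz_add_dzbar (f : ℂ → ℂ) (z v : ℂ) :
    fderiv ℝ f z v = dz f z * v + dzbar f z * conj v := by
  rw [ContinuousLinearMap.apply_eq_re_im, dz, dzbar]
  apply Complex.ext <;> simp <;> ring

theorem dz_eq_of_hasFDerivAt {f : ℂ → ℂ} {z : ℂ} {L : ℂ →L[ℝ] ℂ} (h : HasFDerivAt f L z) :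
    dz f z = (L 1 - Complex.I * L Complex.I) / 2 := by
  rw [dz, h.fderiv]

theorem dzbar_eq_of_hasFDerivAt {f : ℂ → ℂ} {z : ℂ} {L : ℂ →L[ℝ] ℂ} (h : HasFDerivAt f L z) :
    dzbar f z = (L 1 + Complex.I * L Complex.I) / 2 := by
  rw [dzbar, h.fderiv]

theorem dz_mul {f g : ℂ → ℂ} {z : ℂ} (hf : DifferentiableAt ℝ f z) (hg : DifferentiableAt ℝ g z) :
    dz (fun x => f x * g x) z = dz f z * g z + f z * dz g z := by
  rw [dz_eq_of_hasFDerivAt (f := fun x => f x * g x) (hf.hasFDerivAt.mul hg.hasFDerivAt), dz, dz]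
  simp; ring

theorem dzbar_mul {f g : ℂ → ℂ} {z : ℂ} (hf : DifferentiableAt ℝ f z)
    (hg : DifferentiableAt ℝ g z) :
    dzbar (fun x => f x * g x) z = dzbar f z * g z + f z * dzbar g z := by
  rw [dzbar_eq_of_hasFDerivAt (f := fun x => f x * g x) (hf.hasFDerivAt.mul hg.hasFDerivAt), dzbar,
    dzbar]
  simp; ring

theorem dz_comp {f g : ℂ → ℂ} {z : ℂ} (hg : DifferentiableAt ℝ g (f z))
    (hf : DifferentiableAt ℝ f z) :
    dz (fun x => g (f x)) z = dz g (f z) * dz f z + dzbar g (f z) * conj (dzbar f z) := by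
  rw [dz_eq_of_hasFDerivAt (f := fun x => g (f x)) (hg.hasFDerivAt.comp z hf.hasFDerivAt)]
  simp only [ContinuousLinearMap.comp_apply, fderiv_eq_dz_add_dzbar]
  simp
  linear_combination (-(dz g (f z) * dz f z) / 2 - dzbar g (f z) * conj (dzbar f z) / 2
    + dz g (f z) * dzbar f z / 2 + dzbar g (f z) * conj (dz f z) / 2) * Complex.I_sq

theorem dzbar_comp {f g : ℂ → ℂ} {z : ℂ} (hg : DifferentiableAt ℝ g (f z))
    (hf : DifferentiableAt ℝ f z) :
    dzbar (fun x => g (f x)) z = dz g (f z) * dzbar f z + dzbar g (f z) * conj (dz f z) := by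
  rw [dzbar_eq_of_hasFDerivAt (f := fun x => g (f x)) (hg.hasFDerivAt.comp z hf.hasFDerivAt)]
  simp only [ContinuousLinearMap.comp_apply, fderiv_eq_dz_add_dzbar]
  simp
  linear_combination ((dz g (f z) * dz f z) / 2 + dzbar g (f z) * conj (dzbar f z) / 2
    - dz g (f z) * dzbar f z / 2 - dzbar g (f z) * conj (dz f z) / 2) * Complex.I_sq

theorem HasDerivAt.dz_eq {h : ℂ → ℂ} {h' z : ℂ} (H : HasDerivAt h h' z) : dz h z = h' := by
  rw [dz_eq_of_hasFDerivAt (H.hasFDerivAt.restrictScalars ℝ)]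
  simp
  ring_nf
  simp
  try ring

theorem HasDerivAt.dzbar_eq {h : ℂ → ℂ} {h' z : ℂ} (H : HasDerivAt h h' z) :
    dzbar h z = 0 := by
  rw [dzbar_eq_of_hasFDerivAt (H.hasFDerivAt.restrictScalars ℝ)]
  simp
  ring_nf
  simp

theorem dz_const_sub {g : ℂ → ℂ} {w z : ℂ} (hg : DifferentiableAt ℝ g (w - z)) :
    dz (fun x => g (w - x)) z = -dz g (w - z) := by
  have h : HasDerivAt (fun x : ℂ => w - x) (-1) z := by
    simpa using (hasDerivAt_id z).const_sub w
  rw [dz_comp (f := fun x => w - x) hg (by fun_prop), h.dz_eq, h.dzbar_eq]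
  simp

theorem dzbar_const_sub {g : ℂ → ℂ} {w z : ℂ} (hg : DifferentiableAt ℝ g (w - z)) :
    dzbar (fun x => g (w - x)) z = -dzbar g (w - z) := by
  have h : HasDerivAt (fun x : ℂ => w - x) (-1) z := by
    simpa using (hasDerivAt_id z).const_sub w
  rw [dzbar_comp (f := fun x => w - x) hg (by fun_prop), h.dz_eq, h.dzbar_eq]
  simp

/-- Cauchy–Riemann: once the conjugate-linear part vanishes, the real differential is multiplication
by `dz h z`. -/
theorem differentiableAt_complex_of_dzbar_eq_zero {h : ℂ → ℂ} {z : ℂ}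
    (H : DifferentiableAt ℝ h z) (H0 : dzbar h z = 0) : DifferentiableAt ℂ h z := by
  rw [differentiableAt_iff_restrictScalars ℝ H]
  refine ⟨ContinuousLinearMap.toSpanSingleton ℂ (dz h z), ?_⟩
  ext v
  all_goals simp [fderiv_eq_dz_add_dzbar, H0, mul_comm]

abbrev smoothDegree : WithTop ℕ∞ := ((⊤ : ℕ∞) : WithTop ℕ∞)

theorem ContDiff.dz {f : ℂ → ℂ} (hf : ContDiff ℝ smoothDegree f) :
    ContDiff ℝ smoothDegree (dz f) := by
  have h : ContDiff ℝ smoothDegree (fderiv ℝ f) := hf.fderiv_right (by simp)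
  unfold _root_.dz
  fun_prop

theorem ContDiff.dzbar {f : ℂ → ℂ} (hf : ContDiff ℝ smoothDegree f) :
    ContDiff ℝ smoothDegree (dzbar f) := by
  have h : ContDiff ℝ smoothDegree (fderiv ℝ f) := hf.fderiv_right (by simp)
  unfold _root_.dzbar
  fun_prop

theorem tsupport_dz_subset (f : ℂ → ℂ) : tsupport (dz f) ⊆ tsupport f := by
  refine closure_minimal (fun z hz => ?_) isClosed_closure
  by_contra h
  apply hz
  have : fderiv ℝ f z = 0 := by
    by_contra h'
    exact h (support_fderiv_subset ℝ h')
  simp [dz, this]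

theorem tsupport_dzbar_subset (f : ℂ → ℂ) : tsupport (dzbar f) ⊆ tsupport f := by
  refine closure_minimal (fun z hz => ?_) isClosed_closure
  by_contra h
  apply hz
  have : fderiv ℝ f z = 0 := by
    by_contra h'
    exact h (support_fderiv_subset ℝ h')
  simp [dzbar, this]

theorem IsTestFunction.dz {Ω : Set ℂ} {ψ : ℂ → ℂ} (h : IsTestFunction Ω ψ) :
    IsTestFunction Ω (dz ψ) :=
  ⟨h.1.dz, h.2.1.mono' (subset_closure.trans (tsupport_dz_subset ψ)),
    (tsupport_dz_subset ψ).trans h.2.2⟩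

theorem IsTestFunction.dzbar {Ω : Set ℂ} {ψ : ℂ → ℂ} (h : IsTestFunction Ω ψ) :
    IsTestFunction Ω (dzbar ψ) :=
  ⟨h.1.dzbar, h.2.1.mono' (subset_closure.trans (tsupport_dzbar_subset ψ)),
    (tsupport_dzbar_subset ψ).trans h.2.2⟩

/-- Symmetry of the second derivative. This is the identity `d² = 0` behind the closedness of weak
differentials. -/
theorem dz_dzbar_comm {f : ℂ → ℂ} (hf : ContDiff ℝ smoothDegree f) (z : ℂ) :
    dz (dzbar f) z = dzbar (dz f) z := by
  have h : ContDiff ℝ smoothDegree (fderiv ℝ f) := hf.fderiv_right (by simp)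
  have hd : HasFDerivAt (fderiv ℝ f) (fderiv ℝ (fderiv ℝ f) z) z :=
    (h.differentiable (by simp) z).hasFDerivAt
  have hs := (hf.contDiffAt (x := z)).isSymmSndFDerivAt (by
    simp only [minSmoothness_of_isRCLikeNormedField, smoothDegree]
    exact WithTop.coe_le_coe.2 (le_top : (2 : ℕ∞) ≤ ⊤))
  have key (v : ℂ) : HasFDerivAt (fun x => fderiv ℝ f x v)
      ((fderiv ℝ (fderiv ℝ f) z).flip v) z := by
    simpa using hd.clm_apply (hasFDerivAt_const v z)
  have e1 := ((key 1).add ((key Complex.I).const_mul Complex.I)).mul_const ((2 : ℂ)⁻¹)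
  have e2 := ((key 1).sub ((key Complex.I).const_mul Complex.I)).mul_const ((2 : ℂ)⁻¹)
  have d1 : HasFDerivAt (dzbar f) _ z := e1.congr_of_eventuallyEq
    (Eventually.of_forall fun x => by simp [dzbar, div_eq_mul_inv])
  have d2 : HasFDerivAt (dz f) _ z := e2.congr_of_eventuallyEq
    (Eventually.of_forall fun x => by simp [dz, div_eq_mul_inv])
  rw [dz_eq_of_hasFDerivAt d1, dzbar_eq_of_hasFDerivAt d2]
  simp [hs.eq 1 Complex.I]
  ring

theorem integral_fderiv_apply_eq_zero {ψ : ℂ → ℂ} (h1 : ContDiff ℝ smoothDegree ψ)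
    (h2 : HasCompactSupport ψ) (v : ℂ) : ∫ z, fderiv ℝ ψ z v = 0 := by
  have hc : Continuous (fun z => fderiv ℝ ψ z v) :=
    (h1.continuous_fderiv (by simp)).clm_apply continuous_const
  have hi : Integrable (fun z => fderiv ℝ ψ z v) :=
    hc.integrable_of_hasCompactSupport (h2.fderiv_apply ℝ v)
  have hi2 : Integrable ψ := h1.continuous.integrable_of_hasCompactSupport h2
  -- Integration by parts against the constant function `1`.
  have := integral_mul_fderiv_eq_neg_fderiv_mul_of_integrable (μ := (volume : Measure ℂ))
    (f := fun _ : ℂ => (1 : ℂ)) (g := ψ) (v := v) (by simp) (by simpa using hi)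
    (by simpa using hi2) (fun x _ => by fun_prop) (fun x _ => h1.differentiable (by simp) x)
  simpa using this

theorem HasCompactSupport.dz {ψ : ℂ → ℂ} (h2 : HasCompactSupport ψ) :
    HasCompactSupport (dz ψ) := h2.mono' (subset_closure.trans (tsupport_dz_subset ψ))

theorem HasCompactSupport.dzbar {ψ : ℂ → ℂ} (h2 : HasCompactSupport ψ) :
    HasCompactSupport (dzbar ψ) := h2.mono' (subset_closure.trans (tsupport_dzbar_subset ψ))

theorem integral_dz_eq_zero {ψ : ℂ → ℂ} (h1 : ContDiff ℝ smoothDegree ψ)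
    (h2 : HasCompactSupport ψ) : ∫ z, dz ψ z = 0 := by
  have hi (v : ℂ) : Integrable (fun z => fderiv ℝ ψ z v) :=
    ((h1.continuous_fderiv (by simp)).clm_apply continuous_const).integrable_of_hasCompactSupport
      (h2.fderiv_apply ℝ v)
  simp only [_root_.dz]
  rw [integral_div, integral_sub (hi 1) ((hi _).const_mul _), integral_const_mul,
    integral_fderiv_apply_eq_zero h1 h2, integral_fderiv_apply_eq_zero h1 h2]
  simp

theorem integral_dzbar_eq_zero {ψ : ℂ → ℂ} (h1 : ContDiff ℝ smoothDegree ψ)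
    (h2 : HasCompactSupport ψ) : ∫ z, dzbar ψ z = 0 := by
  have hi (v : ℂ) : Integrable (fun z => fderiv ℝ ψ z v) :=
    ((h1.continuous_fderiv (by simp)).clm_apply continuous_const).integrable_of_hasCompactSupport
      (h2.fderiv_apply ℝ v)
  simp only [_root_.dzbar]
  rw [integral_div, integral_add (hi 1) ((hi _).const_mul _), integral_const_mul,
    integral_fderiv_apply_eq_zero h1 h2, integral_fderiv_apply_eq_zero h1 h2]
  simp

/-- A test function pairs to zero with the exterior derivative of a closed form. -/
theorem integral_dzbar_mul_sub_dz_mul {Ω : Set ℂ} {f p q G : ℂ → ℂ} (hp : IsWeakDz Ω f p)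
    (hq : IsWeakDzbar Ω f q) (hG : IsTestFunction Ω G) :
    ∫ z in Ω, p z * dzbar G z = ∫ z in Ω, q z * dz G z := by
  -- Testing the weak `∂z` identity with `∂G/∂z̄` and the weak `∂z̄` identity with `∂G/∂z` gives the
  -- same left-hand side.
  have h1 := hp _ hG.dzbar
  have h2 := hq _ hG.dz
  simp only [dz_dzbar_comm hG.1] at h1
  rw [h1] at h2
  exact neg_injective h2

/-! ### Smoothing integrals -/

/-- All derivatives fall on the kernel `ρ`, so `F` need only be measurable. The case `F = id` is
ordinary mollification; the case where `F` is a solution `f` and `b` contains its Jacobian is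
mollification in the variable `w = f z`. -/
theorem hasFDerivAt_integral_comp_sub_mul {X : Type*} [MeasurableSpace X] {ν : Measure X}
    {F b : X → ℂ} (hF : AEMeasurable F ν) (hb : Integrable b ν) {ρ : ℂ → ℂ}
    (hρ : ContDiff ℝ smoothDegree ρ) (hρc : HasCompactSupport ρ) (w : ℂ) :
    HasFDerivAt (fun w => ∫ x, ρ (w - F x) * b x ∂ν)
      (∫ x, b x • fderiv ℝ ρ (w - F x) ∂ν) w := by
  obtain ⟨C, hC⟩ := (hρc.fderiv ℝ).exists_bound_of_continuous (hρ.continuous_fderiv (by simp))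
  obtain ⟨C', hC'⟩ := hρc.exists_bound_of_continuous hρ.continuous
  have hm (w : ℂ) : AEStronglyMeasurable (fun x => ρ (w - F x)) ν :=
    hρ.continuous.comp_aestronglyMeasurable
      (aestronglyMeasurable_const.sub hF.aestronglyMeasurable)
  have hm' (w : ℂ) : AEStronglyMeasurable (fun x => fderiv ℝ ρ (w - F x)) ν :=
    (hρ.continuous_fderiv (by simp)).comp_aestronglyMeasurable
      (aestronglyMeasurable_const.sub hF.aestronglyMeasurable)
  refine hasFDerivAt_integral_of_dominated_of_fderiv_le (s := univ)
    (F' := fun w x => b x • fderiv ℝ ρ (w - F x))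
    (bound := fun x => ‖b x‖ * C) univ_mem
    (Eventually.of_forall fun w => (hm w).mul hb.1) ?_ (hb.1.smul (hm' w)) ?_
    (hb.norm.mul_const C) ?_
  · exact hb.bdd_mul (hm w) (Eventually.of_forall fun x => hC' _)
  · refine Eventually.of_forall fun x w _ => ?_
    rw [norm_smul]
    gcongr
    exact hC _
  · refine Eventually.of_forall fun x w _ => ?_
    have h1 : HasFDerivAt ρ (fderiv ℝ ρ (w - F x)) (w - F x) :=
      (hρ.differentiable (by simp) _).hasFDerivAt
    have h2 : HasFDerivAt (fun w => ρ (w - F x)) (fderiv ℝ ρ (w - F x)) w := by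
      exact h1.comp w ((hasFDerivAt_id w).sub_const (F x))
    exact h2.mul_const (b x)

theorem integrable_comp_sub_mul {X : Type*} [MeasurableSpace X] {ν : Measure X}
    {F b : X → ℂ} (hF : AEMeasurable F ν) (hb : Integrable b ν) {ρ : ℂ → ℂ}
    (hρ : Continuous ρ) (hρc : HasCompactSupport ρ) (w : ℂ) :
    Integrable (fun x => ρ (w - F x) * b x) ν := by
  obtain ⟨C', hC'⟩ := hρc.exists_bound_of_continuous hρ
  exact hb.bdd_mul (hρ.comp_aestronglyMeasurable
      (aestronglyMeasurable_const.sub hF.aestronglyMeasurable)) (Eventually.of_forall fun x => hC' _)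

theorem fderiv_integral_comp_sub_mul_apply {X : Type*} [MeasurableSpace X] {ν : Measure X}
    {F b : X → ℂ} (hF : AEMeasurable F ν) (hb : Integrable b ν) {ρ : ℂ → ℂ}
    (hρ : ContDiff ℝ smoothDegree ρ) (hρc : HasCompactSupport ρ) (w v : ℂ) :
    fderiv ℝ (fun w => ∫ x, ρ (w - F x) * b x ∂ν) w v =
      ∫ x, fderiv ℝ ρ (w - F x) v * b x ∂ν := by
  obtain ⟨C, hC⟩ := (hρc.fderiv ℝ).exists_bound_of_continuous (hρ.continuous_fderiv (by simp))
  rw [(hasFDerivAt_integral_comp_sub_mul hF hb hρ hρc w).fderiv,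
    ContinuousLinearMap.integral_apply]
  · simp [mul_comm]
  · refine Integrable.mono' (hb.norm.mul_const C) (hb.1.smul
      ((hρ.continuous_fderiv (by simp)).comp_aestronglyMeasurable
        (aestronglyMeasurable_const.sub hF.aestronglyMeasurable)))
      (Eventually.of_forall fun x => ?_)
    rw [norm_smul]
    gcongr
    exact hC _

theorem dz_integral_comp_sub_mul {X : Type*} [MeasurableSpace X] {ν : Measure X}
    {F b : X → ℂ} (hF : AEMeasurable F ν) (hb : Integrable b ν) {ρ : ℂ → ℂ}
    (hρ : ContDiff ℝ smoothDegree ρ) (hρc : HasCompactSupport ρ) (w : ℂ) :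
    dz (fun w => ∫ x, ρ (w - F x) * b x ∂ν) w = ∫ x, dz ρ (w - F x) * b x ∂ν := by
  have hi (v : ℂ) : Integrable (fun x => fderiv ℝ ρ (w - F x) v * b x) ν :=
    integrable_comp_sub_mul hF hb (ρ := fun z => fderiv ℝ ρ z v)
      ((hρ.continuous_fderiv (by simp)).clm_apply continuous_const) (hρc.fderiv_apply ℝ v) w
  simp only [dz, fderiv_integral_comp_sub_mul_apply hF hb hρ hρc]
  rw [← integral_const_mul, ← integral_sub (hi 1) ((hi _).const_mul _), ← integral_div]
  congr 1 with x
  ring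

theorem dzbar_integral_comp_sub_mul {X : Type*} [MeasurableSpace X] {ν : Measure X}
    {F b : X → ℂ} (hF : AEMeasurable F ν) (hb : Integrable b ν) {ρ : ℂ → ℂ}
    (hρ : ContDiff ℝ smoothDegree ρ) (hρc : HasCompactSupport ρ) (w : ℂ) :
    dzbar (fun w => ∫ x, ρ (w - F x) * b x ∂ν) w = ∫ x, dzbar ρ (w - F x) * b x ∂ν := by
  have hi (v : ℂ) : Integrable (fun x => fderiv ℝ ρ (w - F x) v * b x) ν :=
    integrable_comp_sub_mul hF hb (ρ := fun z => fderiv ℝ ρ z v)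
      ((hρ.continuous_fderiv (by simp)).clm_apply continuous_const) (hρc.fderiv_apply ℝ v) w
  simp only [dzbar, fderiv_integral_comp_sub_mul_apply hF hb hρ hρc]
  rw [← integral_const_mul, ← integral_add (hi 1) ((hi _).const_mul _), ← integral_div]
  congr 1 with x
  ring

/-! ### Mollification -/

/-- The normalized bump function `φ.normed volume`, as a complex valued function. -/
noncomputable def ContDiffBump.kernel (φ : ContDiffBump (0 : ℂ)) (z : ℂ) : ℂ := (φ.normed volume z : ℂ)

theorem ContDiffBump.contDiff_kernel (φ : ContDiffBump (0 : ℂ)) :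
    ContDiff ℝ smoothDegree φ.kernel :=
  Complex.ofRealCLM.contDiff.comp φ.contDiff_normed

theorem ContDiffBump.tsupport_kernel (φ : ContDiffBump (0 : ℂ)) :
    tsupport φ.kernel = Metric.closedBall 0 φ.rOut := by
  rw [← φ.tsupport_normed_eq (μ := volume), tsupport, tsupport]
  congr 1
  ext z
  simp [ContDiffBump.kernel]

theorem ContDiffBump.hasCompactSupport_kernel (φ : ContDiffBump (0 : ℂ)) :
    HasCompactSupport φ.kernel := by
  rw [HasCompactSupport, φ.tsupport_kernel]
  exact isCompact_closedBall _ _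

/-- The mollification of `g` with the kernel given by a bump function. -/
noncomputable def mollify (φ : ContDiffBump (0 : ℂ)) (g : ℂ → ℂ) : ℂ → ℂ :=
  convolution (φ.normed volume) g (ContinuousLinearMap.lsmul ℝ ℝ) volume

theorem mollify_eq (φ : ContDiffBump (0 : ℂ)) (g : ℂ → ℂ) (z : ℂ) :
    mollify φ g z = ∫ w, φ.kernel (z - w) * g w := by
  rw [mollify, convolution_lsmul_swap]
  simp [ContDiffBump.kernel]

theorem contDiff_mollify (φ : ContDiffBump (0 : ℂ)) {g : ℂ → ℂ} (hg : LocallyIntegrable g) :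
    ContDiff ℝ smoothDegree (mollify φ g) :=
  φ.hasCompactSupport_normed.contDiff_convolution_left _ φ.contDiff_normed hg

/-- The kernel is a probability density: its `L¹` average is dominated by its `L²` average, and
Tonelli with translation invariance integrates the resulting pointwise bound. -/
theorem eLpNorm_mollify_le (φ : ContDiffBump (0 : ℂ)) {g : ℂ → ℂ}
    (hg : AEStronglyMeasurable g volume) :
    eLpNorm (mollify φ g) 2 volume ≤ eLpNorm g 2 volume := by
  -- A mollification sees only the almost everywhere class of `g`; a strongly measurable
  -- representative makes `(z, t) ↦ g (z - t)` measurable for Tonelli.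
  wlog hg' : StronglyMeasurable g generalizing g
  · have := this hg.stronglyMeasurable_mk.aestronglyMeasurable hg.stronglyMeasurable_mk
    rw [eLpNorm_congr_ae hg.ae_eq_mk]
    convert this using 2
    exact convolution_congr _ (ae_eq_refl _) hg.ae_eq_mk
  set ν : Measure ℂ := volume.withDensity (fun t => ‖φ.normed volume t‖ₑ) with hν
  have hmeas : Measurable (fun t => ‖φ.normed (volume : Measure ℂ) t‖ₑ) :=
    φ.continuous_normed.measurable.enorm
  have hprob : IsProbabilityMeasure ν := ⟨by
    rw [hν, withDensity_apply _ MeasurableSet.univ, Measure.restrict_univ,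
      ← ofReal_integral_norm_eq_lintegral_enorm φ.integrable_normed]
    simp [abs_of_nonneg (φ.nonneg_normed _), φ.integral_normed]⟩
  have hpt (z : ℂ) : ‖mollify φ g z‖ₑ ^ (2 : ℝ) ≤ ∫⁻ t, ‖g (z - t)‖ₑ ^ (2 : ℝ) ∂ν := by
    have hgz' : StronglyMeasurable (fun t => g (z - t)) :=
      hg'.comp_measurable (measurable_const.sub measurable_id)
    have hgz : AEStronglyMeasurable (fun t => g (z - t)) ν := hgz'.aestronglyMeasurable
    have h1 : ‖mollify φ g z‖ₑ ≤ eLpNorm (fun t => g (z - t)) 1 ν := by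
      rw [eLpNorm_one_eq_lintegral_enorm, hν, lintegral_withDensity_eq_lintegral_mul _ hmeas
        hgz'.enorm]
      exact (enorm_integral_le_lintegral_enorm _).trans_eq
        (lintegral_congr fun t => enorm_smul (φ.normed volume t) (g (z - t)))
    have h2 := h1.trans (eLpNorm_le_eLpNorm_of_exponent_le (by norm_num : (1 : ENNReal) ≤ 2) hgz)
    calc ‖mollify φ g z‖ₑ ^ (2 : ℝ) ≤ eLpNorm (fun t => g (z - t)) 2 ν ^ (2 : ℝ) := by gcongr
      _ = _ := by
        have := eLpNorm_nnreal_pow_eq_lintegral (f := fun t => g (z - t)) (μ := ν)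
          (two_ne_zero : (2 : NNReal) ≠ 0)
        simpa using this
  have hsq (u : ℂ → ℂ) : eLpNorm u 2 volume ^ (2 : ℝ) = ∫⁻ z, ‖u z‖ₑ ^ (2 : ℝ) := by
    have := eLpNorm_nnreal_pow_eq_lintegral (f := u) (μ := volume)
      (two_ne_zero : (2 : NNReal) ≠ 0)
    simpa using this
  rw [← ENNReal.rpow_le_rpow_iff (zero_lt_two : (0 : ℝ) < 2), hsq, hsq]
  calc ∫⁻ z, ‖mollify φ g z‖ₑ ^ (2 : ℝ)
      ≤ ∫⁻ z, ∫⁻ t, ‖g (z - t)‖ₑ ^ (2 : ℝ) ∂ν := lintegral_mono hpt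
    _ = ∫⁻ t, (∫⁻ z, ‖g (z - t)‖ₑ ^ (2 : ℝ)) ∂ν := by
        refine lintegral_lintegral_swap ?_
        exact (((hg'.measurable.comp (measurable_fst.sub measurable_snd)).enorm).pow_const
          (2 : ℝ)).aemeasurable
    _ = ∫⁻ t, (∫⁻ z, ‖g z‖ₑ ^ (2 : ℝ)) ∂ν := by
        congr 1 with t
        exact lintegral_sub_right_eq_self (fun z => ‖g z‖ₑ ^ (2 : ℝ)) t
    _ = _ := by simp

theorem mollify_sub (φ : ContDiffBump (0 : ℂ)) {g h : ℂ → ℂ} (hg : LocallyIntegrable g)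
    (hh : LocallyIntegrable h) : mollify φ (g - h) = mollify φ g - mollify φ h := by
  ext z
  have hc (u : ℂ → ℂ) (hu : LocallyIntegrable u) : Integrable (fun w => φ.kernel (z - w) * u w) := by
    have := (φ.hasCompactSupport_normed (μ := volume)).convolutionExists_left
      (ContinuousLinearMap.lsmul ℝ ℝ) φ.continuous_normed hu z
    have := this.integrable_swap
    simpa [ContDiffBump.kernel] using this
  simp only [Pi.sub_apply, mollify_eq]
  rw [← integral_sub (hc g hg) (hc h hh)]
  simp [mul_sub]

/-- A sequence of bump functions shrinking to the origin. -/
noncomputable def bumpSeq (n : ℕ) : ContDiffBump (0 : ℂ) where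
  rIn := 1 / (2 * ((n : ℝ) + 1))
  rOut := 1 / ((n : ℝ) + 1)
  rIn_pos := by positivity
  rIn_lt_rOut := by
    apply one_div_lt_one_div_of_lt <;> nlinarith [(Nat.cast_nonneg n : (0 : ℝ) ≤ n)]

theorem tendsto_bumpSeq_rOut : Tendsto (fun n => (bumpSeq n).rOut) atTop (𝓝 0) :=
  tendsto_one_div_add_atTop_nhds_zero_nat

/-- Uniform continuity gives uniform convergence, and as soon as the kernel radius is below `1` all
the differences vanish outside one fixed compact set. -/
theorem tendsto_eLpNorm_mollify_sub_of_continuous {g : ℂ → ℂ} (hg : Continuous g)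
    (hgc : HasCompactSupport g) :
    Tendsto (fun n => eLpNorm (mollify (bumpSeq n) g - g) 2 volume) atTop (𝓝 0) := by
  set S := Metric.cthickening 1 (tsupport g) with hS
  have hSc : IsCompact S := hgc.isCompact.cthickening
  have hSv : volume S ^ (1 / (2 : ENNReal).toReal) ≠ ⊤ :=
    ENNReal.rpow_ne_top_of_nonneg (by norm_num) hSc.measure_lt_top.ne
  have hlim : Tendsto (fun c : ℝ => ENNReal.ofReal c * volume S ^ (1 / (2 : ENNReal).toReal))
      (𝓝 0) (𝓝 0) := by
    have := ENNReal.Tendsto.mul_const (ENNReal.tendsto_ofReal (tendsto_id (x := 𝓝 (0 : ℝ))))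
      (Or.inr hSv) (b := volume S ^ (1 / (2 : ENNReal).toReal))
    simpa using this
  rw [ENNReal.tendsto_nhds_zero]
  intro ε hε
  obtain ⟨c, hc0, hc⟩ : ∃ c : ℝ, 0 < c ∧
      ENNReal.ofReal c * volume S ^ (1 / (2 : ENNReal).toReal) ≤ ε := by
    have h1 := (ENNReal.tendsto_nhds_zero.1 hlim ε hε).filter_mono
      (nhdsWithin_le_nhds (s := Ioi 0))
    obtain ⟨c, hc⟩ := (h1.and self_mem_nhdsWithin).exists
    exact ⟨c, hc.2, hc.1⟩
  obtain ⟨δ, hδ0, hδ⟩ := Metric.uniformContinuous_iff.1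
    (hg.uniformContinuous_of_tendsto_cocompact hgc.is_zero_at_infty) c hc0
  filter_upwards [tendsto_bumpSeq_rOut.eventually_lt_const (lt_min hδ0 one_pos)] with n hn
  refine (eLpNorm_sub_le_of_dist_bdd volume (by norm_num) hSc.measurableSet hc0.le
    (fun x => ?_) ?_ ?_).trans hc
  · exact (bumpSeq n).dist_normed_convolution_le hg.aestronglyMeasurable fun y hy =>
      (hδ ((Metric.mem_ball.1 hy).trans (hn.trans_le (min_le_left _ _)))).le
  · intro z hz
    have := support_convolution_subset (ContinuousLinearMap.lsmul ℝ ℝ) (μ := volume)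
      (f := (bumpSeq n).normed volume) (g := g) hz
    rw [(bumpSeq n).support_normed_eq] at this
    obtain ⟨a, ha, b, hb, rfl⟩ := this
    refine Metric.mem_cthickening_of_dist_le _ b _ _ (subset_closure hb) ?_
    have : dist a 0 < 1 := (Metric.mem_ball.1 ha).trans (hn.trans_le (min_le_right _ _))
    simpa [dist_eq_norm] using this.le
  · exact subset_closure.trans (Metric.self_subset_cthickening _)

/-- Density of compactly supported continuous functions in `L²`, together with the contraction
property `eLpNorm_mollify_le`. -/
theorem tendsto_eLpNorm_mollify_sub {g : ℂ → ℂ} (hg : MemLp g 2 volume) :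
    Tendsto (fun n => eLpNorm (mollify (bumpSeq n) g - g) 2 volume) atTop (𝓝 0) := by
  rw [ENNReal.tendsto_nhds_zero]
  intro ε hε
  have hε3 : ε / 3 ≠ 0 := by simp [hε.ne']
  obtain ⟨u, huc, hu, hucont, hum⟩ := hg.exists_hasCompactSupport_eLpNorm_sub_le (by norm_num) hε3
  have hli (v : ℂ → ℂ) (hv : MemLp v 2 volume) : LocallyIntegrable v :=
    hv.locallyIntegrable (by norm_num)
  have hmeas (n : ℕ) (v : ℂ → ℂ) (hv : MemLp v 2 volume) :
      AEStronglyMeasurable (mollify (bumpSeq n) v) volume :=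
    (contDiff_mollify _ (hli v hv)).continuous.aestronglyMeasurable
  filter_upwards [ENNReal.tendsto_nhds_zero.1
    (tendsto_eLpNorm_mollify_sub_of_continuous hucont huc) (ε / 3) (pos_iff_ne_zero.2 hε3)]
    with n hn
  have e : mollify (bumpSeq n) g - g =
      mollify (bumpSeq n) (g - u) + (mollify (bumpSeq n) u - u) + (u - g) := by
    rw [mollify_sub _ (hli g hg) (hli u hum)]
    abel
  rw [e]
  have h1 := eLpNorm_mollify_le (bumpSeq n) (hg.1.sub hum.1)
  calc _ ≤ eLpNorm (mollify (bumpSeq n) (g - u) + (mollify (bumpSeq n) u - u)) 2 volume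
        + eLpNorm (u - g) 2 volume :=
        eLpNorm_add_le ((hmeas n _ (hg.sub hum)).add ((hmeas n _ hum).sub hum.1))
          (hum.1.sub hg.1) (by norm_num)
    _ ≤ (eLpNorm (mollify (bumpSeq n) (g - u)) 2 volume
        + eLpNorm (mollify (bumpSeq n) u - u) 2 volume) + eLpNorm (u - g) 2 volume := by
        gcongr
        exact eLpNorm_add_le (hmeas n _ (hg.sub hum)) ((hmeas n _ hum).sub hum.1) (by norm_num)
    _ ≤ (ε / 3 + ε / 3) + ε / 3 := by
        gcongr
        · exact h1.trans hu
        · rw [← eLpNorm_neg, neg_sub]; exact hu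
    _ = ε := ENNReal.add_thirds ε

theorem ContDiffBump.isTestFunction_kernel_sub (φ : ContDiffBump (0 : ℂ)) (z : ℂ) {Ω : Set ℂ}
    (h : Metric.closedBall z φ.rOut ⊆ Ω) : IsTestFunction Ω (fun w => φ.kernel (z - w)) ∧
      tsupport (fun w => φ.kernel (z - w)) ⊆ Metric.closedBall z φ.rOut := by
  have hs : tsupport (fun w => φ.kernel (z - w)) ⊆ Metric.closedBall z φ.rOut := by
    refine closure_minimal (fun w hw => ?_) Metric.isClosed_closedBall
    have : z - w ∈ tsupport φ.kernel := subset_closure hw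
    rw [φ.tsupport_kernel] at this
    simpa [dist_eq_norm, norm_sub_rev] using this
  refine ⟨⟨φ.contDiff_kernel.comp (contDiff_const.sub contDiff_id), ?_, hs.trans h⟩, hs⟩
  exact HasCompactSupport.of_support_subset_isCompact (isCompact_closedBall z φ.rOut)
    (subset_closure.trans hs)

theorem integral_mul_indicator_eq_setIntegral {Ω K : Set ℂ} (hΩ : MeasurableSet Ω) (hK : K ⊆ Ω)
    {f ψ : ℂ → ℂ} (hψ : tsupport ψ ⊆ K) :
    ∫ w, ψ w * K.indicator f w = ∫ w in Ω, f w * ψ w := by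
  rw [← integral_indicator hΩ]
  congr 1 with w
  by_cases hw : w ∈ K
  · simp [hw, hK hw, mul_comm]
  · simp [hw, image_eq_zero_of_notMem_tsupport (fun h => hw (hψ h)), indicator]

/-- The derivative falls on the kernel, which is a test function of the integration variable, and
the weak identity moves it to `f`. Cutting `f` off outside `K` makes it integrable and is invisible
wherever the support of the kernel stays inside `K`. -/
theorem dz_mollify_indicator {Ω K : Set ℂ} (hΩ : MeasurableSet Ω) (hK : K ⊆ Ω) {f p : ℂ → ℂ}
    (hp : IsWeakDz Ω f p) (hf : Integrable (K.indicator f)) (φ : ContDiffBump (0 : ℂ)) {z : ℂ}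
    (hz : Metric.closedBall z φ.rOut ⊆ K) :
    dz (mollify φ (K.indicator f)) z = mollify φ (K.indicator p) z := by
  obtain ⟨hψ, hψs⟩ := φ.isTestFunction_kernel_sub z (hz.trans hK)
  have e : mollify φ (K.indicator f) = fun z => ∫ w, φ.kernel (z - w) * K.indicator f w :=
    funext (mollify_eq φ _)
  -- The sign from the reflection `w ↦ z - w` cancels the sign in the definition of the weak
  -- derivative.
  have hd : dz (fun w => φ.kernel (z - w)) = fun w => - dz φ.kernel (z - w) := by
    ext w
    exact dz_const_sub (φ.contDiff_kernel.differentiable (by simp) _)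
  rw [mollify_eq, e, dz_integral_comp_sub_mul (F := fun w => w) aemeasurable_id' hf
    φ.contDiff_kernel φ.hasCompactSupport_kernel,
    integral_mul_indicator_eq_setIntegral hΩ hK (hψs.trans hz)]
  have h1 := hp _ hψ
  rw [← integral_mul_indicator_eq_setIntegral hΩ hK
    ((tsupport_dz_subset _).trans (hψs.trans hz)), hd] at h1
  simp only [neg_mul, integral_neg] at h1
  exact neg_injective h1

theorem dzbar_mollify_indicator {Ω K : Set ℂ} (hΩ : MeasurableSet Ω) (hK : K ⊆ Ω) {f q : ℂ → ℂ}
    (hq : IsWeakDzbar Ω f q) (hf : Integrable (K.indicator f)) (φ : ContDiffBump (0 : ℂ)) {z : ℂ}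
    (hz : Metric.closedBall z φ.rOut ⊆ K) :
    dzbar (mollify φ (K.indicator f)) z = mollify φ (K.indicator q) z := by
  obtain ⟨hψ, hψs⟩ := φ.isTestFunction_kernel_sub z (hz.trans hK)
  have e : mollify φ (K.indicator f) = fun z => ∫ w, φ.kernel (z - w) * K.indicator f w :=
    funext (mollify_eq φ _)
  have hd : dzbar (fun w => φ.kernel (z - w)) = fun w => - dzbar φ.kernel (z - w) := by
    ext w
    exact dzbar_const_sub (φ.contDiff_kernel.differentiable (by simp) _)
  rw [mollify_eq, e, dzbar_integral_comp_sub_mul (F := fun w => w) aemeasurable_id' hf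
    φ.contDiff_kernel φ.hasCompactSupport_kernel,
    integral_mul_indicator_eq_setIntegral hΩ hK (hψs.trans hz)]
  have h1 := hq _ hψ
  rw [← integral_mul_indicator_eq_setIntegral hΩ hK
    ((tsupport_dzbar_subset _).trans (hψs.trans hz)), hd] at h1
  simp only [neg_mul, integral_neg] at h1
  exact neg_injective h1

/-- A continuous function with locally square integrable weak derivatives is approximated by
smooth functions, uniformly on a compact set, with derivatives converging in `L²`. -/
theorem exists_smooth_approx {Ω : Set ℂ} (hΩ : IsOpen Ω) {f p q : ℂ → ℂ} (hf : ContinuousOn f Ω)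
    (hp : MemL2Loc Ω p) (hq : MemL2Loc Ω q) (hpw : IsWeakDz Ω f p) (hqw : IsWeakDzbar Ω f q)
    {K : Set ℂ} (hK : IsCompact K) (hKΩ : K ⊆ Ω) :
    ∃ F : ℕ → ℂ → ℂ, (∀ n, ContDiff ℝ smoothDegree (F n)) ∧ TendstoUniformlyOn F f atTop K ∧
      Tendsto (fun n => eLpNorm (dz (F n) - p) 2 (volume.restrict K)) atTop (𝓝 0) ∧
      Tendsto (fun n => eLpNorm (dzbar (F n) - q) 2 (volume.restrict K)) atTop (𝓝 0) := by
  -- The larger compact set `K₁` leaves room for kernels of radius below `δ` centred at points of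
  -- `K`.
  obtain ⟨δ, hδ0, hδ⟩ := hK.exists_cthickening_subset_open hΩ hKΩ
  set K₁ := Metric.cthickening δ K with hK₁
  have hK₁c : IsCompact K₁ := hK.cthickening
  have hKK₁ : K ⊆ K₁ := Metric.self_subset_cthickening _
  have hball {z : ℂ} (hz : z ∈ K) {n : ℕ} (hn : (bumpSeq n).rOut < δ) :
      Metric.closedBall z (bumpSeq n).rOut ⊆ K₁ :=
    (Metric.closedBall_subset_cthickening hz _).trans (Metric.cthickening_mono hn.le _)
  have hgi : Integrable (K₁.indicator f) :=
    (integrable_indicator_iff hK₁c.measurableSet).2 ((hf.mono hδ).integrableOn_compact hK₁c)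
  have hsmall := tendsto_bumpSeq_rOut.eventually_lt_const hδ0
  have hL2 (u : ℂ → ℂ) (hu : MemL2Loc Ω u) (v : ℕ → ℂ → ℂ)
      (huv : ∀ n, (bumpSeq n).rOut < δ → ∀ z ∈ K, v n z = mollify (bumpSeq n) (K₁.indicator u) z) :
      Tendsto (fun n => eLpNorm (v n - u) 2 (volume.restrict K)) atTop (𝓝 0) := by
    have h1 := tendsto_eLpNorm_mollify_sub
      ((memLp_indicator_iff_restrict hK₁c.measurableSet).2 (hu K₁ hK₁c hδ))
    refine tendsto_of_tendsto_of_tendsto_of_le_of_le' tendsto_const_nhds h1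
      (Eventually.of_forall fun _ => zero_le) ?_
    filter_upwards [hsmall] with n hn
    refine le_trans (le_of_eq ?_) (eLpNorm_mono_measure _ (Measure.restrict_le_self (s := K)))
    refine eLpNorm_congr_ae ((ae_restrict_iff' hK.measurableSet).2
      (Eventually.of_forall fun z hz => ?_))
    simp [huv n hn z hz, hKK₁ hz]
  refine ⟨fun n => mollify (bumpSeq n) (K₁.indicator f),
    fun n => contDiff_mollify _ hgi.locallyIntegrable, ?_, ?_, ?_⟩
  · rw [Metric.tendstoUniformlyOn_iff]
    intro ε hε
    obtain ⟨η, hη0, hη⟩ := Metric.uniformContinuousOn_iff.1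
      (hK₁c.uniformContinuousOn_of_continuous (hf.mono hδ)) (ε / 2) (by positivity)
    filter_upwards [hsmall, tendsto_bumpSeq_rOut.eventually_lt_const hη0] with n hn hn' z hz
    have := (bumpSeq n).dist_normed_convolution_le (μ := volume) (g := K₁.indicator f) (x₀ := z)
      (ε := ε / 2) hgi.1 fun x hx => by
        have hx1 : x ∈ K₁ := hball hz hn (Metric.ball_subset_closedBall hx)
        rw [indicator_of_mem hx1, indicator_of_mem (hKK₁ hz)]
        exact (hη x hx1 z (hKK₁ hz) ((Metric.mem_ball.1 hx).trans hn')).le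
    rw [indicator_of_mem (hKK₁ hz), dist_comm] at this
    exact this.trans_lt (by linarith)
  · exact hL2 p hp _ fun n hn z hz =>
      dz_mollify_indicator hΩ.measurableSet hδ hpw hgi _ (hball hz hn)
  · exact hL2 q hq _ fun n hn z hz =>
      dzbar_mollify_indicator hΩ.measurableSet hδ hqw hgi _ (hball hz hn)

/-! ### Convergence in `L²` -/

/-- Convergence in `L²(ν)` of a sequence of square integrable functions. -/
def TendstoL2 (ν : Measure ℂ) (a : ℕ → ℂ → ℂ) (b : ℂ → ℂ) : Prop :=
  (∀ n, MemLp (a n) 2 ν) ∧ MemLp b 2 ν ∧ Tendsto (fun n => eLpNorm (a n - b) 2 ν) atTop (𝓝 0)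

theorem ENNReal.tendsto_nhds_zero_of_eventually_le_ofReal_mul {u : ℕ → ENNReal} {B : ENNReal}
    (hB : B ≠ ⊤) (h : ∀ c : ℝ, 0 < c → ∀ᶠ n in atTop, u n ≤ ENNReal.ofReal c * B) :
    Tendsto u atTop (𝓝 0) := by
  have hlim : Tendsto (fun c : ℝ => ENNReal.ofReal c * B) (𝓝 0) (𝓝 0) := by
    have := ENNReal.Tendsto.mul_const (ENNReal.tendsto_ofReal (tendsto_id (x := 𝓝 (0 : ℝ))))
      (Or.inr hB) (b := B)
    simpa using this
  rw [ENNReal.tendsto_nhds_zero]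
  intro ε hε
  have h1 := (ENNReal.tendsto_nhds_zero.1 hlim ε hε).filter_mono
    (nhdsWithin_le_nhds (s := Ioi 0))
  obtain ⟨c, hc⟩ := (h1.and self_mem_nhdsWithin).exists
  exact (h c hc.2).mono fun n hn => hn.trans hc.1

theorem tendstoL2_const {ν : Measure ℂ} {b : ℂ → ℂ} (hb : MemLp b 2 ν) :
    TendstoL2 ν (fun _ => b) b :=
  ⟨fun _ => hb, hb, by simp⟩

theorem TendstoL2.add {ν : Measure ℂ} {a a' : ℕ → ℂ → ℂ} {b b' : ℂ → ℂ} (h : TendstoL2 ν a b)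
    (h' : TendstoL2 ν a' b') :
    TendstoL2 ν (fun n z => a n z + a' n z) (fun z => b z + b' z) := by
  refine ⟨fun n => (h.1 n).add (h'.1 n), h.2.1.add h'.2.1, ?_⟩
  have := h.2.2.add h'.2.2
  rw [add_zero] at this
  refine tendsto_of_tendsto_of_tendsto_of_le_of_le tendsto_const_nhds this
    (fun _ => zero_le) fun n => ?_
  refine le_trans (le_of_eq ?_) (eLpNorm_add_le ((h.1 n).1.sub h.2.1.1) ((h'.1 n).1.sub h'.2.1.1)
    (by norm_num))
  congr 1
  ext z
  simp only [Pi.sub_apply, Pi.add_apply]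
  ring

theorem TendstoL2.conj {ν : Measure ℂ} {a : ℕ → ℂ → ℂ} {b : ℂ → ℂ} (h : TendstoL2 ν a b) :
    TendstoL2 ν (fun n z => conj (a n z)) (fun z => conj (b z)) := by
  have hm {u : ℂ → ℂ} (hu : MemLp u 2 ν) : MemLp (fun z => conj (u z)) 2 ν :=
    hu.congr_norm (Complex.continuous_conj.comp_aestronglyMeasurable hu.1)
      (Eventually.of_forall fun z => by simp)
  refine ⟨fun n => hm (h.1 n), hm h.2.1, h.2.2.congr fun n => eLpNorm_congr_norm_ae
    (Eventually.of_forall fun z => ?_)⟩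
  simp only [Pi.sub_apply, ← map_sub, RCLike.norm_conj]

theorem memLp_mul_of_continuousOn {K : Set ℂ} (hK : IsCompact K) {u b : ℂ → ℂ}
    (hu : ContinuousOn u K) {r : ENNReal} (hb : MemLp b r (volume.restrict K)) :
    MemLp (fun z => u z * b z) r (volume.restrict K) := by
  obtain ⟨C, hC⟩ := hK.exists_bound_of_continuousOn hu
  refine MemLp.of_le_mul (c := C) hb
    ((hu.aestronglyMeasurable hK.measurableSet).mul hb.1)
    ((ae_restrict_iff' hK.measurableSet).2 (Eventually.of_forall fun z hz => ?_))
  rw [norm_mul]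
  gcongr
  exact hC z hz

/-- Split `uₙ aₙ - v b = uₙ (aₙ - b) + (uₙ - v) b`: the first term is bounded times `L²`-small, the
second uniformly small times a fixed `L²` function. -/
theorem TendstoL2.mul_tendstoUniformlyOn {K : Set ℂ} (hK : IsCompact K) {a u : ℕ → ℂ → ℂ}
    {b v : ℂ → ℂ} (h : TendstoL2 (volume.restrict K) a b) (hu : ∀ n, ContinuousOn (u n) K)
    (huv : TendstoUniformlyOn u v atTop K) :
    TendstoL2 (volume.restrict K) (fun n z => u n z * a n z) (fun z => v z * b z) := by
  have hv : ContinuousOn v K := huv.continuousOn (Frequently.of_forall hu)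
  obtain ⟨C, hC⟩ := hK.exists_bound_of_continuousOn hv
  rw [Metric.tendstoUniformlyOn_iff] at huv
  have hum (n : ℕ) : AEStronglyMeasurable (u n) (volume.restrict K) :=
    (hu n).aestronglyMeasurable hK.measurableSet
  have hvm : AEStronglyMeasurable v (volume.restrict K) :=
    hv.aestronglyMeasurable hK.measurableSet
  refine ⟨fun n => memLp_mul_of_continuousOn hK (hu n) (h.1 n),
    memLp_mul_of_continuousOn hK hv h.2.1, ?_⟩
  have t1 : Tendsto (fun n => eLpNorm (fun z => u n z * (a n z - b z)) 2 (volume.restrict K))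
      atTop (𝓝 0) := by
    -- `C` bounds `v` on `K`, hence `C + 1` bounds `u n` once it is within `1` of `v`.
    have := ENNReal.Tendsto.const_mul h.2.2 (Or.inr (ENNReal.ofReal_ne_top (r := C + 1)))
    rw [mul_zero] at this
    refine tendsto_of_tendsto_of_tendsto_of_le_of_le' tendsto_const_nhds this
      (Eventually.of_forall fun _ => zero_le) ?_
    filter_upwards [huv 1 one_pos] with n hn
    refine eLpNorm_le_mul_eLpNorm_of_ae_le_mul
      ((ae_restrict_iff' hK.measurableSet).2 (Eventually.of_forall fun z hz => ?_)) _
    rw [norm_mul, Pi.sub_apply]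
    gcongr
    have h1 := hn z hz
    rw [dist_eq_norm, norm_sub_rev] at h1
    calc ‖u n z‖ ≤ ‖v z‖ + ‖u n z - v z‖ := norm_le_norm_add_norm_sub' _ _
      _ ≤ C + 1 := add_le_add (hC z hz) h1.le
  have t2 : Tendsto (fun n => eLpNorm (fun z => (u n z - v z) * b z) 2 (volume.restrict K))
      atTop (𝓝 0) := by
    refine ENNReal.tendsto_nhds_zero_of_eventually_le_ofReal_mul h.2.1.2.ne fun c hc => ?_
    filter_upwards [huv c hc] with n hn
    refine eLpNorm_le_mul_eLpNorm_of_ae_le_mul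
      ((ae_restrict_iff' hK.measurableSet).2 (Eventually.of_forall fun z hz => ?_)) _
    rw [norm_mul]
    gcongr
    have h1 := hn z hz
    rw [dist_eq_norm, norm_sub_rev] at h1
    exact h1.le
  have := t1.add t2
  rw [add_zero] at this
  refine tendsto_of_tendsto_of_tendsto_of_le_of_le tendsto_const_nhds this
    (fun _ => zero_le) fun n => ?_
  refine le_trans (le_of_eq ?_) (eLpNorm_add_le
    ((hum n).mul ((h.1 n).1.sub h.2.1.1)) (((hum n).sub hvm).mul h.2.1.1) (by norm_num))
  congr 1
  ext z
  simp only [Pi.sub_apply, Pi.add_apply]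
  ring

theorem TendstoL2.mul_continuousOn {K : Set ℂ} (hK : IsCompact K) {a : ℕ → ℂ → ℂ}
    {b v : ℂ → ℂ} (h : TendstoL2 (volume.restrict K) a b) (hv : ContinuousOn v K) :
    TendstoL2 (volume.restrict K) (fun n z => v z * a n z) (fun z => v z * b z) :=
  h.mul_tendstoUniformlyOn hK (u := fun _ => v) (fun _ => hv) (fun _ hU =>
    Eventually.of_forall fun _ _ _ => refl_mem_uniformity hU)

theorem TendstoL2.tendsto_integral_mul {ν : Measure ℂ} {a : ℕ → ℂ → ℂ} {b w : ℂ → ℂ}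
    (h : TendstoL2 ν a b) (hw : MemLp w 2 ν) :
    Tendsto (fun n => ∫ z, a n z * w z ∂ν) atTop (𝓝 (∫ z, b z * w z ∂ν)) := by
  refine tendsto_integral_of_L1' _ (h.2.1.integrable_mul hw).1
    (Eventually.of_forall fun n => (h.1 n).integrable_mul hw) ?_
  have := ENNReal.Tendsto.mul_const h.2.2 (Or.inr hw.2.ne)
  rw [zero_mul] at this
  refine tendsto_of_tendsto_of_tendsto_of_le_of_le tendsto_const_nhds this
    (fun _ => zero_le) fun n => ?_
  refine le_trans (le_of_eq ?_) (eLpNorm_smul_le_mul_eLpNorm hw.1 ((h.1 n).1.sub h.2.1.1)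
    (r := 1))
  congr 1
  ext z
  simp [sub_mul]

/-! ### Stokes' theorem and the chain rule for Sobolev functions -/

/-- Being `1` near each point of `K`, and not only on `K`, makes the derivatives of `χ` vanish on
`K` as well. -/
theorem exists_isTestFunction_eq_one {Ω K : Set ℂ} (hΩ : IsOpen Ω) (hK : IsCompact K)
    (hKΩ : K ⊆ Ω) : ∃ χ : ℂ → ℂ, IsTestFunction Ω χ ∧ ∀ z ∈ K, χ =ᶠ[𝓝 z] fun _ => 1 := by
  obtain ⟨L, hL, hKL, hLΩ⟩ := exists_compact_between hK hΩ hKΩ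
  obtain ⟨χ, h1, h0, -⟩ := exists_contMDiffMap_one_nhds_of_subset_interior
    (n := (⊤ : ℕ∞)) (modelWithCornersSelf ℝ ℂ) hK.isClosed hKL
  have hs : tsupport (fun z => (χ z : ℂ)) ⊆ L := by
    refine closure_minimal (fun z hz => ?_) hL.isClosed
    by_contra h
    exact hz (by simp [h0 z h])
  refine ⟨fun z => (χ z : ℂ), ⟨Complex.ofRealCLM.contDiff.comp χ.contMDiff.contDiff, ?_,
    hs.trans hLΩ⟩, fun z hz => ?_⟩
  · exact HasCompactSupport.of_support_subset_isCompact hL (subset_closure.trans hs)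
  · filter_upwards [(eventually_nhdsSet_iff_forall.1 h1) z hz] with x hx
    simp [hx]

theorem uniformContinuous_of_hasCompactSupport {g : ℂ → ℂ} (hg : Continuous g)
    (hgc : HasCompactSupport g) : UniformContinuous g :=
  hg.uniformContinuous_of_tendsto_cocompact hgc.is_zero_at_infty

/-- The weak chain rule in `L²`, for a sequence of smooth approximations. -/
theorem TendstoL2.dz_comp {K : Set ℂ} (hK : IsCompact K) {F : ℕ → ℂ → ℂ} {f p q g : ℂ → ℂ}
    (hF : ∀ n, ContDiff ℝ smoothDegree (F n)) (hFf : TendstoUniformlyOn F f atTop K)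
    (hp : TendstoL2 (volume.restrict K) (fun n => dz (F n)) p)
    (hq : TendstoL2 (volume.restrict K) (fun n => dzbar (F n)) q)
    (hg : ContDiff ℝ smoothDegree g) (hgc : HasCompactSupport g) :
    TendstoL2 (volume.restrict K) (fun n => dz (fun z => g (F n z)))
      (fun z => dz g (f z) * p z + dzbar g (f z) * conj (q z)) := by
  have e : (fun n => dz (fun z => g (F n z))) = fun n z =>
      dz g (F n z) * dz (F n) z + dzbar g (F n z) * conj (dzbar (F n) z) := by
    ext n z
    exact _root_.dz_comp (hg.differentiable (by simp) _) ((hF n).differentiable (by simp) _)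
  rw [e]
  exact (hp.mul_tendstoUniformlyOn hK
    (fun n => (hg.dz.continuous.comp (hF n).continuous).continuousOn)
    ((uniformContinuous_of_hasCompactSupport hg.dz.continuous hgc.dz).comp_tendstoUniformlyOn
      hFf)).add (hq.conj.mul_tendstoUniformlyOn hK
    (fun n => (hg.dzbar.continuous.comp (hF n).continuous).continuousOn)
    ((uniformContinuous_of_hasCompactSupport hg.dzbar.continuous
      hgc.dzbar).comp_tendstoUniformlyOn hFf))

theorem TendstoL2.dzbar_comp {K : Set ℂ} (hK : IsCompact K) {F : ℕ → ℂ → ℂ} {f p q g : ℂ → ℂ}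
    (hF : ∀ n, ContDiff ℝ smoothDegree (F n)) (hFf : TendstoUniformlyOn F f atTop K)
    (hp : TendstoL2 (volume.restrict K) (fun n => dz (F n)) p)
    (hq : TendstoL2 (volume.restrict K) (fun n => dzbar (F n)) q)
    (hg : ContDiff ℝ smoothDegree g) (hgc : HasCompactSupport g) :
    TendstoL2 (volume.restrict K) (fun n => dzbar (fun z => g (F n z)))
      (fun z => dz g (f z) * q z + dzbar g (f z) * conj (p z)) := by
  have e : (fun n => dzbar (fun z => g (F n z))) = fun n z =>
      dz g (F n z) * dzbar (F n) z + dzbar g (F n z) * conj (dz (F n) z) := by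
    ext n z
    exact _root_.dzbar_comp (hg.differentiable (by simp) _) ((hF n).differentiable (by simp) _)
  rw [e]
  exact (hq.mul_tendstoUniformlyOn hK
    (fun n => (hg.dz.continuous.comp (hF n).continuous).continuousOn)
    ((uniformContinuous_of_hasCompactSupport hg.dz.continuous hgc.dz).comp_tendstoUniformlyOn
      hFf)).add (hp.conj.mul_tendstoUniformlyOn hK
    (fun n => (hg.dzbar.continuous.comp (hF n).continuous).continuousOn)
    ((uniformContinuous_of_hasCompactSupport hg.dzbar.continuous
      hgc.dzbar).comp_tendstoUniformlyOn hFf))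

theorem exists_tendstoL2_approx {Ω : Set ℂ} (hΩ : IsOpen Ω) {f p q : ℂ → ℂ}
    (hf : ContinuousOn f Ω) (hp : MemL2Loc Ω p) (hq : MemL2Loc Ω q) (hpw : IsWeakDz Ω f p)
    (hqw : IsWeakDzbar Ω f q) {K : Set ℂ} (hK : IsCompact K) (hKΩ : K ⊆ Ω) :
    ∃ F : ℕ → ℂ → ℂ, (∀ n, ContDiff ℝ smoothDegree (F n)) ∧ TendstoUniformlyOn F f atTop K ∧
      TendstoL2 (volume.restrict K) (fun n => dz (F n)) p ∧
      TendstoL2 (volume.restrict K) (fun n => dzbar (F n)) q := by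
  obtain ⟨F, h1, h2, h3, h4⟩ := exists_smooth_approx hΩ hf hp hq hpw hqw hK hKΩ
  have hm {u : ℂ → ℂ} (hu : Continuous u) : MemLp u 2 (volume.restrict K) := by
    have : IsFiniteMeasure (volume.restrict K) := ⟨by simpa using hK.measure_lt_top⟩
    simpa using memLp_mul_of_continuousOn hK hu.continuousOn (memLp_const (1 : ℂ))
  exact ⟨F, h1, h2, ⟨fun n => hm (h1 n).dz.continuous, hp K hK hKΩ, h3⟩,
    ⟨fun n => hm (h1 n).dzbar.continuous, hq K hK hKΩ, h4⟩⟩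

theorem setIntegral_mul_tsupport {Ω : Set ℂ} (hΩ : MeasurableSet Ω) {ψ : ℂ → ℂ}
    {K : Set ℂ} (hKΩ : K ⊆ Ω) (hψ : tsupport ψ ⊆ K) (u : ℂ → ℂ) :
    ∫ z in Ω, u z * ψ z = ∫ z in K, u z * ψ z := by
  refine (setIntegral_eq_of_subset_of_forall_sdiff_eq_zero hΩ hKΩ fun z hz => ?_)
  simp [image_eq_zero_of_notMem_tsupport (fun h => hz.2 (hψ h))]

theorem integral_mul_tsupport {ψ : ℂ → ℂ} {K : Set ℂ} (hψ : tsupport ψ ⊆ K) (u : ℂ → ℂ) :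
    ∫ z, u z * ψ z = ∫ z in K, u z * ψ z := by
  rw [← setIntegral_univ, setIntegral_mul_tsupport MeasurableSet.univ (subset_univ K) hψ]

theorem MeasureTheory.MemLp.integrable_fun_mul {ν : Measure ℂ} {u w : ℂ → ℂ} (hu : MemLp u 2 ν)
    (hw : MemLp w 2 ν) : Integrable (fun z => u z * w z) ν :=
  hu.integrable_mul hw

/-- The weak chain rule for `g ∘ f`. For smooth approximations of `f` it is integration by parts; on
the support of `ψ` the functions `g ∘ F n` converge uniformly and their derivatives in `L²`, so both
sides pass to the limit. -/
theorem integral_comp_mul_fderiv {Ω : Set ℂ} (hΩ : IsOpen Ω) {f p q : ℂ → ℂ}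
    (hf : ContinuousOn f Ω) (hp : MemL2Loc Ω p) (hq : MemL2Loc Ω q) (hpw : IsWeakDz Ω f p)
    (hqw : IsWeakDzbar Ω f q) {g : ℂ → ℂ} (hg : ContDiff ℝ smoothDegree g)
    (hgc : HasCompactSupport g) {ψ : ℂ → ℂ} (hψ : IsTestFunction Ω ψ) :
    ∫ z in Ω, g (f z) * dz ψ z =
        - ∫ z in Ω, (dz g (f z) * p z + dzbar g (f z) * conj (q z)) * ψ z ∧
      ∫ z in Ω, g (f z) * dzbar ψ z =
        - ∫ z in Ω, (dz g (f z) * q z + dzbar g (f z) * conj (p z)) * ψ z := by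
  set K := tsupport ψ with hKdef
  have hK : IsCompact K := hψ.2.1
  have : IsFiniteMeasure (volume.restrict K) := ⟨by simpa using hK.measure_lt_top⟩
  obtain ⟨F, hF, hFf, hFp, hFq⟩ := exists_tendstoL2_approx hΩ hf hp hq hpw hqw hK hψ.2.2
  have hm {u : ℂ → ℂ} (hu : Continuous u) : MemLp u 2 (volume.restrict K) := by
    simpa using memLp_mul_of_continuousOn hK hu.continuousOn (memLp_const (1 : ℂ))
  have hgu : TendstoUniformlyOn (fun n z => g (F n z)) (fun z => g (f z)) atTop K :=
    (uniformContinuous_of_hasCompactSupport hg.continuous hgc).comp_tendstoUniformlyOn hFf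
  have hgF (n : ℕ) : ContDiff ℝ smoothDegree (fun z => g (F n z)) := hg.comp (hF n)
  have conv {D : ℂ → ℂ} (hD : Continuous D) :=
    ((tendstoL2_const (hm hD)).mul_tendstoUniformlyOn hK
      (fun n => (hgF n).continuous.continuousOn) hgu).tendsto_integral_mul (memLp_const (1 : ℂ))
  have hψm : MemLp ψ 2 (volume.restrict K) := hm hψ.1.continuous
  constructor
  · have t1 := conv hψ.1.dz.continuous
    have t2 := (TendstoL2.dz_comp hK hF hFf hFp hFq hg hgc).tendsto_integral_mul hψm
    rw [setIntegral_mul_tsupport hΩ.measurableSet hψ.2.2 (tsupport_dz_subset ψ),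
      setIntegral_mul_tsupport hΩ.measurableSet hψ.2.2 subset_rfl]
    simp only [mul_one] at t1
    refine tendsto_nhds_unique t1 (t2.neg.congr fun n => ?_)
    have h0 := integral_dz_eq_zero (ψ := fun z => g (F n z) * ψ z) ((hgF n).mul hψ.1)
      hψ.2.1.mul_left
    have e : dz (fun z => g (F n z) * ψ z) = fun z =>
        dz (fun z => g (F n z)) z * ψ z + g (F n z) * dz ψ z := by
      ext z
      exact dz_mul ((hgF n).differentiable (by simp) _) (hψ.1.differentiable (by simp) _)
    rw [e] at h0
    beta_reduce at h0
    rw [integral_add (f := fun z => dz (fun z => g (F n z)) z * ψ z)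
      (g := fun z => g (F n z) * dz ψ z)
      (((hgF n).dz.continuous.mul hψ.1.continuous).integrable_of_hasCompactSupport hψ.2.1.mul_left)
      (((hgF n).continuous.mul hψ.1.dz.continuous).integrable_of_hasCompactSupport
        hψ.2.1.dz.mul_left),
      integral_mul_tsupport (K := K) subset_rfl,
      integral_mul_tsupport (tsupport_dz_subset ψ)] at h0
    exact (eq_neg_of_add_eq_zero_right h0).symm
  · have t1 := conv hψ.1.dzbar.continuous
    have t2 := (TendstoL2.dzbar_comp hK hF hFf hFp hFq hg hgc).tendsto_integral_mul hψm
    rw [setIntegral_mul_tsupport hΩ.measurableSet hψ.2.2 (tsupport_dzbar_subset ψ),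
      setIntegral_mul_tsupport hΩ.measurableSet hψ.2.2 subset_rfl]
    simp only [mul_one] at t1
    refine tendsto_nhds_unique t1 (t2.neg.congr fun n => ?_)
    have h0 := integral_dzbar_eq_zero (ψ := fun z => g (F n z) * ψ z) ((hgF n).mul hψ.1)
      hψ.2.1.mul_left
    have e : dzbar (fun z => g (F n z) * ψ z) = fun z =>
        dzbar (fun z => g (F n z)) z * ψ z + g (F n z) * dzbar ψ z := by
      ext z
      exact dzbar_mul ((hgF n).differentiable (by simp) _) (hψ.1.differentiable (by simp) _)
    rw [e] at h0
    beta_reduce at h0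
    rw [integral_add (f := fun z => dzbar (fun z => g (F n z)) z * ψ z)
      (g := fun z => g (F n z) * dzbar ψ z)
      (((hgF n).dzbar.continuous.mul hψ.1.continuous).integrable_of_hasCompactSupport
        hψ.2.1.mul_left)
      (((hgF n).continuous.mul hψ.1.dzbar.continuous).integrable_of_hasCompactSupport
        hψ.2.1.dzbar.mul_left),
      integral_mul_tsupport (K := K) subset_rfl,
      integral_mul_tsupport (tsupport_dzbar_subset ψ)] at h0
    exact (eq_neg_of_add_eq_zero_right h0).symm

/-- The change of variables `w = f z` turns the Beltrami equation for `a` into `∂a/∂w̄ = 0`. -/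
theorem integral_mul_dzbar_comp_mul_jacobian {Ω : Set ℂ} (hΩ : IsOpen Ω)
    {μ f p q a pa qa : ℂ → ℂ}
    (hf : ContinuousOn f Ω) (hp : MemL2Loc Ω p) (hq : MemL2Loc Ω q) (hpw : IsWeakDz Ω f p)
    (hqw : IsWeakDzbar Ω f q) (hμ : ∀ᵐ z ∂volume.restrict Ω, q z = μ z * p z)
    (ha : ContinuousOn a Ω) (hpa : MemL2Loc Ω pa) (hqa : MemL2Loc Ω qa) (hpaw : IsWeakDz Ω a pa)
    (hqaw : IsWeakDzbar Ω a qa) (hμa : ∀ᵐ z ∂volume.restrict Ω, qa z = μ z * pa z)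
    {η : ℂ → ℂ} (hη : ContDiff ℝ smoothDegree η) (hηc : HasCompactSupport η) {K : Set ℂ}
    (hK : IsCompact K) (hKΩ : K ⊆ Ω) (hKη : ∀ z ∈ Ω, f z ∈ tsupport η → z ∈ K) :
    ∫ z in Ω, dzbar η (f z) * (a z * (p z * conj (p z) - q z * conj (q z))) = 0 := by
  obtain ⟨χ, hχ, hχ1⟩ := exists_isTestFunction_eq_one hΩ hK hKΩ
  set L := tsupport χ with hLdef
  have hL : IsCompact L := hχ.2.1
  have hLΩ : L ⊆ Ω := hχ.2.2
  have hKL : K ⊆ L := fun z hz => subset_closure (by simp [(hχ1 z hz).eq_of_nhds])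
  obtain ⟨F, hF, hFf, hFp, hFq⟩ := exists_tendstoL2_approx hΩ hf hp hq hpw hqw hL hLΩ
  obtain ⟨A, hA, hAa, hAp, hAq⟩ := exists_tendstoL2_approx hΩ ha hpa hqa hpaw hqaw hL hLΩ
  have : IsFiniteMeasure (volume.restrict L) := ⟨by simpa using hL.measure_lt_top⟩
  have hm {u : ℂ → ℂ} (hu : Continuous u) : MemLp u 2 (volume.restrict L) := by
    simpa using memLp_mul_of_continuousOn hL hu.continuousOn (memLp_const (1 : ℂ))
  have hηu : TendstoUniformlyOn (fun n z => η (F n z)) (fun z => η (f z)) atTop L :=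
    (uniformContinuous_of_hasCompactSupport hη.continuous hηc).comp_tendstoUniformlyOn hFf
  have hηF (n : ℕ) : ContDiff ℝ smoothDegree (fun z => η (F n z)) := hη.comp (hF n)
  have hηFc (n : ℕ) : ContinuousOn (fun z => η (F n z)) L := (hηF n).continuous.continuousOn
  have hAc (n : ℕ) : ContinuousOn (A n) L := (hA n).continuous.continuousOn
  have hd {u : ℂ → ℂ} (hu : ContDiff ℝ smoothDegree u) (z : ℂ) : DifferentiableAt ℝ u z :=
    hu.differentiable (by simp) z
  -- On `Ω`, `η ∘ f` vanishes off `K`, but `η ∘ F n` need not. The cutoff `χ` turns the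
  -- approximation of `a η(f)` into a genuine test function, which pairs to zero with the closed
  -- form `p dz + q dz̄`.
  set G : ℕ → ℂ → ℂ := fun n z => χ z * (A n z * η (F n z)) with hG
  have hGt (n : ℕ) : IsTestFunction Ω (G n) ∧ tsupport (G n) ⊆ L := by
    have : tsupport (G n) ⊆ L := tsupport_mul_subset_left
    exact ⟨⟨hχ.1.mul ((hA n).mul (hηF n)), hχ.2.1.mul_right, this.trans hLΩ⟩, this⟩
  have ez (n : ℕ) (z : ℂ) : dz (G n) z = A n z * (η (F n z) * dz χ z) +
      χ z * (η (F n z) * dz (A n) z + A n z * dz (fun z => η (F n z)) z) := by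
    rw [hG, dz_mul (hd hχ.1 z) (hd ((hA n).mul (hηF n)) z), dz_mul (hd (hA n) z) (hd (hηF n) z)]
    ring
  have ezb (n : ℕ) (z : ℂ) : dzbar (G n) z = A n z * (η (F n z) * dzbar χ z) +
      χ z * (η (F n z) * dzbar (A n) z + A n z * dzbar (fun z => η (F n z)) z) := by
    rw [hG, dzbar_mul (hd hχ.1 z) (hd ((hA n).mul (hηF n)) z),
      dzbar_mul (hd (hA n) z) (hd (hηF n) z)]
    ring
  have tz := ((((tendstoL2_const (hm hχ.1.dz.continuous)).mul_tendstoUniformlyOn hL hηFc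
    hηu).mul_tendstoUniformlyOn hL hAc hAa).add
    (((hAp.mul_tendstoUniformlyOn hL hηFc hηu).add
      ((TendstoL2.dz_comp hL hF hFf hFp hFq hη hηc).mul_tendstoUniformlyOn hL hAc
        hAa)).mul_continuousOn hL hχ.1.continuous.continuousOn))
  have tzb := ((((tendstoL2_const (hm hχ.1.dzbar.continuous)).mul_tendstoUniformlyOn hL hηFc
    hηu).mul_tendstoUniformlyOn hL hAc hAa).add
    (((hAq.mul_tendstoUniformlyOn hL hηFc hηu).add
      ((TendstoL2.dzbar_comp hL hF hFf hFp hFq hη hηc).mul_tendstoUniformlyOn hL hAc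
        hAa)).mul_continuousOn hL hχ.1.continuous.continuousOn))
  have hpL := hp L hL hLΩ
  have hqL := hq L hL hLΩ
  have key := tendsto_nhds_unique (tz.tendsto_integral_mul hqL)
    ((tzb.tendsto_integral_mul hpL).congr fun n => by
      have h0 := integral_dzbar_mul_sub_dz_mul hpw hqw (hGt n).1
      rw [setIntegral_mul_tsupport hΩ.measurableSet hLΩ
          ((tsupport_dz_subset _).trans (hGt n).2),
        setIntegral_mul_tsupport hΩ.measurableSet hLΩ
          ((tsupport_dzbar_subset _).trans (hGt n).2)] at h0
      simp only [ez, ezb] at h0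
      simpa only [mul_comm] using h0)
  rw [← sub_eq_zero, ← integral_sub (tz.2.1.integrable_fun_mul hqL)
    (tzb.2.1.integrable_fun_mul hpL)] at key
  have hηK {z : ℂ} (hz : z ∈ L) (hzK : z ∉ K) : η (f z) = 0 ∧ dzbar η (f z) = 0 := by
    have : f z ∉ tsupport η := fun h => hzK (hKη z (hLΩ hz) h)
    exact ⟨image_eq_zero_of_notMem_tsupport this,
      image_eq_zero_of_notMem_tsupport (fun h => this (tsupport_dzbar_subset _ h))⟩
  have hχK {z : ℂ} (hz : z ∈ K) : χ z = 1 ∧ dz χ z = 0 ∧ dzbar χ z = 0 := by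
    have h1 := (hχ1 z hz).fderiv_eq (𝕜 := ℝ)
    refine ⟨(hχ1 z hz).eq_of_nhds, ?_, ?_⟩ <;> simp [dz, dzbar, h1]
  have hLeq : ∫ z in L, dzbar η (f z) * (a z * (p z * conj (p z) - q z * conj (q z))) = 0 := by
    rw [← neg_eq_zero, ← integral_neg, ← key]
    refine integral_congr_ae ?_
    have hres : ∀ᵐ z ∂volume.restrict L, q z = μ z * p z ∧ qa z = μ z * pa z :=
      ae_restrict_of_ae_restrict_of_subset hLΩ (hμ.and hμa)
    filter_upwards [hres, ae_restrict_mem hL.measurableSet] with z hz hzL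
    -- This is `da ∧ df = 0`: two solutions with the same `μ` have proportional differentials. Only
    -- the term with `∂η/∂w̄` times the Jacobian survives.
    have e : qa z * p z = pa z * q z := by rw [hz.1, hz.2]; ring
    by_cases hzK : z ∈ K
    · obtain ⟨c1, c2, c3⟩ := hχK hzK
      simp only [c1, c2, c3]
      linear_combination η (f z) * e
    · obtain ⟨c1, c2⟩ := hηK hzL hzK
      simp only [c1, c2]
      ring
  rw [← hLeq]
  refine setIntegral_eq_of_subset_of_forall_sdiff_eq_zero hΩ.measurableSet hLΩ fun z hz => ?_
  have : f z ∉ tsupport η := fun h => hz.2 (hKL (hKη z hz.1 h))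
  rw [image_eq_zero_of_notMem_tsupport (fun h => this (tsupport_dzbar_subset _ h)), zero_mul]

/-! ### Continuous solutions of the Beltrami equation -/

/-- `f` is a continuous solution of the Beltrami equation with weak derivatives `p` and `q`. -/
structure IsContinuousBeltramiSolution (Ω : Set ℂ) (μ f p q : ℂ → ℂ) : Prop where
  continuousOn : ContinuousOn f Ω
  memL2Loc_dz : MemL2Loc Ω p
  memL2Loc_dzbar : MemL2Loc Ω q
  isWeakDz : IsWeakDz Ω f p
  isWeakDzbar : IsWeakDzbar Ω f q
  eq_mul : ∀ᵐ z ∂volume.restrict Ω, q z = μ z * p z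

theorem IsContinuousBeltramiSolution.mono {Ω D : Set ℂ} {μ f p q : ℂ → ℂ}
    (h : IsContinuousBeltramiSolution Ω μ f p q) (hΩ : MeasurableSet Ω) (hD : D ⊆ Ω) :
    IsContinuousBeltramiSolution D μ f p q where
  continuousOn := h.continuousOn.mono hD
  memL2Loc_dz K hK hKD := h.memL2Loc_dz K hK (hKD.trans hD)
  memL2Loc_dzbar K hK hKD := h.memL2Loc_dzbar K hK (hKD.trans hD)
  isWeakDz ψ hψ := by
    have := h.isWeakDz ψ ⟨hψ.1, hψ.2.1, hψ.2.2.trans hD⟩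
    rwa [setIntegral_mul_tsupport hΩ hD ((tsupport_dz_subset ψ).trans hψ.2.2),
      setIntegral_mul_tsupport hΩ hD hψ.2.2] at this
  isWeakDzbar ψ hψ := by
    have := h.isWeakDzbar ψ ⟨hψ.1, hψ.2.1, hψ.2.2.trans hD⟩
    rwa [setIntegral_mul_tsupport hΩ hD ((tsupport_dzbar_subset ψ).trans hψ.2.2),
      setIntegral_mul_tsupport hΩ hD hψ.2.2] at this
  eq_mul := ae_restrict_of_ae_restrict_of_subset hD h.eq_mul

/-- Allows `a = 1` in the change of variables, which controls the total weight of the mollifier. -/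
theorem isContinuousBeltramiSolution_one (Ω : Set ℂ) (μ : ℂ → ℂ) :
    IsContinuousBeltramiSolution Ω μ (fun _ => 1) (fun _ => 0) (fun _ => 0) where
  continuousOn := continuousOn_const
  memL2Loc_dz K hK hKΩ := MemLp.zero
  memL2Loc_dzbar K hK hKΩ := MemLp.zero
  isWeakDz ψ hψ := by
    have h := setIntegral_mul_tsupport MeasurableSet.univ (subset_univ Ω)
      ((tsupport_dz_subset ψ).trans hψ.2.2) (fun _ => 1)
    simp only [one_mul, setIntegral_univ, integral_dz_eq_zero hψ.1 hψ.2.1] at h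
    simp [← h]
  isWeakDzbar ψ hψ := by
    have h := setIntegral_mul_tsupport MeasurableSet.univ (subset_univ Ω)
      ((tsupport_dzbar_subset ψ).trans hψ.2.2) (fun _ => 1)
    simp only [one_mul, setIntegral_univ, integral_dzbar_eq_zero hψ.1 hψ.2.1] at h
    simp [← h]
  eq_mul := by simp

theorem tendsto_mollify_of_continuousAt {g : ℂ → ℂ} (hg : AEStronglyMeasurable g volume) {z : ℂ}
    (hz : ContinuousAt g z) : Tendsto (fun n => mollify (bumpSeq n) g z) atTop (𝓝 (g z)) := by
  rw [Metric.tendsto_nhds]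
  intro ε hε
  obtain ⟨δ, hδ0, hδ⟩ := Metric.continuousAt_iff.1 hz (ε / 2) (by positivity)
  filter_upwards [tendsto_bumpSeq_rOut.eventually_lt_const hδ0] with n hn
  exact ((bumpSeq n).dist_normed_convolution_le hg fun x hx =>
    (hδ ((Metric.mem_ball.1 hx).trans hn)).le).trans_lt (by linarith)

/-- A continuous function with vanishing weak derivatives on a disc is constant there. -/
theorem eq_of_weak_derivatives_eq_zero {Ω : Set ℂ} (hΩ : MeasurableSet Ω) {f p q : ℂ → ℂ}
    (hf : ContinuousOn f Ω) (hp : IsWeakDz Ω f p) (hq : IsWeakDzbar Ω f q) {z₀ : ℂ} {r : ℝ}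
    (hr : Metric.closedBall z₀ r ⊆ Ω)
    (h0 : ∀ᵐ z ∂volume.restrict (Metric.closedBall z₀ r), p z = 0 ∧ q z = 0)
    {z : ℂ} (hz : z ∈ Metric.ball z₀ r) : f z = f z₀ := by
  set K := Metric.closedBall z₀ r with hK
  have hKc : IsCompact K := isCompact_closedBall _ _
  have hgi : Integrable (K.indicator f) :=
    (integrable_indicator_iff hKc.measurableSet).2 ((hf.mono hr).integrableOn_compact hKc)
  rw [Metric.mem_ball] at hz
  have hr0 : 0 < r := dist_nonneg.trans_lt hz
  obtain ⟨s, hs, hsr⟩ := exists_between hz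
  have hs0 : 0 < s := dist_nonneg.trans_lt hs
  have hcont (x : ℂ) (hx : dist x z₀ < r) :
      Tendsto (fun n => mollify (bumpSeq n) (K.indicator f) x) atTop (𝓝 (f x)) := by
    have hKx : K ∈ 𝓝 x := mem_of_superset (Metric.isOpen_ball.mem_nhds (Metric.mem_ball.2 hx))
      Metric.ball_subset_closedBall
    have e : K.indicator f =ᶠ[𝓝 x] f := by
      filter_upwards [hKx] with y hy
      simp [hy]
    rw [← e.eq_of_nhds]
    exact tendsto_mollify_of_continuousAt hgi.1
      ((continuousAt_congr e).2 (hf.continuousAt (mem_of_superset hKx hr)))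
  refine tendsto_nhds_unique (hcont z hz) ((hcont z₀ (by simpa using hr0)).congr' ?_)
  have hzero (u : ℂ → ℂ) (hu : ∀ᵐ z ∂volume.restrict K, u z = 0) (n : ℕ) (x : ℂ) :
      mollify (bumpSeq n) (K.indicator u) x = 0 := by
    rw [mollify_eq]
    refine integral_eq_zero_of_ae ?_
    filter_upwards [(ae_restrict_iff' hKc.measurableSet).1 hu] with y hy
    by_cases hyK : y ∈ K
    · simp [hyK, hy hyK]
    · simp [hyK]
  -- For kernel radii below `r - s`, the mollification has zero differential on the ball of radius
  -- `s`, which contains both `z` and `z₀`.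
  filter_upwards [tendsto_bumpSeq_rOut.eventually_lt_const (sub_pos.2 hsr)] with n hn
  refine Metric.isOpen_ball.is_const_of_fderiv_eq_zero (𝕜 := ℝ) (s := Metric.ball z₀ s)
    (convex_ball z₀ s).isPreconnected
    ((contDiff_mollify _ hgi.locallyIntegrable).differentiable (by simp)).differentiableOn
    (fun x hx => ?_) (Metric.mem_ball_self hs0) (Metric.mem_ball.2 hs)
  have hball : Metric.closedBall x (bumpSeq n).rOut ⊆ K :=
    Metric.closedBall_subset_closedBall' (by linarith [Metric.mem_ball.1 hx])
  ext v
  rw [fderiv_eq_dz_add_dzbar, dz_mollify_indicator hΩ hr hp hgi _ hball,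
    dzbar_mollify_indicator hΩ hr hq hgi _ hball, hzero p (h0.mono fun _ h => h.1),
    hzero q (h0.mono fun _ h => h.2)]
  simp

/-- The Jacobian of a function with Wirtinger derivatives `p` and `q`. -/
noncomputable def wirtingerJacobian (p q : ℂ → ℂ) (z : ℂ) : ℝ := ‖p z‖ ^ 2 - ‖q z‖ ^ 2

theorem ofReal_wirtingerJacobian (p q : ℂ → ℂ) (z : ℂ) :
    (wirtingerJacobian p q z : ℂ) = p z * conj (p z) - q z * conj (q z) := by
  simp [wirtingerJacobian, Complex.mul_conj, Complex.normSq_eq_norm_sq]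

/-- By the equation the Jacobian equals `(1 - |μ|²) |p|²`, with a positive first factor. -/
theorem IsContinuousBeltramiSolution.jacobian_nonneg {Ω : Set ℂ} {μ f p q : ℂ → ℂ}
    (h : IsContinuousBeltramiSolution Ω μ f p q) (hμ : ∀ᵐ z ∂volume.restrict Ω, ‖μ z‖ < 1) :
    ∀ᵐ z ∂volume.restrict Ω, 0 ≤ wirtingerJacobian p q z ∧
      (wirtingerJacobian p q z = 0 → p z = 0 ∧ q z = 0) := by
  filter_upwards [h.eq_mul, hμ] with z hz hμz
  have e : wirtingerJacobian p q z = (1 - ‖μ z‖ ^ 2) * ‖p z‖ ^ 2 := by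
    rw [wirtingerJacobian, hz, norm_mul]; ring
  have h1 : 0 < 1 - ‖μ z‖ ^ 2 := by nlinarith [norm_nonneg (μ z)]
  refine ⟨by rw [e]; positivity, fun h0 => ?_⟩
  rw [e, mul_eq_zero, or_iff_right h1.ne'] at h0
  have : p z = 0 := by simpa using h0
  exact ⟨this, by rw [hz, this, mul_zero]⟩

theorem MemL2Loc.integrable_jacobian {Ω : Set ℂ} {p q : ℂ → ℂ} (hp : MemL2Loc Ω p)
    (hq : MemL2Loc Ω q) {K : Set ℂ} (hK : IsCompact K) (hKΩ : K ⊆ Ω) :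
    IntegrableOn (wirtingerJacobian p q) K :=
  (hp K hK hKΩ).norm.integrable_sq.sub (hq K hK hKΩ).norm.integrable_sq

/-- The mollification of `a ∘ f⁻¹`, weighted with the Jacobian of `f`, where `f` is restricted to
`D`, as an integral over the domain of `f`. -/
noncomputable def weightedMollify (D : Set ℂ) (f p q : ℂ → ℂ) (φ : ContDiffBump (0 : ℂ))
    (a : ℂ → ℂ) (w : ℂ) : ℂ :=
  ∫ z in D, φ.kernel (w - f z) * (a z * wirtingerJacobian p q z)

/-! ### Mollification in the variable `w = f z` on a disc -/

section Disc

variable {Ω : Set ℂ} {μ f p q : ℂ → ℂ} {z₀ : ℂ} {r R : ℝ}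

theorem IsContinuousBeltramiSolution.integrableOn_mul_jacobian
    (hf : IsContinuousBeltramiSolution Ω μ f p q) (hr : Metric.closedBall z₀ r ⊆ Ω) {a : ℂ → ℂ}
    (ha : ContinuousOn a Ω) :
    IntegrableOn (fun z => a z * (wirtingerJacobian p q z : ℂ)) (Metric.ball z₀ r) := by
  have hK := isCompact_closedBall z₀ r
  have h1 := (hf.memL2Loc_dz.integrable_jacobian hf.memL2Loc_dzbar hK hr).ofReal (𝕜 := ℂ)
  have h2 := memLp_mul_of_continuousOn hK (ha.mono hr) (memLp_one_iff_integrable.2 h1)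
  exact IntegrableOn.mono_set (memLp_one_iff_integrable.1 h2) Metric.ball_subset_closedBall

theorem IsContinuousBeltramiSolution.aemeasurable (hf : IsContinuousBeltramiSolution Ω μ f p q)
    (hr : Metric.closedBall z₀ r ⊆ Ω) : AEMeasurable f (volume.restrict (Metric.ball z₀ r)) :=
  (hf.continuousOn.mono (Metric.ball_subset_closedBall.trans hr)).aemeasurable
    Metric.isOpen_ball.measurableSet

theorem differentiable_real_weightedMollify
    (hf : IsContinuousBeltramiSolution Ω μ f p q) (hr : Metric.closedBall z₀ r ⊆ Ω) {a : ℂ → ℂ}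
    (ha : ContinuousOn a Ω) (φ : ContDiffBump (0 : ℂ)) :
    Differentiable ℝ (weightedMollify (Metric.ball z₀ r) f p q φ a) := fun w =>
  (hasFDerivAt_integral_comp_sub_mul (hf.aemeasurable hr)
    (hf.integrableOn_mul_jacobian hr ha) φ.contDiff_kernel φ.hasCompactSupport_kernel
    w).differentiableAt

/-- This is `integral_mul_dzbar_comp_mul_jacobian` for `η(x) = ρ(w - x)` on the open disc. The
factor `2` in `hR` pays for the distance from `w` to `f z₀` and for the kernel radius, both below
`R`: points of the circle are never mapped into the support of the kernel. -/
theorem dzbar_weightedMollify (hΩ : IsOpen Ω) (hf : IsContinuousBeltramiSolution Ω μ f p q)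
    (hr : Metric.closedBall z₀ r ⊆ Ω)
    (hR : ∀ z ∈ Metric.sphere z₀ r, 2 * R ≤ dist (f z) (f z₀)) {a pa qa : ℂ → ℂ}
    (ha : IsContinuousBeltramiSolution Ω μ a pa qa) (φ : ContDiffBump (0 : ℂ)) (hφ : φ.rOut < R)
    {w : ℂ} (hw : w ∈ Metric.ball (f z₀) R) :
    dzbar (weightedMollify (Metric.ball z₀ r) f p q φ a) w = 0 := by
  have e : dzbar (weightedMollify (Metric.ball z₀ r) f p q φ a) w =
      ∫ z in Metric.ball z₀ r, dzbar φ.kernel (w - f z) * (a z * wirtingerJacobian p q z) :=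
    dzbar_integral_comp_sub_mul (hf.aemeasurable hr)
      (hf.integrableOn_mul_jacobian hr ha.continuousOn) φ.contDiff_kernel
      φ.hasCompactSupport_kernel w
  rw [e]
  have hD : Metric.ball z₀ r ⊆ Ω := Metric.ball_subset_closedBall.trans hr
  have hf' := hf.mono hΩ.measurableSet hD
  have ha' := ha.mono hΩ.measurableSet hD
  obtain ⟨hη, hηs⟩ := φ.isTestFunction_kernel_sub w (subset_univ _)
  have hK : IsCompact (Metric.closedBall z₀ r ∩ f ⁻¹' Metric.closedBall w φ.rOut) :=
    (isCompact_closedBall z₀ r).of_isClosed_subset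
      ((hf.continuousOn.mono hr).preimage_isClosed_of_isClosed Metric.isClosed_closedBall
        Metric.isClosed_closedBall) inter_subset_left
  have hKD : Metric.closedBall z₀ r ∩ f ⁻¹' Metric.closedBall w φ.rOut ⊆ Metric.ball z₀ r := by
    rintro z ⟨hz, hzw⟩
    rcases (Metric.mem_closedBall.1 hz).lt_or_eq with h | h
    · exact h
    · have h1 := hR z h
      have h2 := dist_triangle (f z) w (f z₀)
      have h3 : dist (f z) w ≤ φ.rOut := hzw
      have h4 := Metric.mem_ball.1 hw
      linarith
  have key := integral_mul_dzbar_comp_mul_jacobian Metric.isOpen_ball hf'.continuousOn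
    hf'.memL2Loc_dz hf'.memL2Loc_dzbar hf'.isWeakDz hf'.isWeakDzbar hf'.eq_mul ha'.continuousOn
    ha'.memL2Loc_dz ha'.memL2Loc_dzbar ha'.isWeakDz ha'.isWeakDzbar ha'.eq_mul hη.1 hη.2.1 hK hKD
    (fun z hz hzη => ⟨Metric.ball_subset_closedBall hz, hηs hzη⟩)
  simp only [dzbar_const_sub (φ.contDiff_kernel.differentiable (by simp) _), neg_mul,
    integral_neg, neg_eq_zero] at key
  simpa only [ofReal_wirtingerJacobian] using key

theorem differentiableOn_weightedMollify (hΩ : IsOpen Ω)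
    (hf : IsContinuousBeltramiSolution Ω μ f p q) (hr : Metric.closedBall z₀ r ⊆ Ω)
    (hR : ∀ z ∈ Metric.sphere z₀ r, 2 * R ≤ dist (f z) (f z₀)) {a pa qa : ℂ → ℂ}
    (ha : IsContinuousBeltramiSolution Ω μ a pa qa) (φ : ContDiffBump (0 : ℂ))
    (hφ : φ.rOut < R) :
    DifferentiableOn ℂ (weightedMollify (Metric.ball z₀ r) f p q φ a)
      (Metric.ball (f z₀) R) := fun w hw =>
  (differentiableAt_complex_of_dzbar_eq_zero
    (differentiable_real_weightedMollify hf hr ha.continuousOn φ w)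
    (dzbar_weightedMollify hΩ hf hr hR ha φ hφ hw)).differentiableWithinAt

theorem weightedMollify_one_eq_ofReal (φ : ContDiffBump (0 : ℂ)) (D : Set ℂ) (w : ℂ) :
    weightedMollify D f p q φ (fun _ => 1) w =
      ((∫ z in D, φ.normed volume (w - f z) * wirtingerJacobian p q z : ℝ) : ℂ) := by
  rw [weightedMollify, ← integral_complex_ofReal]
  simp [ContDiffBump.kernel]

/-- A real-valued function with `∂T/∂w̄ = 0` has zero differential. The constancy of this weight
plays the role of the local constancy of the degree. -/
theorem weightedMollify_one_eq (hΩ : IsOpen Ω) (hf : IsContinuousBeltramiSolution Ω μ f p q)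
    (hr : Metric.closedBall z₀ r ⊆ Ω)
    (hR : ∀ z ∈ Metric.sphere z₀ r, 2 * R ≤ dist (f z) (f z₀)) (φ : ContDiffBump (0 : ℂ))
    (hφ : φ.rOut < R) {w : ℂ} (hw : w ∈ Metric.ball (f z₀) R) :
    weightedMollify (Metric.ball z₀ r) f p q φ (fun _ => 1) w =
      weightedMollify (Metric.ball z₀ r) f p q φ (fun _ => 1) (f z₀) := by
  set T := weightedMollify (Metric.ball z₀ r) f p q φ (fun _ => 1) with hT
  have hd : Differentiable ℝ T :=
    differentiable_real_weightedMollify hf hr continuousOn_const φ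
  have him (x v : ℂ) : (fderiv ℝ T x v).im = 0 := by
    have h1 : HasFDerivAt (fun y => (T y).im) (Complex.imCLM.comp (fderiv ℝ T x)) x :=
      Complex.imCLM.hasFDerivAt.comp x (hd x).hasFDerivAt
    have h2 : (fun y => (T y).im) = fun _ => 0 := by
      ext y
      rw [hT, weightedMollify_one_eq_ofReal, Complex.ofReal_im]
    rw [h2] at h1
    simpa using congrArg (fun L => L v) (h1.unique (hasFDerivAt_const (0 : ℝ) x))
  refine Metric.isOpen_ball.is_const_of_fderiv_eq_zero (𝕜 := ℝ) (s := Metric.ball (f z₀) R)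
    (convex_ball _ _).isPreconnected hd.differentiableOn (fun x hx => ?_) hw
    (Metric.mem_ball_self (φ.rOut_pos.trans hφ))
  have h0 := dzbar_weightedMollify hΩ hf hr hR
    (isContinuousBeltramiSolution_one Ω μ) φ hφ hx
  rw [← hT, dzbar, div_eq_zero_iff, or_iff_left two_ne_zero] at h0
  have hre := congrArg Complex.re h0
  have hi := congrArg Complex.im h0
  simp [him] at hre hi
  ext v
  rw [ContinuousLinearMap.apply_eq_re_im]
  have e1 : fderiv ℝ T x 1 = 0 := Complex.ext hre (him x 1)
  have e2 : fderiv ℝ T x Complex.I = 0 := Complex.ext hi (him x _)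
  simp [e1, e2]

end Disc

/-! ### Positivity of the weight and openness of injective solutions -/

section Disc

variable {Ω : Set ℂ} {μ f p q : ℂ → ℂ} {z₀ : ℂ} {r R : ℝ}

/-- If the integral vanished, the Jacobian would be zero almost everywhere where the kernel is
positive, in particular near `z₀`. Both weak derivatives would then vanish there and `f` would be
locally constant, against injectivity. -/
theorem integral_kernel_mul_jacobian_pos (hΩ : IsOpen Ω)
    (hf : IsContinuousBeltramiSolution Ω μ f p q) (hμ : ∀ᵐ z ∂volume.restrict Ω, ‖μ z‖ < 1)
    (hfi : InjOn f Ω) (hr0 : 0 < r) (hr : Metric.closedBall z₀ r ⊆ Ω) (φ : ContDiffBump (0 : ℂ)) :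
    0 < ∫ z in Metric.ball z₀ r, φ.normed volume (f z₀ - f z) * wirtingerJacobian p q z := by
  have hD : Metric.ball z₀ r ⊆ Ω := Metric.ball_subset_closedBall.trans hr
  have hJ := ae_restrict_of_ae_restrict_of_subset hD (hf.jacobian_nonneg hμ)
  have hz₀ : z₀ ∈ Ω := hD (Metric.mem_ball_self hr0)
  have hnn : 0 ≤ᵐ[volume.restrict (Metric.ball z₀ r)]
      fun z => φ.normed volume (f z₀ - f z) * wirtingerJacobian p q z := by
    filter_upwards [hJ] with z hz
    exact mul_nonneg (φ.nonneg_normed _) hz.1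
  refine lt_of_le_of_ne (integral_nonneg_of_ae hnn) fun h0 => ?_
  have hi : IntegrableOn (fun z => φ.normed volume (f z₀ - f z) * wirtingerJacobian p q z)
      (Metric.ball z₀ r) := by
    have := integrable_comp_sub_mul (hf.aemeasurable hr)
      (hf.integrableOn_mul_jacobian hr (a := fun _ => 1) continuousOn_const)
      φ.contDiff_kernel.continuous φ.hasCompactSupport_kernel (f z₀)
    rw [IntegrableOn]
    simpa [ContDiffBump.kernel] using this.re
  have hae := (integral_eq_zero_iff_of_nonneg_ae hnn hi).1 h0.symm
  obtain ⟨s, hs0, hs⟩ : ∃ s > 0, Metric.closedBall z₀ s ⊆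
      Metric.ball z₀ r ∩ {z | f z ∈ Metric.ball (f z₀) φ.rOut} := by
    refine Metric.nhds_basis_closedBall.mem_iff.1 (inter_mem (Metric.ball_mem_nhds _ hr0) ?_)
    exact (hf.continuousOn.continuousAt (hΩ.mem_nhds hz₀)).preimage_mem_nhds
      (Metric.ball_mem_nhds _ φ.rOut_pos)
  have hsD : Metric.closedBall z₀ s ⊆ Metric.ball z₀ r := fun z hz => (hs hz).1
  have hpq : ∀ᵐ z ∂volume.restrict (Metric.closedBall z₀ s), p z = 0 ∧ q z = 0 := by
    filter_upwards [ae_restrict_of_ae_restrict_of_subset hsD hJ,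
      ae_restrict_of_ae_restrict_of_subset hsD hae,
      ae_restrict_mem Metric.isClosed_closedBall.measurableSet] with z h1 h2 h3
    refine h1.2 ((mul_eq_zero.1 h2).resolve_left fun h4 => ?_)
    have : f z₀ - f z ∈ Function.support (φ.normed volume) := by
      rw [φ.support_normed_eq, Metric.mem_ball, dist_zero_right, ← dist_eq_norm, dist_comm]
      exact (hs h3).2
    exact this h4
  have hconst : f (z₀ + (s / 2 : ℝ)) = f z₀ :=
    eq_of_weak_derivatives_eq_zero hΩ.measurableSet hf.continuousOn hf.isWeakDz hf.isWeakDzbar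
      (hsD.trans hD) hpq (by
        rw [Metric.mem_ball, dist_eq_norm, add_sub_cancel_left, Complex.norm_real,
          Real.norm_of_nonneg (by positivity)]
        linarith)
  have hmem : z₀ + (s / 2 : ℝ) ∈ Metric.closedBall z₀ s := by
    rw [Metric.mem_closedBall, dist_eq_norm, add_sub_cancel_left, Complex.norm_real,
      Real.norm_of_nonneg (by positivity)]
    linarith
  have := hfi (hD (hsD hmem)) hz₀ hconst
  rw [add_eq_left, Complex.ofReal_eq_zero] at this
  linarith

/-- A degree argument: an omitted value `w` has positive distance from the compact image, so a sharp
kernel at `w` gives total weight zero, whereas this weight equals the positive one at `f z₀`. -/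
theorem ball_subset_image_closedBall (hΩ : IsOpen Ω)
    (hf : IsContinuousBeltramiSolution Ω μ f p q) (hμ : ∀ᵐ z ∂volume.restrict Ω, ‖μ z‖ < 1)
    (hfi : InjOn f Ω) (hr0 : 0 < r) (hr : Metric.closedBall z₀ r ⊆ Ω)
    (hR : ∀ z ∈ Metric.sphere z₀ r, 2 * R ≤ dist (f z) (f z₀)) :
    Metric.ball (f z₀) R ⊆ f '' Metric.closedBall z₀ r := by
  intro w hw
  by_contra hwn
  have hR0 : 0 < R := dist_nonneg.trans_lt (Metric.mem_ball.1 hw)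
  have hcl : IsClosed (f '' Metric.closedBall z₀ r) :=
    ((isCompact_closedBall z₀ r).image_of_continuousOn (hf.continuousOn.mono hr)).isClosed
  obtain ⟨d, hd0, hd⟩ := Metric.mem_nhds_iff.1 (hcl.isOpen_compl.mem_nhds hwn)
  obtain ⟨n, hn⟩ := (tendsto_bumpSeq_rOut.eventually_lt_const (lt_min hR0 hd0)).exists
  have h1 := weightedMollify_one_eq hΩ hf hr hR (bumpSeq n) (hn.trans_le (min_le_left _ _)) hw
  rw [weightedMollify_one_eq_ofReal, weightedMollify_one_eq_ofReal, Complex.ofReal_inj] at h1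
  have h2 := integral_kernel_mul_jacobian_pos hΩ hf hμ hfi hr0 hr (bumpSeq n)
  rw [← h1] at h2
  refine h2.ne' (setIntegral_eq_zero_of_forall_eq_zero fun z hz => ?_)
  have : w - f z ∉ Function.support ((bumpSeq n).normed volume) := by
    intro h
    rw [(bumpSeq n).support_normed_eq, Metric.mem_ball, dist_zero_right, ← dist_eq_norm,
      dist_comm] at h
    exact hd (Metric.mem_ball.2 (h.trans (hn.trans_le (min_le_right _ _))))
      ⟨z, Metric.ball_subset_closedBall hz, rfl⟩
  rw [Function.notMem_support.1 this, zero_mul]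

theorem exists_le_dist_of_injOn (hf : ContinuousOn f Ω) (hfi : InjOn f Ω) (hr0 : 0 < r)
    (hr : Metric.closedBall z₀ r ⊆ Ω) :
    ∃ R > 0, ∀ z ∈ Metric.sphere z₀ r, 2 * R ≤ dist (f z) (f z₀) := by
  have hz₀ : z₀ ∈ Ω := hr (Metric.mem_closedBall_self hr0.le)
  have hc : IsCompact (f '' Metric.sphere z₀ r) := (isCompact_sphere z₀ r).image_of_continuousOn
    (hf.mono (Metric.sphere_subset_closedBall.trans hr))
  have hn : f z₀ ∉ f '' Metric.sphere z₀ r := by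
    rintro ⟨z, hz, hzz⟩
    have := hfi (hr (Metric.sphere_subset_closedBall hz)) hz₀ hzz
    rw [this, Metric.mem_sphere, dist_self] at hz
    exact hr0.ne hz
  obtain ⟨d, hd0, hd⟩ := Metric.mem_nhds_iff.1 (hc.isClosed.isOpen_compl.mem_nhds hn)
  refine ⟨d / 2, by positivity, fun z hz => ?_⟩
  by_contra! h
  exact hd (Metric.mem_ball.2 (by linarith)) ⟨z, hz, rfl⟩

end Disc

variable {Ω : Set ℂ} {μ f p q : ℂ → ℂ}

/-- An injective continuous solution of the Beltrami equation is an open map. -/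
theorem IsContinuousBeltramiSolution.isOpen_image (hΩ : IsOpen Ω)
    (hf : IsContinuousBeltramiSolution Ω μ f p q) (hμ : ∀ᵐ z ∂volume.restrict Ω, ‖μ z‖ < 1)
    (hfi : InjOn f Ω) {U : Set ℂ} (hU : IsOpen U) (hUΩ : U ⊆ Ω) : IsOpen (f '' U) := by
  rw [isOpen_iff_mem_nhds]
  rintro _ ⟨z, hz, rfl⟩
  obtain ⟨r, hr0, hr⟩ := Metric.nhds_basis_closedBall.mem_iff.1 (hU.mem_nhds hz)
  obtain ⟨R, hR0, hR⟩ := exists_le_dist_of_injOn hf.continuousOn hfi hr0 (hr.trans hUΩ)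
  exact mem_of_superset (Metric.ball_mem_nhds _ hR0)
    ((ball_subset_image_closedBall hΩ hf hμ hfi hr0 (hr.trans hUΩ) hR).trans (image_mono hr))

theorem IsContinuousBeltramiSolution.continuousOn_invFunOn (hΩ : IsOpen Ω)
    (hf : IsContinuousBeltramiSolution Ω μ f p q) (hμ : ∀ᵐ z ∂volume.restrict Ω, ‖μ z‖ < 1)
    (hfi : InjOn f Ω) : ContinuousOn (Function.invFunOn f Ω) (f '' Ω) := by
  rw [continuousOn_open_iff (hf.isOpen_image hΩ hμ hfi hΩ subset_rfl)]
  intro V hV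
  have e : f '' Ω ∩ Function.invFunOn f Ω ⁻¹' V = f '' (Ω ∩ V) := by
    ext w
    constructor
    · rintro ⟨⟨z, hz, rfl⟩, hw⟩
      rw [mem_preimage, hfi.leftInvOn_invFunOn hz] at hw
      exact ⟨z, ⟨hz, hw⟩, rfl⟩
    · rintro ⟨z, ⟨hz, hzV⟩, rfl⟩
      exact ⟨⟨z, hz, rfl⟩, by rwa [mem_preimage, hfi.leftInvOn_invFunOn hz]⟩
  rw [e]
  exact hf.isOpen_image hΩ hμ hfi (hΩ.inter hV) inter_subset_left

/-- **Stoilow factorization**: two continuous solutions of the same Beltrami equation, the first of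
which is injective, differ by a holomorphic function. -/
theorem IsContinuousBeltramiSolution.differentiableOn_comp_invFunOn (hΩ : IsOpen Ω)
    (hf : IsContinuousBeltramiSolution Ω μ f p q) (hμ : ∀ᵐ z ∂volume.restrict Ω, ‖μ z‖ < 1)
    (hfi : InjOn f Ω) {a pa qa : ℂ → ℂ} (ha : IsContinuousBeltramiSolution Ω μ a pa qa) :
    DifferentiableOn ℂ (fun w => a (Function.invFunOn f Ω w)) (f '' Ω) := by
  set h : ℂ → ℂ := fun w => a (Function.invFunOn f Ω w) with hh
  have hinv {z : ℂ} (hz : z ∈ Ω) : h (f z) = a z := by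
    rw [hh]
    exact congrArg a (hfi.leftInvOn_invFunOn hz)
  have hopen := hf.isOpen_image hΩ hμ hfi hΩ subset_rfl
  have hhc : ContinuousOn h (f '' Ω) := ha.continuousOn.comp
    (hf.continuousOn_invFunOn hΩ hμ hfi) (hfi.leftInvOn_invFunOn.mapsTo (surjOn_image f Ω))
  rintro _ ⟨z₀, hz₀, rfl⟩
  refine DifferentiableAt.differentiableWithinAt ?_
  obtain ⟨r, hr0, hr⟩ := Metric.nhds_basis_closedBall.mem_iff.1 (hΩ.mem_nhds hz₀)
  obtain ⟨R₁, hR₁0, hR₁⟩ := exists_le_dist_of_injOn hf.continuousOn hfi hr0 hr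
  obtain ⟨R₂, hR₂0, hR₂⟩ := Metric.nhds_basis_closedBall.mem_iff.1
    (hopen.mem_nhds (mem_image_of_mem f hz₀))
  -- `R₁` keeps the image of the circle away; `R₂ / 2` puts the closed ball of radius `2 * R` inside
  -- the image, where `h` is uniformly continuous. It contains every `f z` that the kernel at `w`
  -- sees.
  set R := min R₁ (R₂ / 2) with hRdef
  have hR0 : 0 < R := by positivity
  have hR : ∀ z ∈ Metric.sphere z₀ r, 2 * R ≤ dist (f z) (f z₀) := fun z hz =>
    (mul_le_mul_of_nonneg_left (min_le_left _ _) zero_le_two).trans (hR₁ z hz)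
  have hR2 : 2 * R ≤ R₂ := by linarith [min_le_right R₁ (R₂ / 2)]
  have hbig : Metric.closedBall (f z₀) (2 * R) ⊆ f '' Ω :=
    (Metric.closedBall_subset_closedBall hR2).trans hR₂
  set D := Metric.ball z₀ r with hDdef
  have hD : D ⊆ Ω := Metric.ball_subset_closedBall.trans hr
  set c : ℕ → ℝ := fun n =>
    ∫ z in D, (bumpSeq n).normed volume (f z₀ - f z) * wirtingerJacobian p q z with hc
  have hc0 (n : ℕ) : 0 < c n := integral_kernel_mul_jacobian_pos hΩ hf hμ hfi hr0 hr (bumpSeq n)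
  have hcw (n : ℕ) (hn : (bumpSeq n).rOut < R) {w : ℂ} (hw : w ∈ Metric.ball (f z₀) R) :
      ∫ z in D, (bumpSeq n).normed volume (w - f z) * wirtingerJacobian p q z = c n := by
    have h1 := weightedMollify_one_eq hΩ hf hr hR (bumpSeq n) hn hw
    rwa [weightedMollify_one_eq_ofReal, weightedMollify_one_eq_ofReal, Complex.ofReal_inj] at h1
  -- On the ball of radius `R`, once the kernel radius is below `R`, the weight has total mass `c n`
  -- for every `w`, so `T n w` is an average of `h (f z) = a z` over points with `f z` close to `w`.
  set T : ℕ → ℂ → ℂ := fun n w => (c n : ℂ)⁻¹ * weightedMollify D f p q (bumpSeq n) a w with hT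
  have hsmall := tendsto_bumpSeq_rOut.eventually_lt_const hR0
  have hlim : TendstoUniformlyOn T h atTop (Metric.ball (f z₀) R) := by
    rw [Metric.tendstoUniformlyOn_iff]
    intro ε hε
    obtain ⟨δ, hδ0, hδ⟩ := Metric.uniformContinuousOn_iff.1
      ((isCompact_closedBall (f z₀) (2 * R)).uniformContinuousOn_of_continuous (hhc.mono hbig))
      (ε / 2) (by positivity)
    filter_upwards [hsmall, tendsto_bumpSeq_rOut.eventually_lt_const hδ0] with n hn hn' w hw
    have hwR : dist w (f z₀) < R := hw
    have hi1 : IntegrableOn (fun z => (bumpSeq n).kernel (w - f z) *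
        (a z * (wirtingerJacobian p q z : ℂ))) D :=
      integrable_comp_sub_mul (hf.aemeasurable hr)
        (hf.integrableOn_mul_jacobian hr ha.continuousOn) (bumpSeq n).contDiff_kernel.continuous
        (bumpSeq n).hasCompactSupport_kernel w
    have hi2 : IntegrableOn (fun z => (bumpSeq n).kernel (w - f z) *
        (1 * (wirtingerJacobian p q z : ℂ))) D :=
      integrable_comp_sub_mul (hf.aemeasurable hr)
        (hf.integrableOn_mul_jacobian hr (a := fun _ => 1) continuousOn_const)
        (bumpSeq n).contDiff_kernel.continuous (bumpSeq n).hasCompactSupport_kernel w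
    have e1 : weightedMollify D f p q (bumpSeq n) (fun _ => 1) w = c n := by
      rw [weightedMollify_one_eq_ofReal, hcw n hn hw]
    have e2 : T n w - h w = (c n : ℂ)⁻¹ * ∫ z in D, ((bumpSeq n).kernel (w - f z) *
        (a z * (wirtingerJacobian p q z : ℂ)) - h w * ((bumpSeq n).kernel (w - f z) *
        (1 * (wirtingerJacobian p q z : ℂ)))) := by
      rw [integral_sub hi1 (hi2.const_mul _), integral_const_mul]
      change _ = (c n : ℂ)⁻¹ * (_ - h w * weightedMollify D f p q (bumpSeq n) (fun _ => 1) w)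
      rw [e1, mul_sub, mul_left_comm, inv_mul_cancel₀ (by exact_mod_cast (hc0 n).ne'), mul_one]
      rfl
    have hJ := ae_restrict_of_ae_restrict_of_subset hD (hf.jacobian_nonneg hμ)
    have e3 : ‖∫ z in D, ((bumpSeq n).kernel (w - f z) *
        (a z * (wirtingerJacobian p q z : ℂ)) - h w * ((bumpSeq n).kernel (w - f z) *
        (1 * (wirtingerJacobian p q z : ℂ))))‖ ≤ ε / 2 * c n := by
      rw [← hcw n hn hw, ← integral_const_mul]
      refine norm_integral_le_of_norm_le ?_ ?_
      · refine Integrable.const_mul ?_ _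
        have := hi2.re
        simpa [ContDiffBump.kernel] using this
      · filter_upwards [hJ, ae_restrict_mem Metric.isOpen_ball.measurableSet] with z hz hzD
        have e4 : (bumpSeq n).kernel (w - f z) * (a z * (wirtingerJacobian p q z : ℂ)) -
            h w * ((bumpSeq n).kernel (w - f z) * (1 * (wirtingerJacobian p q z : ℂ))) =
            (a z - h w) * (((bumpSeq n).normed volume (w - f z) * wirtingerJacobian p q z : ℝ) :
              ℂ) := by
          rw [ContDiffBump.kernel]
          push_cast
          ring
        rw [e4, norm_mul, Complex.norm_real,
          Real.norm_of_nonneg (mul_nonneg ((bumpSeq n).nonneg_normed _) hz.1)]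
        -- Only points with `f z` within the kernel radius of `w` contribute, and there uniform
        -- continuity of `h` applies.
        by_cases hk : (bumpSeq n).normed volume (w - f z) = 0
        · simp [hk]
        · refine mul_le_mul_of_nonneg_right ?_
            (mul_nonneg ((bumpSeq n).nonneg_normed _) hz.1)
          have hk' : w - f z ∈ Function.support ((bumpSeq n).normed volume) := hk
          rw [(bumpSeq n).support_normed_eq, Metric.mem_ball, dist_zero_right,
            ← dist_eq_norm] at hk'
          rw [← hinv (hD hzD), ← dist_eq_norm, dist_comm]
          refine (hδ w ?_ (f z) ?_ (hk'.trans hn')).le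
          · exact Metric.mem_closedBall.2 (by linarith)
          · refine Metric.mem_closedBall.2 ?_
            have := dist_triangle_left (f z) (f z₀) w
            linarith
    rw [dist_comm, dist_eq_norm, e2, norm_mul, norm_inv, Complex.norm_real,
      Real.norm_of_nonneg (hc0 n).le]
    calc (c n)⁻¹ * _ ≤ (c n)⁻¹ * (ε / 2 * c n) :=
          mul_le_mul_of_nonneg_left e3 (inv_nonneg.2 (hc0 n).le)
      _ = ε / 2 := by field_simp [(hc0 n).ne']
      _ < ε := by linarith
  -- Weierstrass: a uniform limit of holomorphic functions is holomorphic.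
  have hdiff : DifferentiableOn ℂ h (Metric.ball (f z₀) R) := by
    refine hlim.tendstoLocallyUniformlyOn.differentiableOn ?_ Metric.isOpen_ball
    filter_upwards [hsmall] with n hn
    exact (differentiableOn_weightedMollify hΩ hf hr hR ha (bumpSeq n) hn).const_mul _
  exact hdiff.differentiableAt (Metric.ball_mem_nhds _ hR0)

/-! ### Solutions composed with holomorphic functions -/

theorem memL2Loc_of_continuousOn {Ω : Set ℂ} {u : ℂ → ℂ} (hu : ContinuousOn u Ω) :
    MemL2Loc Ω u := fun K hK hKΩ => by
  have : IsFiniteMeasure (volume.restrict K) := ⟨by simpa using hK.measure_lt_top⟩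
  simpa using memLp_mul_of_continuousOn hK (hu.mono hKΩ) (memLp_const (1 : ℂ))

theorem contDiff_mul_of_tsupport_subset {V : Set ℂ} (hV : IsOpen V) {χ h : ℂ → ℂ}
    (hχ : IsTestFunction V χ) (hh : DifferentiableOn ℂ h V) :
    ContDiff ℝ smoothDegree (fun w => χ w * h w) := by
  rw [contDiff_iff_contDiffAt]
  intro w
  by_cases hw : w ∈ V
  · exact hχ.1.contDiffAt.mul
      (((hh.contDiffOn hV).contDiffAt (hV.mem_nhds hw)).restrict_scalars ℝ)
  · have e : (fun w => χ w * h w) =ᶠ[𝓝 w] fun _ => 0 := by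
      have h1 := notMem_tsupport_iff_eventuallyEq.1 (fun h => hw (hχ.2.2 h))
      filter_upwards [h1] with x hx
      simp [hx]
    exact contDiffAt_const.congr_of_eventuallyEq e

/-- Post-composition with a holomorphic function preserves solutions of the Beltrami equation. -/
theorem IsContinuousBeltramiSolution.isBeltramiSolution_comp {Ω V : Set ℂ} {μ f p q : ℂ → ℂ}
    (hΩ : IsOpen Ω) (hf : IsContinuousBeltramiSolution Ω μ f p q) (hV : IsOpen V)
    (hfV : MapsTo f Ω V) {h φ : ℂ → ℂ} (hh : DifferentiableOn ℂ h V)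
    (hφ : ∀ z ∈ Ω, φ z = h (f z)) : IsBeltramiSolution Ω μ φ := by
  have hφc : ContinuousOn φ Ω := (hh.continuousOn.comp hf.continuousOn hfV).congr hφ
  have hh' : ContinuousOn (fun z => deriv h (f z)) Ω :=
    (hh.deriv hV).continuousOn.comp hf.continuousOn hfV
  -- The weak chain rule wants a globally smooth, compactly supported outer function. Multiplying
  -- `h` by a cutoff equal to `1` near the compact set `f(supp ψ)` supplies one without changing
  -- anything that `ψ` sees.
  have key (ψ : ℂ → ℂ) (hψ : IsTestFunction Ω ψ) : ∃ g : ℂ → ℂ, ContDiff ℝ smoothDegree g ∧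
      HasCompactSupport g ∧ ∀ z ∈ tsupport ψ, g (f z) = φ z ∧ dz g (f z) = deriv h (f z) ∧
        dzbar g (f z) = 0 := by
    have hKc : IsCompact (f '' tsupport ψ) :=
      hψ.2.1.isCompact.image_of_continuousOn (hf.continuousOn.mono hψ.2.2)
    obtain ⟨χ, hχ, hχ1⟩ := exists_isTestFunction_eq_one hV hKc
      (image_subset_iff.2 fun z hz => hfV (hψ.2.2 hz))
    refine ⟨fun w => χ w * h w, contDiff_mul_of_tsupport_subset hV hχ hh, hχ.2.1.mul_right,
      fun z hz => ?_⟩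
    have e : (fun w => χ w * h w) =ᶠ[𝓝 (f z)] h := by
      filter_upwards [hχ1 (f z) (mem_image_of_mem f hz)] with w hw
      simp [hw]
    have hd : HasDerivAt (fun w => χ w * h w) (deriv h (f z)) (f z) :=
      (hh.differentiableAt (hV.mem_nhds (hfV (hψ.2.2 hz)))).hasDerivAt.congr_of_eventuallyEq e
    exact ⟨by rw [hφ z (hψ.2.2 hz)]; exact e.eq_of_nhds, hd.dz_eq, hd.dzbar_eq⟩
  refine ⟨memL2Loc_of_continuousOn hφc, fun z => deriv h (f z) * p z,
    fun z => deriv h (f z) * q z,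
    fun K hK hKΩ => memLp_mul_of_continuousOn hK (hh'.mono hKΩ) (hf.memL2Loc_dz K hK hKΩ),
    fun K hK hKΩ => memLp_mul_of_continuousOn hK (hh'.mono hKΩ) (hf.memL2Loc_dzbar K hK hKΩ),
    fun ψ hψ => ?_, fun ψ hψ => ?_, ?_⟩
  · obtain ⟨g, hg, hgc, hgφ⟩ := key ψ hψ
    have h1 := (integral_comp_mul_fderiv hΩ hf.continuousOn hf.memL2Loc_dz hf.memL2Loc_dzbar
      hf.isWeakDz hf.isWeakDzbar hg hgc hψ).1
    rw [setIntegral_mul_tsupport hΩ.measurableSet hψ.2.2 (tsupport_dz_subset ψ),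
      setIntegral_mul_tsupport hΩ.measurableSet hψ.2.2 subset_rfl] at h1 ⊢
    rw [setIntegral_congr_fun (isClosed_tsupport ψ).measurableSet fun z hz => ?_, h1,
      setIntegral_congr_fun (isClosed_tsupport ψ).measurableSet fun z hz => ?_]
    · simp [(hgφ z hz).2.1, (hgφ z hz).2.2]
    · simp [(hgφ z hz).1]
  · obtain ⟨g, hg, hgc, hgφ⟩ := key ψ hψ
    have h1 := (integral_comp_mul_fderiv hΩ hf.continuousOn hf.memL2Loc_dz hf.memL2Loc_dzbar
      hf.isWeakDz hf.isWeakDzbar hg hgc hψ).2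
    rw [setIntegral_mul_tsupport hΩ.measurableSet hψ.2.2 (tsupport_dzbar_subset ψ),
      setIntegral_mul_tsupport hΩ.measurableSet hψ.2.2 subset_rfl] at h1 ⊢
    rw [setIntegral_congr_fun (isClosed_tsupport ψ).measurableSet fun z hz => ?_, h1,
      setIntegral_congr_fun (isClosed_tsupport ψ).measurableSet fun z hz => ?_]
    · simp [(hgφ z hz).2.1, (hgφ z hz).2.2]
    · simp [(hgφ z hz).1]
  · filter_upwards [hf.eq_mul] with z hz
    rw [hz]
    ring

/-! ### Riemann-Stieltjes integrals -/

theorem mem_Icc_of_partition {n : ℕ} {t : ℕ → ℝ} (h0 : t 0 = 0) (hn : t n = 1)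
    (ht : ∀ i < n, t i ≤ t (i + 1)) : MonotoneOn t (Iic n) ∧ ∀ i ≤ n, t i ∈ Icc (0 : ℝ) 1 := by
  have hm : MonotoneOn t (Iic n) := by
    intro i _ j hj hij
    induction j, hij using Nat.le_induction with
    | base => exact le_rfl
    | succ k hk ih => exact (ih (Nat.le_of_succ_le hj)).trans (ht k hj)
  refine ⟨hm, fun i hi => ⟨?_, ?_⟩⟩
  · rw [← h0]; exact hm (Nat.zero_le n) hi (Nat.zero_le i)
  · rw [← hn]; exact hm hi (mem_Iic.2 le_rfl) hi

theorem exists_partition {δ : ℝ} (hδ : 0 < δ) : ∃ (n : ℕ) (t : ℕ → ℝ), t 0 = 0 ∧ t n = 1 ∧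
    ∀ i < n, t i ≤ t (i + 1) ∧ t (i + 1) - t i < δ := by
  obtain ⟨n, hn⟩ := exists_nat_one_div_lt hδ
  have hn0 : (0 : ℝ) < n + 1 := by positivity
  refine ⟨n + 1, fun i => i / ((n : ℝ) + 1), by simp, ?_, fun i _ => ⟨?_, ?_⟩⟩
  · push_cast
    exact div_self hn0.ne'
  · push_cast
    gcongr
    linarith
  · have e : ((i + 1 : ℕ) : ℝ) / ((n : ℝ) + 1) - i / ((n : ℝ) + 1) = 1 / ((n : ℝ) + 1) := by
      rw [← sub_div]
      push_cast
      ring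
    exact e.trans_lt hn

theorem HasContourIntegral.unique {f g : ℂ → ℂ} {γ : ℝ → ℂ} {I J : ℂ}
    (hI : HasContourIntegral f g γ I) (hJ : HasContourIntegral f g γ J) : I = J := by
  refine eq_of_forall_dist_le fun ε hε => ?_
  obtain ⟨δ₁, hδ₁, h₁⟩ := hI (ε / 2) (by positivity)
  obtain ⟨δ₂, hδ₂, h₂⟩ := hJ (ε / 2) (by positivity)
  obtain ⟨n, t, h0, hn, ht⟩ := exists_partition (lt_min hδ₁ hδ₂)
  have e₁ := h₁ n t t h0 hn fun i hi =>
    ⟨left_mem_Icc.2 (ht i hi).1, (ht i hi).2.trans_le (min_le_left _ _)⟩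
  have e₂ := h₂ n t t h0 hn fun i hi =>
    ⟨left_mem_Icc.2 (ht i hi).1, (ht i hi).2.trans_le (min_le_right _ _)⟩
  rw [← dist_eq_norm] at e₁ e₂
  have := dist_triangle_left I J
    (∑ i ∈ Finset.range n, f (γ (t i)) * (g (γ (t (i + 1))) - g (γ (t i))))
  linarith

theorem HasContourIntegral.congr {f g F G : ℂ → ℂ} {γ Γ : ℝ → ℂ} {I : ℂ}
    (h : HasContourIntegral f g γ I) (hf : ∀ t ∈ Icc (0 : ℝ) 1, F (Γ t) = f (γ t))
    (hg : ∀ t ∈ Icc (0 : ℝ) 1, G (Γ t) = g (γ t)) : HasContourIntegral F G Γ I := by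
  intro ε hε
  obtain ⟨δ, hδ, h⟩ := h ε hε
  refine ⟨δ, hδ, fun n t s h0 hn hts => ?_⟩
  obtain ⟨-, hmem⟩ := mem_Icc_of_partition h0 hn fun i hi => (hts i hi).1.1.trans (hts i hi).1.2
  convert h n t s h0 hn hts using 4 with i hi
  have hi' := Finset.mem_range.1 hi
  have hs : s i ∈ Icc (0 : ℝ) 1 :=
    ⟨(hmem i hi'.le).1.trans (hts i hi').1.1, (hts i hi').1.2.trans (hmem (i + 1) hi').2⟩
  rw [hf _ hs, hg _ (hmem i hi'.le), hg _ (hmem (i + 1) hi')]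

/-- Meant for the real and imaginary parts, through which the fundamental theorem of calculus for
complex-valued functions reduces to the real case. -/
theorem AbsolutelyContinuousOnInterval.comp_of_dist_le {X Y : Type*} [PseudoMetricSpace X]
    [PseudoMetricSpace Y] {G : ℝ → X} {a b : ℝ} (hG : AbsolutelyContinuousOnInterval G a b)
    {L : X → Y} (hL : ∀ x y, dist (L x) (L y) ≤ dist x y) :
    AbsolutelyContinuousOnInterval (fun t => L (G t)) a b :=
  squeeze_zero (fun _ => Finset.sum_nonneg fun _ _ => dist_nonneg)
    (fun _ => Finset.sum_le_sum fun _ _ => hL _ _) hG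

theorem AbsolutelyContinuousOnInterval.re {G : ℝ → ℂ} {a b : ℝ}
    (hG : AbsolutelyContinuousOnInterval G a b) :
    AbsolutelyContinuousOnInterval (fun t => (G t).re) a b :=
  hG.comp_of_dist_le fun x y => by
    rw [Real.dist_eq, dist_eq_norm, ← Complex.sub_re]
    exact Complex.abs_re_le_norm _

theorem AbsolutelyContinuousOnInterval.im {G : ℝ → ℂ} {a b : ℝ}
    (hG : AbsolutelyContinuousOnInterval G a b) :
    AbsolutelyContinuousOnInterval (fun t => (G t).im) a b :=
  hG.comp_of_dist_le fun x y => by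
    rw [Real.dist_eq, dist_eq_norm, ← Complex.sub_im]
    exact Complex.abs_im_le_norm _

theorem AbsolutelyContinuousOnInterval.ae_hasDerivAt_complex {G : ℝ → ℂ} {a b : ℝ}
    (hG : AbsolutelyContinuousOnInterval G a b) :
    ∀ᵐ t, t ∈ uIcc a b → HasDerivAt G
      (((deriv (fun t => (G t).re) t : ℝ) : ℂ) + ((deriv (fun t => (G t).im) t : ℝ) : ℂ) * Complex.I) t := by
  filter_upwards [hG.re.ae_differentiableAt, hG.im.ae_differentiableAt] with t h1 h2 ht
  have := (h1 ht).hasDerivAt.ofReal_comp.add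
    ((h2 ht).hasDerivAt.ofReal_comp.mul_const Complex.I)
  exact this.congr_of_eventuallyEq (Eventually.of_forall fun s => (Complex.re_add_im _).symm)

theorem AbsolutelyContinuousOnInterval.ae_differentiableAt_complex {G : ℝ → ℂ} {a b : ℝ}
    (hG : AbsolutelyContinuousOnInterval G a b) :
    ∀ᵐ t, t ∈ uIcc a b → DifferentiableAt ℝ G t :=
  hG.ae_hasDerivAt_complex.mono fun _ h ht => (h ht).differentiableAt

theorem IntervalIntegrable.complex_ofReal {u : ℝ → ℝ} {a b : ℝ}
    (h : IntervalIntegrable u volume a b) :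
    IntervalIntegrable (fun t => (u t : ℂ)) volume a b :=
  ⟨h.1.ofReal, h.2.ofReal⟩

theorem AbsolutelyContinuousOnInterval.intervalIntegrable_deriv_complex {G : ℝ → ℂ} {a b : ℝ}
    (hG : AbsolutelyContinuousOnInterval G a b) : IntervalIntegrable (deriv G) volume a b := by
  have h := hG.re.intervalIntegrable_deriv.complex_ofReal |>.add
    ((hG.im.intervalIntegrable_deriv.complex_ofReal).mul_const Complex.I)
  refine h.congr_ae ((ae_restrict_iff' measurableSet_uIoc).2 ?_)
  filter_upwards [hG.ae_hasDerivAt_complex] with t ht hmem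
  exact (ht (uIoc_subset_uIcc hmem)).deriv.symm

theorem AbsolutelyContinuousOnInterval.integral_deriv_eq_sub_complex {G : ℝ → ℂ} {a b : ℝ}
    (hG : AbsolutelyContinuousOnInterval G a b) : ∫ t in a..b, deriv G t = G b - G a := by
  have h1 := hG.re.intervalIntegrable_deriv.complex_ofReal
  have h2 := (hG.im.intervalIntegrable_deriv.complex_ofReal).mul_const Complex.I
  have e : ∫ t in a..b, deriv G t = ∫ t in a..b, (((deriv (fun t => (G t).re) t : ℝ) : ℂ) +
      ((deriv (fun t => (G t).im) t : ℝ) : ℂ) * Complex.I) := by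
    refine intervalIntegral.integral_congr_ae ?_
    filter_upwards [hG.ae_hasDerivAt_complex] with t ht hmem
    exact (ht (uIoc_subset_uIcc hmem)).deriv
  rw [e, intervalIntegral.integral_add h1 h2, intervalIntegral.integral_mul_const,
    intervalIntegral.integral_ofReal, intervalIntegral.integral_ofReal,
    hG.re.integral_deriv_eq_sub, hG.im.integral_deriv_eq_sub]
  apply Complex.ext <;> simp

/-- The Riemann-Stieltjes integral with respect to an absolutely continuous function. -/
theorem hasContourIntegral_of_absolutelyContinuous {f g : ℂ → ℂ} {γ : ℝ → ℂ}
    (hf : ContinuousOn (fun t => f (γ t)) (Icc 0 1))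
    (hg : AbsolutelyContinuousOnInterval (fun t => g (γ t)) 0 1) :
    IntervalIntegrable (fun t => f (γ t) * deriv (fun t => g (γ t)) t) volume 0 1 ∧
      HasContourIntegral f g γ (∫ t in (0 : ℝ)..1, f (γ t) * deriv (fun t => g (γ t)) t) := by
  set F := fun t => f (γ t) with hF
  set G := fun t => g (γ t) with hG
  have hG' := hg.intervalIntegrable_deriv_complex
  have hi : IntervalIntegrable (fun t => F t * deriv G t) volume 0 1 :=
    hG'.continuousOn_mul (by rwa [uIcc_of_le zero_le_one])
  refine ⟨hi, fun ε hε => ?_⟩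
  set M := ∫ t in (0 : ℝ)..1, ‖deriv G t‖ with hM
  have hM0 : 0 ≤ M := intervalIntegral.integral_nonneg zero_le_one fun t _ => norm_nonneg _
  obtain ⟨δ, hδ0, hδ⟩ := Metric.uniformContinuousOn_iff.1
    (isCompact_Icc.uniformContinuousOn_of_continuous hf) (ε / (M + 1)) (by positivity)
  refine ⟨δ, hδ0, fun n t s h0 hn hts => ?_⟩
  obtain ⟨-, hmem⟩ := mem_Icc_of_partition h0 hn fun i hi => (hts i hi).1.1.trans (hts i hi).1.2
  have hle {i : ℕ} (hi : i < n) : t i ≤ t (i + 1) := (hts i hi).1.1.trans (hts i hi).1.2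
  have hsub {i : ℕ} (hi : i < n) : uIcc (t i) (t (i + 1)) ⊆ uIcc (0 : ℝ) 1 := by
    rw [uIcc_of_le (hle hi), uIcc_of_le zero_le_one]
    exact Icc_subset_Icc (hmem i hi.le).1 (hmem (i + 1) hi).2
  have e1 : ∫ t in (0 : ℝ)..1, F t * deriv G t =
      ∑ i ∈ Finset.range n, ∫ t in t i..t (i + 1), F t * deriv G t := by
    rw [intervalIntegral.sum_integral_adjacent_intervals (a := t) fun i hi' => hi.mono_set (hsub hi'),
      h0, hn]
  have e2 : M = ∑ i ∈ Finset.range n, ∫ t in t i..t (i + 1), ‖deriv G t‖ := by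
    rw [intervalIntegral.sum_integral_adjacent_intervals (a := t)
      fun i hi' => hG'.norm.mono_set (hsub hi'), h0, hn]
  rw [e1, ← Finset.sum_sub_distrib]
  calc ‖∑ i ∈ Finset.range n, (F (s i) * (G (t (i + 1)) - G (t i)) -
        ∫ t in t i..t (i + 1), F t * deriv G t)‖
      ≤ ∑ i ∈ Finset.range n, ε / (M + 1) * ∫ t in t i..t (i + 1), ‖deriv G t‖ := by
        refine norm_sum_le_of_le _ fun i hi' => ?_
        have hin := Finset.mem_range.1 hi'
        have hGi := hG'.mono_set (hsub hin)
        -- With the increment of `G` written as the integral of its derivative, the error on a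
        -- subinterval is the integral of `(F (s i) - F x) * deriv G x`, and uniform continuity
        -- bounds the first factor.
        rw [← (hg.mono (hsub hin)).integral_deriv_eq_sub_complex,
          ← intervalIntegral.integral_const_mul, ← intervalIntegral.integral_sub
            (hGi.const_mul _) (hi.mono_set (hsub hin)), ← intervalIntegral.integral_const_mul]
        refine intervalIntegral.norm_integral_le_of_norm_le (hle hin)
          (Eventually.of_forall fun x hx => ?_) (hGi.norm.const_mul _)
        rw [← sub_mul, norm_mul]
        refine mul_le_mul_of_nonneg_right ?_ (norm_nonneg _)
        have hsi := (hts i hin).1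
        have hδi := (hts i hin).2
        rw [← dist_eq_norm]
        refine (hδ _ ⟨(hmem i hin.le).1.trans hsi.1, hsi.2.trans (hmem (i + 1) hin).2⟩ _
          ⟨(hmem i hin.le).1.trans hx.1.le, hx.2.trans (hmem (i + 1) hin).2⟩ ?_).le
        rw [Real.dist_eq, abs_lt]
        constructor <;> linarith [hx.1, hx.2, hsi.1, hsi.2]
    _ = ε / (M + 1) * M := by rw [← Finset.mul_sum, ← e2]
    _ < ε := by
        rw [div_mul_eq_mul_div, div_lt_iff₀ (by positivity)]
        nlinarith

/-- Absolutely continuous substitution in a contour integral. -/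
theorem hasContourIntegral_of_ae_differentiableAt {f g : ℂ → ℂ} {μ : ℂ → ℂ} {γ : ℝ → ℂ}
    (hf : ContinuousOn (fun t => f (γ t)) (Icc 0 1)) (hγ : AbsolutelyContinuousOnInterval γ 0 1)
    (hg : AbsolutelyContinuousOnInterval (g ∘ γ) 0 1)
    (hd : ∀ᵐ t ∂(volume.restrict (Icc (0 : ℝ) 1)),
        DifferentiableAt ℝ g (γ t) ∧ dzbar g (γ t) = μ (γ t) * dz g (γ t)) :
    IntervalIntegrable (fun t => f (γ t) * dz g (γ t) *
        (deriv γ t + μ (γ t) * conj (deriv γ t))) volume 0 1 ∧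
      HasContourIntegral f g γ (∫ t in (0 : ℝ)..1, f (γ t) * dz g (γ t) *
        (deriv γ t + μ (γ t) * conj (deriv γ t))) := by
  obtain ⟨h1, h2⟩ := hasContourIntegral_of_absolutelyContinuous (f := f) (g := g) hf hg
  have e : ∀ᵐ t, t ∈ uIoc (0 : ℝ) 1 → f (γ t) * deriv (fun t => g (γ t)) t =
      f (γ t) * dz g (γ t) * (deriv γ t + μ (γ t) * conj (deriv γ t)) := by
    filter_upwards [(ae_restrict_iff' measurableSet_Icc).1 hd, hγ.ae_differentiableAt_complex]
      with t ht1 ht2 ht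
    have ht' : t ∈ uIcc (0 : ℝ) 1 := uIoc_subset_uIcc ht
    obtain ⟨hgd, hgμ⟩ := ht1 (by rwa [uIcc_of_le zero_le_one] at ht')
    have := (hgd.hasFDerivAt.comp_hasDerivAt t (ht2 ht').hasDerivAt).deriv
    rw [show deriv (fun t => g (γ t)) t = deriv (g ∘ γ) t from rfl, this,
      fderiv_eq_dz_add_dzbar, hgμ]
    ring
  refine ⟨h1.congr_ae ((ae_restrict_iff' measurableSet_uIoc).2 e), ?_⟩
  rwa [← intervalIntegral.integral_congr_ae e]

/-! ### Integrals of holomorphic functions along segments -/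

/-- The integral of `h` along the segment from `a` to `b`. -/
noncomputable def segmentIntegral (h : ℂ → ℂ) (a b : ℂ) : ℂ :=
  ∫ s in (0 : ℝ)..1, h (a + s * (b - a)) * (b - a)

theorem add_ofReal_mul_sub_mem_ball {x a b : ℂ} {r : ℝ} (ha : a ∈ Metric.ball x r)
    (hb : b ∈ Metric.ball x r) {s : ℝ} (hs : s ∈ Icc (0 : ℝ) 1) :
    a + s * (b - a) ∈ Metric.ball x r := by
  have := (convex_ball x r).add_smul_sub_mem ha hb hs
  simpa using this

theorem continuousOn_comp_segment {h : ℂ → ℂ} {x a b : ℂ} {r : ℝ}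
    (hh : ContinuousOn h (Metric.ball x r)) (ha : a ∈ Metric.ball x r)
    (hb : b ∈ Metric.ball x r) : ContinuousOn (fun s : ℝ => h (a + s * (b - a))) (Icc 0 1) :=
  hh.comp (by fun_prop) fun _ hs => add_ofReal_mul_sub_mem_ball ha hb hs

theorem segmentIntegral_eq_sub {h H : ℂ → ℂ} {x a b : ℂ} {r : ℝ}
    (hh : ContinuousOn h (Metric.ball x r)) (hH : ∀ z ∈ Metric.ball x r, HasDerivAt H (h z) z)
    (ha : a ∈ Metric.ball x r) (hb : b ∈ Metric.ball x r) :
    segmentIntegral h a b = H b - H a := by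
  have hd (s : ℝ) (hs : s ∈ uIcc (0 : ℝ) 1) :
      HasDerivAt (fun s : ℝ => H (a + s * (b - a))) (h (a + s * (b - a)) * (b - a)) s := by
    rw [uIcc_of_le zero_le_one] at hs
    have h1 : HasDerivAt (fun s : ℝ => a + s * (b - a)) (b - a) s := by
      simpa using ((hasDerivAt_id s).ofReal_comp.mul_const (b - a)).const_add a
    exact (hH _ (add_ofReal_mul_sub_mem_ball ha hb hs)).comp s h1
  have hi : IntervalIntegrable (fun s : ℝ => h (a + s * (b - a)) * (b - a)) volume 0 1 := by
    refine ContinuousOn.intervalIntegrable ?_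
    rw [uIcc_of_le zero_le_one]
    exact (continuousOn_comp_segment hh ha hb).mul continuousOn_const
  rw [segmentIntegral, intervalIntegral.integral_eq_sub_of_hasDerivAt hd hi]
  simp

theorem norm_segmentIntegral_sub_le {h : ℂ → ℂ} {x a b c : ℂ} {r C : ℝ}
    (hh : ContinuousOn h (Metric.ball x r)) (ha : a ∈ Metric.ball x r)
    (hb : b ∈ Metric.ball x r)
    (hC : ∀ s ∈ Icc (0 : ℝ) 1, ‖h (a + s * (b - a)) - c‖ ≤ C) :
    ‖segmentIntegral h a b - c * (b - a)‖ ≤ C * ‖b - a‖ := by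
  have hi : IntervalIntegrable (fun s : ℝ => h (a + s * (b - a)) * (b - a)) volume 0 1 := by
    refine ContinuousOn.intervalIntegrable ?_
    rw [uIcc_of_le zero_le_one]
    exact (continuousOn_comp_segment hh ha hb).mul continuousOn_const
  have e : segmentIntegral h a b - c * (b - a) =
      ∫ s in (0 : ℝ)..1, (h (a + s * (b - a)) * (b - a) - c * (b - a)) := by
    rw [intervalIntegral.integral_sub hi (by simp), segmentIntegral]
    simp
  rw [e]
  have := intervalIntegral.norm_integral_le_of_norm_le_const (a := 0) (b := 1)
    (C := C * ‖b - a‖) (f := fun s : ℝ => h (a + s * (b - a)) * (b - a) - c * (b - a))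
    fun s hs => by
      rw [uIoc_of_le zero_le_one] at hs
      rw [← sub_mul, norm_mul]
      exact mul_le_mul_of_nonneg_right (hC s (Ioc_subset_Icc_self hs)) (norm_nonneg _)
  simpa using this

theorem segmentIntegral_self (h : ℂ → ℂ) (a : ℂ) : segmentIntegral h a a = 0 := by
  simp [segmentIntegral]

/-- Each small quadrilateral lies in a ball where `h` has a primitive, so its boundary integral
vanishes; the cross edges between the two polygons telescope. -/
theorem sum_segmentIntegral_sub_sum {V : Set ℂ} {h : ℂ → ℂ} (hh : DifferentiableOn ℂ h V) {n : ℕ}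
    {u v : ℕ → ℂ}
    (huv : ∀ i < n, ∃ x r, Metric.ball x r ⊆ V ∧ u i ∈ Metric.ball x r ∧
      u (i + 1) ∈ Metric.ball x r ∧ v i ∈ Metric.ball x r ∧ v (i + 1) ∈ Metric.ball x r) :
    ∑ i ∈ Finset.range n, segmentIntegral h (v i) (v (i + 1)) -
        ∑ i ∈ Finset.range n, segmentIntegral h (u i) (u (i + 1)) =
      segmentIntegral h (u n) (v n) - segmentIntegral h (u 0) (v 0) := by
  rw [← Finset.sum_sub_distrib, ← Finset.sum_range_sub fun i => segmentIntegral h (u i) (v i)]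
  refine Finset.sum_congr rfl fun i hi => ?_
  obtain ⟨x, r, hV, h1, h2, h3, h4⟩ := huv i (Finset.mem_range.1 hi)
  obtain ⟨H, hH⟩ := (hh.mono hV).isExactOn_ball
  have hc := hh.continuousOn.mono hV
  rw [segmentIntegral_eq_sub hc hH h3 h4, segmentIntegral_eq_sub hc hH h1 h2,
    segmentIntegral_eq_sub hc hH h2 h4, segmentIntegral_eq_sub hc hH h1 h3]
  ring

/-- **Cauchy's theorem** for a loop in a simply connected set, mapped continuously into a set where
`h` is holomorphic: the sum of the integrals along the edges of a sufficiently fine inscribed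
polygon vanishes. -/
theorem exists_sum_segmentIntegral_eq_zero {Ω V : Set ℂ} (hΩ : IsSimplyConnected Ω)
    (hV : IsOpen V) {h : ℂ → ℂ} (hh : DifferentiableOn ℂ h V) {f : ℂ → ℂ} (hf : ContinuousOn f Ω)
    (hfV : MapsTo f Ω V) {γ : ℝ → ℂ} (hγ : ContinuousOn γ (Icc 0 1)) (hγ01 : γ 0 = γ 1)
    (hγΩ : MapsTo γ (Icc 0 1) Ω) :
    ∃ δ : ℝ, 0 < δ ∧ ∀ (n : ℕ) (t : ℕ → ℝ), t 0 = 0 → t n = 1 →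
      (∀ i < n, t i ≤ t (i + 1) ∧ t (i + 1) - t i < δ) →
      ∑ i ∈ Finset.range n, segmentIntegral h (f (γ (t i))) (f (γ (t (i + 1)))) = 0 := by
  let P : Path (γ 0) (γ 0) :=
    { toFun := fun t => γ t
      continuous_toFun := continuousOn_iff_continuous_domRestrict.1 hγ
      source' := by simp
      target' := by simp [hγ01] }
  obtain ⟨F, hF⟩ := (isSimplyConnected_iff_exists_homotopy_refl_forall_mem.1 hΩ).2 (γ 0) P
    fun t => hγΩ t.2
  -- The image of the homotopy square is compact in `V`, so balls of one radius `r` about its points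
  -- stay in `V`. A grid finer than `δ` sends the corners of each cell into one such ball; this `δ`
  -- does not depend on the partition of the loop.
  set Φ : unitInterval × unitInterval → ℂ := fun x => f (F x) with hΦ
  have hΦc : Continuous Φ := hf.comp_continuous F.continuous hF
  obtain ⟨r, hr0, hr⟩ := (isCompact_range hΦc).exists_cthickening_subset_open hV
    (range_subset_iff.2 fun x => hfV (hF x))
  have hball (x : unitInterval × unitInterval) : Metric.ball (Φ x) r ⊆ V :=
    (Metric.ball_subset_closedBall.trans
      (Metric.closedBall_subset_cthickening (mem_range_self x) r)).trans hr
  obtain ⟨δ, hδ0, hδ⟩ := Metric.uniformContinuous_iff.1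
    (CompactSpace.uniformContinuous_of_continuous hΦc) r hr0
  obtain ⟨N, τ, hτ0, hτN, hτ⟩ := exists_partition hδ0
  refine ⟨δ, hδ0, fun n t h0 hn ht => ?_⟩
  set π : ℝ → unitInterval := projIcc 0 1 zero_le_one with hπ
  have hπd (a b : ℝ) (h1 : a ≤ b) (h2 : b - a < δ) : dist (π b) (π a) < δ := by
    refine lt_of_le_of_lt ?_ h2
    rw [Subtype.dist_eq, Real.dist_eq, hπ, abs_le]
    simp only [coe_projIcc]
    constructor
    · have : max 0 (min 1 a) ≤ max 0 (min 1 b) := by gcongr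
      linarith
    · rcases le_total 1 b with hb | hb <;> rcases le_total 1 a with ha | ha <;>
        rcases le_total 0 b with hb0 | hb0 <;> rcases le_total 0 a with ha0 | ha0 <;>
        simp [*] <;> linarith
  have hπ0 : π 0 = 0 := projIcc_left _
  have hπ1 : π 1 = 1 := projIcc_right _
  have hstep (j : ℕ) (hj : j < N) :
      ∑ i ∈ Finset.range n, segmentIntegral h (Φ (π (τ (j + 1)), π (t i)))
        (Φ (π (τ (j + 1)), π (t (i + 1)))) =
      ∑ i ∈ Finset.range n, segmentIntegral h (Φ (π (τ j), π (t i)))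
        (Φ (π (τ j), π (t (i + 1)))) := by
    -- The homotopy fixes the base point, so the end terms of the telescoping sum cancel.
    have hside (σ : unitInterval) : Φ (σ, 0) = f (γ 0) ∧ Φ (σ, 1) = f (γ 0) := by
      simp [hΦ]
    have key := sum_segmentIntegral_sub_sum hh (n := n)
      (u := fun i => Φ (π (τ j), π (t i))) (v := fun i => Φ (π (τ (j + 1)), π (t i)))
      fun i hi => ⟨Φ (π (τ j), π (t i)), r, hball _, Metric.mem_ball_self hr0,
        hδ (by simpa [Prod.dist_eq, hδ0] using hπd _ _ (ht i hi).1 (ht i hi).2),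
        hδ (by simpa [Prod.dist_eq, hδ0] using hπd _ _ (hτ j hj).1 (hτ j hj).2),
        hδ (by
          simpa [Prod.dist_eq] using ⟨hπd _ _ (hτ j hj).1 (hτ j hj).2,
            hπd _ _ (ht i hi).1 (ht i hi).2⟩)⟩
    rw [h0, hn, hπ0, hπ1, (hside _).1, (hside _).1, (hside _).2, (hside _).2, sub_self] at key
    exact sub_eq_zero.1 key
  have hall (j : ℕ) (hj : j ≤ N) :
      ∑ i ∈ Finset.range n, segmentIntegral h (Φ (π (τ j), π (t i)))
        (Φ (π (τ j), π (t (i + 1)))) =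
      ∑ i ∈ Finset.range n, segmentIntegral h (Φ (π (τ 0), π (t i)))
        (Φ (π (τ 0), π (t (i + 1)))) := by
    induction j with
    | zero => rfl
    | succ j ih => rw [hstep j hj, ih (Nat.le_of_succ_le hj)]
  have hmem := (mem_Icc_of_partition h0 hn fun i hi => (ht i hi).1).2
  have hN := hall N le_rfl
  rw [hτ0, hτN, hπ0, hπ1] at hN
  have e1 (x : unitInterval) : Φ (1, x) = f (γ 0) := by simp [hΦ]
  have e0 {i : ℕ} (hi : i ≤ n) : Φ (0, π (t i)) = f (γ (t i)) := by
    simp only [hΦ, F.apply_zero, hπ, projIcc_of_mem zero_le_one (hmem i hi)]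
    rfl
  -- The last row of the grid is a constant loop, whose edges are degenerate.
  simp only [e1, segmentIntegral_self, Finset.sum_const_zero] at hN
  rw [hN]
  refine Finset.sum_congr rfl fun i hi => ?_
  rw [e0 (Finset.mem_range.1 hi).le, e0 (Finset.mem_range.1 hi)]

/-- The derivative of an injective holomorphic function does not vanish. -/
theorem deriv_ne_zero_of_injOn {V : Set ℂ} (hV : IsOpen V) {h : ℂ → ℂ}
    (hh : DifferentiableOn ℂ h V) (hi : InjOn h V) {w : ℂ} (hw : w ∈ V) : deriv h w ≠ 0 := by
  intro h0
  have hda : AnalyticAt ℂ (deriv h) w := (hh.analyticAt (hV.mem_nhds hw)).deriv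
  -- A zero of `deriv h` is isolated, since otherwise `h` would be constant near `w`.
  have hne : ∀ᶠ z in 𝓝[≠] w, deriv h z ≠ 0 := by
    refine hda.eventually_eq_zero_or_eventually_ne_zero.resolve_left fun hz => ?_
    obtain ⟨r, hr0, hr⟩ := Metric.mem_nhds_iff.1 (inter_mem hz (hV.mem_nhds hw))
    have hc : h (w + (r / 2 : ℝ)) = h w :=
      Metric.isOpen_ball.is_const_of_deriv_eq_zero (convex_ball w r).isPreconnected
        (hh.mono fun x hx => (hr hx).2) (fun x hx => (hr hx).1)
        (by
          rw [Metric.mem_ball, dist_eq_norm, add_sub_cancel_left, Complex.norm_real,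
            Real.norm_of_nonneg (by positivity)]
          linarith) (Metric.mem_ball_self hr0)
    have hmem : w + (r / 2 : ℝ) ∈ Metric.ball w r := by
      rw [Metric.mem_ball, dist_eq_norm, add_sub_cancel_left, Complex.norm_real,
        Real.norm_of_nonneg (by positivity)]
      linarith
    have := hi (hr hmem).2 hw hc
    rw [add_eq_left, Complex.ofReal_eq_zero] at this
    linarith
  obtain ⟨r, hr0, hr⟩ := Metric.mem_nhds_iff.1
    (inter_mem (eventually_nhdsWithin_iff.1 hne) (hV.mem_nhds hw))
  set B := Metric.ball w r with hB
  have hBV : B ⊆ V := fun x hx => (hr hx).2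
  have hwB : w ∈ B := Metric.mem_ball_self hr0
  have hiB : InjOn h B := hi.mono hBV
  have hmem : w + (r / 2 : ℝ) ∈ B := by
    rw [hB, Metric.mem_ball, dist_eq_norm, add_sub_cancel_left, Complex.norm_real,
      Real.norm_of_nonneg (by positivity)]
    linarith
  have hopen : ∀ s ⊆ B, IsOpen s → IsOpen (h '' s) := by
    refine (((hh.mono hBV).analyticOnNhd Metric.isOpen_ball).is_constant_or_isOpen
      (convex_ball w r).isPreconnected).resolve_left ?_
    rintro ⟨c, hc⟩
    have := hiB hmem hwB ((hc _ hmem).trans (hc _ hwB).symm)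
    rw [add_eq_left, Complex.ofReal_eq_zero] at this
    linarith
  set k := Function.invFunOn h B with hk
  have hkh {z : ℂ} (hz : z ∈ B) : k (h z) = z := hiB.leftInvOn_invFunOn hz
  have hBo : IsOpen (h '' B) := hopen B subset_rfl Metric.isOpen_ball
  have hkc : ContinuousOn k (h '' B) := by
    rw [continuousOn_open_iff hBo]
    intro U hU
    have e : h '' B ∩ k ⁻¹' U = h '' (B ∩ U) := by
      ext y
      constructor
      · rintro ⟨⟨z, hz, rfl⟩, hy⟩
        rw [mem_preimage, hkh hz] at hy
        exact ⟨z, ⟨hz, hy⟩, rfl⟩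
      · rintro ⟨z, ⟨hz, hzU⟩, rfl⟩
        exact ⟨⟨z, hz, rfl⟩, by rwa [mem_preimage, hkh hz]⟩
    rw [e]
    exact hopen _ inter_subset_left (Metric.isOpen_ball.inter hU)
  have hkcz {z : ℂ} (hz : z ∈ B) : ContinuousAt k (h z) :=
    hkc.continuousAt (hBo.mem_nhds (mem_image_of_mem h hz))
  have hkd : DifferentiableOn ℂ k (h '' B \ {h w}) := by
    rintro _ ⟨⟨z, hz, rfl⟩, hzw⟩
    have hzw' : z ≠ w := fun e => hzw (by rw [e]; rfl)
    have hd : HasDerivAt h (deriv h z) (k (h z)) := by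
      rw [hkh hz]
      exact (hh.differentiableAt (hV.mem_nhds (hBV hz))).hasDerivAt
    refine (HasDerivAt.of_local_left_inverse (hkcz hz) hd ((hr hz).1 hzw')
      ?_).differentiableAt.differentiableWithinAt
    filter_upwards [hBo.mem_nhds (mem_image_of_mem h hz)] with y hy
    obtain ⟨x, hx, rfl⟩ := hy
    rw [hkh hx]
  -- The local inverse `k` is continuous and is holomorphic off `h w`, hence everywhere by
  -- removability. The chain rule for `k ∘ h` at `w` then contradicts the vanishing derivative.
  have hkd' := (Complex.differentiableOn_compl_singleton_and_continuousAt_iff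
    (hBo.mem_nhds (mem_image_of_mem h hwB))).1 ⟨hkd, hkcz hwB⟩
  have h1 := (hkd'.differentiableAt (hBo.mem_nhds (mem_image_of_mem h hwB))).hasDerivAt.comp w
    (hh.differentiableAt (hV.mem_nhds hw)).hasDerivAt
  have h2 : HasDerivAt (k ∘ h) 1 w := by
    refine (hasDerivAt_id w).congr_of_eventuallyEq ?_
    filter_upwards [Metric.isOpen_ball.mem_nhds hwB] with z hz
    exact hkh hz
  have := h1.unique h2
  rw [h0, mul_zero] at this
  exact zero_ne_one this

/-! ### Contour integrals of holomorphic functions along rough curves -/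

/-- A Lebesgue number for the balls on which a local estimate holds, making the estimate uniform on
`K`. -/
theorem exists_forall_ball_subset_of_forall_exists_ball {X : Type*} [PseudoMetricSpace X]
    {K : Set X} (hK : IsCompact K) {P : X → ℝ → Prop} (hP : ∀ x ∈ K, ∃ r > 0, P x r) :
    ∃ ρ > 0, ∀ a ∈ K, ∃ x r, P x r ∧ Metric.ball a ρ ⊆ Metric.ball x r := by
  obtain ⟨ρ, hρ0, hρ⟩ := lebesgue_number_lemma_of_metric hK
    (c := fun q : {q : X × ℝ // P q.1 q.2} => Metric.ball q.1.1 q.1.2)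
    (fun _ => Metric.isOpen_ball) fun x hx => by
      obtain ⟨r, hr0, hr⟩ := hP x hx
      exact mem_iUnion.2 ⟨⟨(x, r), hr⟩, Metric.mem_ball_self hr0⟩
  refine ⟨ρ, hρ0, fun a ha => ?_⟩
  obtain ⟨q, hq⟩ := hρ a ha
  exact ⟨q.1.1, q.1.2, q.2, hq⟩

theorem exists_norm_segmentIntegral_sub_le {K V : Set ℂ} (hK : IsCompact K) (hV : IsOpen V)
    (hKV : K ⊆ V) {h : ℂ → ℂ} (hh : ContinuousOn h V) {ε : ℝ} (hε : 0 < ε) :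
    ∃ ρ > 0, ∀ a ∈ K, ∀ b ∈ Metric.ball a ρ, ∀ c ∈ Metric.ball a ρ,
      ‖segmentIntegral h a b - h c * (b - a)‖ ≤ ε * ‖b - a‖ := by
  obtain ⟨ρ, hρ0, hρ⟩ := exists_forall_ball_subset_of_forall_exists_ball hK
    (P := fun x r => Metric.ball x r ⊆ V ∩ {y | dist (h y) (h x) < ε / 2}) fun x hx => by
      obtain ⟨r, hr0, hr⟩ := Metric.mem_nhds_iff.1 (inter_mem (hV.mem_nhds (hKV hx))
        ((hh.continuousAt (hV.mem_nhds (hKV hx))).eventually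
          (Metric.ball_mem_nhds (h x) (half_pos hε))))
      exact ⟨r, hr0, hr⟩
  refine ⟨ρ, hρ0, fun a ha b hb c hc => ?_⟩
  obtain ⟨x, r, hP, hsub⟩ := hρ a ha
  have ha' := hsub (Metric.mem_ball_self hρ0)
  refine norm_segmentIntegral_sub_le (hh.mono fun y hy => (hP hy).1) ha' (hsub hb)
    fun s hs => ?_
  have h1 := (hP (add_ofReal_mul_sub_mem_ball ha' (hsub hb) hs)).2
  have h2 := (hP (hsub hc)).2
  simp only [mem_ofPred_eq] at h1 h2
  rw [← dist_eq_norm]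
  linarith [dist_triangle_right (h (a + s * (b - a))) (h c) (h x)]

/-- Since `d = h'(x) ≠ 0`, near `x` the increments of `h` differ from those of `d · id` by at most
half their size. Hence `h` varies along the segment by at most `3/2 |d| |b - a|`, while `|d| |b - a|
≤ 2 |h b - h a|`; this gives the factor `3`. A bound by the increment of `h` itself is what replaces
rectifiability. -/
theorem exists_norm_segmentIntegral_sub_le_norm_sub {K V : Set ℂ} (hK : IsCompact K)
    (hV : IsOpen V) (hKV : K ⊆ V) {h : ℂ → ℂ} (hh : DifferentiableOn ℂ h V) (hi : InjOn h V) :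
    ∃ ρ > 0, ∀ a ∈ K, ∀ b ∈ Metric.ball a ρ,
      ‖segmentIntegral h a b - h a * (b - a)‖ ≤ 3 * ‖h b - h a‖ * ‖b - a‖ := by
  obtain ⟨ρ, hρ0, hρ⟩ := exists_forall_ball_subset_of_forall_exists_ball hK
    (P := fun x r => Metric.ball x r ⊆ V ∧ ∀ y ∈ Metric.ball x r, ∀ z ∈ Metric.ball x r,
      ‖h y - h z - deriv h x * (y - z)‖ ≤ ‖deriv h x‖ / 2 * ‖y - z‖) fun x hx => by
      have hx' := hKV hx
      have hd : HasStrictDerivAt h (deriv h x) x :=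
        (hh.analyticAt (hV.mem_nhds hx')).hasStrictDerivAt
      have hne : 0 < ‖deriv h x‖ := norm_pos_iff.2 (deriv_ne_zero_of_injOn hV hh hi hx')
      have h1 := hd.isLittleO.bound (half_pos hne)
      obtain ⟨t, ht, h1⟩ := mem_prod_self_iff.1 (nhds_prod_eq (x := x) (y := x) ▸ h1)
      obtain ⟨r, hr0, hr⟩ := Metric.mem_nhds_iff.1 (inter_mem (hV.mem_nhds hx') ht)
      refine ⟨r, hr0, fun y hy => (hr hy).1, fun y hy z hz => ?_⟩
      simpa [mul_comm] using h1 (mk_mem_prod (hr hy).2 (hr hz).2)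
  refine ⟨ρ, hρ0, fun a ha b hb => ?_⟩
  obtain ⟨x, r, ⟨hrV, hP⟩, hsub⟩ := hρ a ha
  have ha' := hsub (Metric.mem_ball_self hρ0)
  refine norm_segmentIntegral_sub_le (hh.continuousOn.mono hrV) ha' (hsub hb) fun s hs => ?_
  have h1 := hP _ (add_ofReal_mul_sub_mem_ball ha' (hsub hb) hs) a ha'
  have h2 := hP b (hsub hb) a ha'
  set d := deriv h x
  set y := a + s * (b - a) with hy
  have e1 : ‖y - a‖ ≤ ‖b - a‖ := by
    rw [hy, add_sub_cancel_left, norm_mul, Complex.norm_real, Real.norm_of_nonneg hs.1]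
    exact mul_le_of_le_one_left (norm_nonneg _) hs.2
  have e2 : ‖h y - h a‖ ≤ ‖h y - h a - d * (y - a)‖ + ‖d‖ * ‖y - a‖ := by
    rw [← norm_mul]; exact norm_le_norm_sub_add _ _
  have e3 : ‖d‖ * ‖b - a‖ ≤ ‖h b - h a - d * (b - a)‖ + ‖h b - h a‖ := by
    rw [← norm_mul, norm_sub_rev (h b - h a)]; exact norm_le_norm_sub_add _ _
  nlinarith [mul_le_mul_of_nonneg_left e1 (norm_nonneg d)]

/-- The positive and negative parts of the real and imaginary parts are four subset sums, each
bounded by `C`. -/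
theorem sum_norm_le_four_mul_of_forall_subset {ι : Type*} {s : Finset ι} {z : ι → ℂ} {C : ℝ}
    (h : ∀ S ⊆ s, ‖∑ i ∈ S, z i‖ ≤ C) : ∑ i ∈ s, ‖z i‖ ≤ 4 * C := by
  classical
  have key (L : ℂ →+ ℝ) (hL : ∀ w, |L w| ≤ ‖w‖) : ∑ i ∈ s, |L (z i)| ≤ 2 * C := by
    rw [← Finset.sum_filter_add_sum_filter_not s fun i => 0 ≤ L (z i)]
    have h1 : ∑ i ∈ s with 0 ≤ L (z i), |L (z i)| ≤ C := by
      rw [Finset.sum_congr rfl fun i hi => abs_of_nonneg (Finset.mem_filter.1 hi).2, ← map_sum]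
      exact (le_abs_self _).trans ((hL _).trans (h _ (Finset.filter_subset _ _)))
    have h2 : ∑ i ∈ s with ¬ 0 ≤ L (z i), |L (z i)| ≤ C := by
      rw [Finset.sum_congr rfl fun i hi => abs_of_neg (not_le.1 (Finset.mem_filter.1 hi).2),
        Finset.sum_neg_distrib, ← map_sum]
      exact (neg_le_abs _).trans ((hL _).trans (h _ (Finset.filter_subset _ _)))
    linarith
  have h1 := key Complex.reAddGroupHom Complex.abs_re_le_norm
  have h2 := key Complex.imAddGroupHom Complex.abs_im_le_norm
  calc ∑ i ∈ s, ‖z i‖ ≤ ∑ i ∈ s, (|(z i).re| + |(z i).im|) :=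
        Finset.sum_le_sum fun i _ => Complex.norm_le_abs_re_add_abs_im _
    _ ≤ 4 * C := by
        rw [Finset.sum_add_distrib]
        simp only [Complex.coe_reAddGroupHom, Complex.coe_imAddGroupHom] at h1 h2
        linarith

section

variable {Ω V : Set ℂ} {h f φ : ℂ → ℂ} {γ : ℝ → ℂ}

theorem exists_dist_lt_of_continuousOn_comp (hf : ContinuousOn f Ω)
    (hγ : ContinuousOn γ (Icc 0 1)) (hγΩ : MapsTo γ (Icc 0 1) Ω) {ρ : ℝ} (hρ : 0 < ρ) :
    ∃ δ > 0, ∀ s ∈ Icc (0 : ℝ) 1, ∀ t ∈ Icc (0 : ℝ) 1, |s - t| < δ →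
      dist (f (γ s)) (f (γ t)) < ρ :=
  Metric.uniformContinuousOn_iff.1
    (isCompact_Icc.uniformContinuousOn_of_continuous (hf.comp hγ hγΩ)) ρ hρ

/-- **Cauchy's theorem** for rectifiable curves. -/
theorem hasContourIntegral_zero_of_boundedVariationOn (hΩ : IsSimplyConnected Ω) (hV : IsOpen V)
    (hh : DifferentiableOn ℂ h V) (hf : ContinuousOn f Ω) (hfV : MapsTo f Ω V)
    (hφ : ∀ z ∈ Ω, φ z = h (f z)) (hγ : ContinuousOn γ (Icc 0 1)) (hγ01 : γ 0 = γ 1)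
    (hγΩ : MapsTo γ (Icc 0 1) Ω) (hbv : BoundedVariationOn (f ∘ γ) (Icc 0 1)) :
    HasContourIntegral φ f γ 0 := by
  intro ε hε
  set M := (eVariationOn (f ∘ γ) (Icc 0 1)).toReal with hM
  have hM0 : 0 ≤ M := ENNReal.toReal_nonneg
  have hK : IsCompact ((f ∘ γ) '' Icc 0 1) :=
    isCompact_Icc.image_of_continuousOn (hf.comp hγ hγΩ)
  obtain ⟨ρ, hρ0, hρ⟩ := exists_norm_segmentIntegral_sub_le hK hV
    (image_subset_iff.2 fun t ht => hfV (hγΩ ht)) hh.continuousOn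
    (show 0 < ε / (M + 1) by positivity)
  obtain ⟨δ₁, hδ₁, h₁⟩ := exists_dist_lt_of_continuousOn_comp hf hγ hγΩ hρ0
  obtain ⟨δ₂, hδ₂, h₂⟩ := exists_sum_segmentIntegral_eq_zero hΩ hV hh hf hfV hγ hγ01 hγΩ
  refine ⟨min δ₁ δ₂, lt_min hδ₁ hδ₂, fun n t s h0 hn hts => ?_⟩
  have hle {i : ℕ} (hi : i < n) : t i ≤ t (i + 1) := (hts i hi).1.1.trans (hts i hi).1.2
  obtain ⟨hmono, hmem⟩ := mem_Icc_of_partition h0 hn fun i hi => hle hi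
  have hvar : ∑ i ∈ Finset.range n, ‖f (γ (t (i + 1))) - f (γ (t i))‖ ≤ M := by
    have := ENNReal.toReal_mono hbv
      (eVariationOn.sum_le_of_monotoneOn_Iic (f := f ∘ γ) hmono hmem)
    rw [ENNReal.toReal_sum fun i _ => edist_ne_top _ _] at this
    simpa only [edist_dist, ENNReal.toReal_ofReal dist_nonneg, ← dist_eq_norm, hM,
      Function.comp_apply] using this
  -- The zero being subtracted is rewritten as the sum of the segment integrals, so that the
  -- comparison is made segment by segment.
  rw [← h₂ n t h0 hn fun i hi => ⟨hle hi, (hts i hi).2.trans_le (min_le_right _ _)⟩,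
    ← Finset.sum_sub_distrib]
  calc _ ≤ ∑ i ∈ Finset.range n, ε / (M + 1) * ‖f (γ (t (i + 1))) - f (γ (t i))‖ := by
        refine norm_sum_le_of_le _ fun i hi => ?_
        have hi' := Finset.mem_range.1 hi
        have hti := hmem i hi'.le
        have hti' := hmem (i + 1) hi'
        have hsi := (hts i hi').1
        have hs : s i ∈ Icc (0 : ℝ) 1 := ⟨hti.1.trans hsi.1, hsi.2.trans hti'.2⟩
        have hδ := (hts i hi').2.trans_le (min_le_left _ _)
        rw [norm_sub_rev, hφ _ (hγΩ hs)]
        refine hρ _ (mem_image_of_mem _ hti) _ (h₁ _ hti' _ hti ?_) _ (h₁ _ hs _ hti ?_)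
        · rwa [abs_of_nonneg (sub_nonneg.2 (hle hi'))]
        · rw [abs_of_nonneg (sub_nonneg.2 hsi.1)]
          linarith [hsi.2]
    _ ≤ ε / (M + 1) * M := by
        rw [← Finset.mul_sum]
        exact mul_le_mul_of_nonneg_left hvar (by positivity)
    _ < ε := by
        rw [div_mul_eq_mul_div, div_lt_iff₀ (by positivity)]
        nlinarith

/-- The contour integral of an injective holomorphic function vanishes whenever it exists. -/
theorem HasContourIntegral.eq_zero_of_injOn (hΩ : IsSimplyConnected Ω) (hV : IsOpen V)
    (hh : DifferentiableOn ℂ h V) (hi : InjOn h V) (hf : ContinuousOn f Ω) (hfV : MapsTo f Ω V)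
    (hφ : ∀ z ∈ Ω, φ z = h (f z)) (hγ : ContinuousOn γ (Icc 0 1)) (hγ01 : γ 0 = γ 1)
    (hγΩ : MapsTo γ (Icc 0 1) Ω) {I : ℂ} (hI : HasContourIntegral φ f γ I) : I = 0 := by
  refine eq_of_forall_dist_le fun ε' hε' => ?_
  -- The constant is `1 + 3 * (4 * 2)`: one `ε` for the Riemann sum, then the factor `3` of the
  -- segment estimate, `4` for absolute values and `2` for a change of tags.
  obtain ⟨ε, hε, rfl⟩ : ∃ ε, 0 < ε ∧ 25 * ε = ε' := ⟨ε' / 25, by positivity, by ring⟩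
  have hK : IsCompact ((f ∘ γ) '' Icc 0 1) :=
    isCompact_Icc.image_of_continuousOn (hf.comp hγ hγΩ)
  obtain ⟨ρ, hρ0, hρ⟩ := exists_norm_segmentIntegral_sub_le_norm_sub hK hV
    (image_subset_iff.2 fun t ht => hfV (hγΩ ht)) hh hi
  obtain ⟨δ₁, hδ₁, h₁⟩ := exists_dist_lt_of_continuousOn_comp hf hγ hγΩ hρ0
  obtain ⟨δ₂, hδ₂, h₂⟩ := exists_sum_segmentIntegral_eq_zero hΩ hV hh hf hfV hγ hγ01 hγΩ
  obtain ⟨δ₃, hδ₃, h₃⟩ := hI ε hε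
  obtain ⟨n, t, h0, hn, ht⟩ := exists_partition (lt_min hδ₁ (lt_min hδ₂ hδ₃))
  have hmem := (mem_Icc_of_partition h0 hn fun i hi => (ht i hi).1).2
  have hlt₁ {i : ℕ} (hi : i < n) := (ht i hi).2.trans_le (min_le_left _ _)
  have hlt₂ {i : ℕ} (hi : i < n) :=
    (ht i hi).2.trans_le ((min_le_right _ _).trans (min_le_left _ _))
  have hlt₃ {i : ℕ} (hi : i < n) :=
    (ht i hi).2.trans_le ((min_le_right _ _).trans (min_le_right _ _))
  set Δ : ℕ → ℂ := fun i => f (γ (t (i + 1))) - f (γ (t i)) with hΔ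
  set z : ℕ → ℂ := fun i => (φ (γ (t (i + 1))) - φ (γ (t i))) * Δ i with hz
  have hbase := h₃ n t t h0 hn fun i hi => ⟨left_mem_Icc.2 (ht i hi).1, hlt₃ hi⟩
  -- Moving the tags in `S` from left to right endpoints changes the Riemann sum by exactly `∑ i ∈
  -- S, z i`. Both sums are within `ε` of `I`, so every subset sum is at most `2 * ε`.
  have hsum : ∑ i ∈ Finset.range n, ‖z i‖ ≤ 4 * (2 * ε) := by
    refine sum_norm_le_four_mul_of_forall_subset fun S hS => ?_
    classical
    have htag := h₃ n t (fun i => if i ∈ S then t (i + 1) else t i) h0 hn fun i hi => by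
      refine ⟨?_, hlt₃ hi⟩
      split_ifs
      · exact right_mem_Icc.2 (ht i hi).1
      · exact left_mem_Icc.2 (ht i hi).1
    have e : ∑ i ∈ S, z i =
        ∑ i ∈ Finset.range n, φ (γ (if i ∈ S then t (i + 1) else t i)) * Δ i -
          ∑ i ∈ Finset.range n, φ (γ (t i)) * Δ i := by
      rw [← Finset.sum_sub_distrib, ← Finset.sum_subset hS (f := fun i =>
        φ (γ (if i ∈ S then t (i + 1) else t i)) * Δ i - φ (γ (t i)) * Δ i)
        fun i _ hi => by simp [hi]]
      refine Finset.sum_congr rfl fun i hi => ?_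
      simp only [hi, if_true, hz]
      ring
    rw [e, ← dist_eq_norm]
    rw [← dist_eq_norm] at htag hbase
    refine (dist_triangle_right _ _ I).trans ?_
    linarith
  have hdiff : ‖∑ i ∈ Finset.range n, φ (γ (t i)) * Δ i‖ ≤ 3 * (4 * (2 * ε)) := by
    rw [← norm_neg, ← zero_sub, ← h₂ n t h0 hn fun i hi => ⟨(ht i hi).1, hlt₂ hi⟩,
      ← Finset.sum_sub_distrib]
    refine (norm_sum_le_of_le _ fun i hi => ?_).trans
      ((Finset.mul_sum _ _ _).symm.trans_le (mul_le_mul_of_nonneg_left hsum zero_le_three))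
    have hi' := Finset.mem_range.1 hi
    have hti := hmem i hi'.le
    have hti' := hmem (i + 1) hi'
    rw [hz, norm_mul, hφ _ (hγΩ hti), hφ _ (hγΩ hti'), ← mul_assoc]
    refine hρ _ (mem_image_of_mem _ hti) _ (h₁ _ hti' _ hti ?_)
    rw [abs_of_nonneg (sub_nonneg.2 (ht i hi').1)]
    exact hlt₁ hi'
  rw [dist_zero_right]
  have := norm_le_norm_sub_add I (∑ i ∈ Finset.range n, φ (γ (t i)) * Δ i)
  rw [norm_sub_rev] at hbase
  linarith

end

/-! ### Morera's theorem with parametrized rectangles -/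

/-- The piecewise linear function that increases from `0` to `1` on `[a / 4, (a + 1) / 4]` and
decreases from `1` to `0` on `[(b - 1) / 4, b / 4]`. -/
noncomputable def trapezoid (a b t : ℝ) : ℝ := max 0 (min 1 (min (4 * t - a) (b - 4 * t)))

theorem trapezoid_mem_Icc (a b t : ℝ) : trapezoid a b t ∈ Icc (0 : ℝ) 1 :=
  ⟨le_max_left _ _, max_le zero_le_one (min_le_left _ _)⟩

theorem abs_trapezoid_sub_le (a b s t : ℝ) :
    |trapezoid a b s - trapezoid a b t| ≤ 4 * |s - t| := by
  refine (abs_max_sub_max_le_max _ _ _ _).trans (max_le (by simp) ?_)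
  refine (abs_min_sub_min_le_max _ _ _ _).trans (max_le (by simp) ?_)
  refine (abs_min_sub_min_le_max _ _ _ _).trans (max_le (le_of_eq ?_) (le_of_eq ?_))
  · rw [show 4 * s - a - (4 * t - a) = 4 * (s - t) by ring, abs_mul, abs_of_pos four_pos]
  · rw [show b - 4 * s - (b - 4 * t) = -(4 * (s - t)) by ring, abs_neg, abs_mul,
      abs_of_pos four_pos]

/-- The boundary of the rectangle with opposite corners `z` and `w`, parametrized on `[0, 1]`. -/
noncomputable def rectangleCurve (z w : ℂ) (t : ℝ) : ℂ :=
  ⟨z.re + (w.re - z.re) * trapezoid 0 3 t, z.im + (w.im - z.im) * trapezoid 1 4 t⟩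

section

variable (z w : ℂ) {t : ℝ}

theorem trapezoid_of_mem_first (ht : t ∈ Icc (0 : ℝ) (1 / 4)) :
    trapezoid 0 3 t = 4 * t ∧ trapezoid 1 4 t = 0 := by
  obtain ⟨h1, h2⟩ := ht
  constructor
  · rw [trapezoid, min_eq_left (by linarith : 4 * t - 0 ≤ 3 - 4 * t), min_eq_right (by linarith),
      max_eq_right (by linarith), sub_zero]
  · exact max_eq_left ((min_le_right _ _).trans ((min_le_left _ _).trans (by linarith)))

theorem trapezoid_of_mem_second (ht : t ∈ Icc (1 / 4 : ℝ) (1 / 2)) :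
    trapezoid 0 3 t = 1 ∧ trapezoid 1 4 t = 4 * t - 1 := by
  obtain ⟨h1, h2⟩ := ht
  constructor
  · rw [trapezoid, min_eq_left (le_min (by linarith) (by linarith)), max_eq_right zero_le_one]
  · rw [trapezoid, min_eq_left (by linarith : 4 * t - 1 ≤ 4 - 4 * t), min_eq_right (by linarith),
      max_eq_right (by linarith)]

theorem trapezoid_of_mem_third (ht : t ∈ Icc (1 / 2 : ℝ) (3 / 4)) :
    trapezoid 0 3 t = 3 - 4 * t ∧ trapezoid 1 4 t = 1 := by
  obtain ⟨h1, h2⟩ := ht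
  constructor
  · rw [trapezoid, min_eq_right (by linarith : 3 - 4 * t ≤ 4 * t - 0), min_eq_right (by linarith),
      max_eq_right (by linarith)]
  · rw [trapezoid, min_eq_left (le_min (by linarith) (by linarith)), max_eq_right zero_le_one]

theorem trapezoid_of_mem_fourth (ht : t ∈ Icc (3 / 4 : ℝ) 1) :
    trapezoid 0 3 t = 0 ∧ trapezoid 1 4 t = 4 - 4 * t := by
  obtain ⟨h1, h2⟩ := ht
  constructor
  · exact max_eq_left ((min_le_right _ _).trans ((min_le_right _ _).trans (by linarith)))
  · rw [trapezoid, min_eq_right (by linarith : 4 - 4 * t ≤ 4 * t - 1), min_eq_right (by linarith),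
      max_eq_right (by linarith)]

theorem absolutelyContinuousOnInterval_rectangleCurve (a b : ℝ) :
    AbsolutelyContinuousOnInterval (rectangleCurve z w) a b := by
  refine LipschitzOnWith.absolutelyContinuousOnInterval
    (K := 4 * (‖w.re - z.re‖₊ + ‖w.im - z.im‖₊)) (LipschitzWith.lipschitzOnWith ?_)
  refine LipschitzWith.of_dist_le_mul fun s t => ?_
  rw [dist_eq_norm, Real.dist_eq]
  refine (Complex.norm_le_abs_re_add_abs_im _).trans ?_
  have e1 : (rectangleCurve z w s - rectangleCurve z w t).re =
      (w.re - z.re) * (trapezoid 0 3 s - trapezoid 0 3 t) := by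
    simp only [rectangleCurve, Complex.sub_re]
    ring
  have e2 : (rectangleCurve z w s - rectangleCurve z w t).im =
      (w.im - z.im) * (trapezoid 1 4 s - trapezoid 1 4 t) := by
    simp only [rectangleCurve, Complex.sub_im]
    ring
  rw [e1, e2, abs_mul, abs_mul]
  have h1 := mul_le_mul_of_nonneg_left (abs_trapezoid_sub_le 0 3 s t) (abs_nonneg (w.re - z.re))
  have h2 := mul_le_mul_of_nonneg_left (abs_trapezoid_sub_le 1 4 s t) (abs_nonneg (w.im - z.im))
  push_cast
  simp only [Real.norm_eq_abs]
  linarith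

theorem rectangleCurve_mem_rectangle (t : ℝ) : rectangleCurve z w t ∈ Complex.Rectangle z w := by
  have key (a b c : ℝ) (hc : c ∈ Icc (0 : ℝ) 1) : a + (b - a) * c ∈ uIcc a b := by
    rw [← segment_eq_uIcc, segment_eq_image']
    exact ⟨c, hc, by simp [mul_comm]⟩
  exact ⟨key _ _ _ (trapezoid_mem_Icc _ _ _), key _ _ _ (trapezoid_mem_Icc _ _ _)⟩

theorem isJordanCurveIn_rectangleCurve {V : Set ℂ} {z w : ℂ} (hre : z.re ≠ w.re)
    (him : z.im ≠ w.im) (hV : Complex.Rectangle z w ⊆ V) :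
    IsJordanCurveIn (rectangleCurve z w) V := by
  refine ⟨?_, ?_, fun s hs t ht hst => ?_, fun t _ => hV (rectangleCurve_mem_rectangle z w t)⟩
  · simpa [uIcc_of_le zero_le_one] using
      (absolutelyContinuousOnInterval_rectangleCurve z w 0 1).continuousOn
  · obtain ⟨h1, h2⟩ := trapezoid_of_mem_first (t := 0) (by norm_num)
    obtain ⟨h3, h4⟩ := trapezoid_of_mem_fourth (t := 1) (by norm_num)
    simp [rectangleCurve, h1, h2, h3, h4]
  · obtain ⟨e1, e2⟩ := Complex.ext_iff.1 hst
    simp only [rectangleCurve, add_right_inj] at e1 e2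
    have e1 := mul_left_cancel₀ (sub_ne_zero.2 hre.symm) e1
    have e2 := mul_left_cancel₀ (sub_ne_zero.2 him.symm) e2
    -- The edges are taken over disjoint parameter intervals, so that each corner belongs to one
    -- edge only and every coincidence is settled by linear arithmetic.
    have key (x : ℝ) (hx : x ∈ Ico (0 : ℝ) 1) :
        x ≤ 1 / 4 ∧ trapezoid 0 3 x = 4 * x ∧ trapezoid 1 4 x = 0 ∨
        1 / 4 < x ∧ x ≤ 1 / 2 ∧ trapezoid 0 3 x = 1 ∧ trapezoid 1 4 x = 4 * x - 1 ∨
        1 / 2 < x ∧ x ≤ 3 / 4 ∧ trapezoid 0 3 x = 3 - 4 * x ∧ trapezoid 1 4 x = 1 ∨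
        3 / 4 < x ∧ trapezoid 0 3 x = 0 ∧ trapezoid 1 4 x = 4 - 4 * x := by
      rcases le_or_gt x (1 / 4) with h1 | h1
      · exact Or.inl ⟨h1, trapezoid_of_mem_first ⟨hx.1, h1⟩⟩
      rcases le_or_gt x (1 / 2) with h2 | h2
      · exact Or.inr (Or.inl ⟨h1, h2, trapezoid_of_mem_second ⟨h1.le, h2⟩⟩)
      rcases le_or_gt x (3 / 4) with h3 | h3
      · exact Or.inr (Or.inr (Or.inl ⟨h2, h3, trapezoid_of_mem_third ⟨h2.le, h3⟩⟩))
      · exact Or.inr (Or.inr (Or.inr ⟨h3, trapezoid_of_mem_fourth ⟨h3.le, hx.2.le⟩⟩))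
    obtain ⟨hs0, hs1⟩ := id hs
    obtain ⟨ht0, ht1⟩ := id ht
    rcases key s hs with ⟨a1, a2, a3⟩ | ⟨a0, a1, a2, a3⟩ | ⟨a0, a1, a2, a3⟩ | ⟨a1, a2, a3⟩ <;>
      rcases key t ht with ⟨b1, b2, b3⟩ | ⟨b0, b1, b2, b3⟩ | ⟨b0, b1, b2, b3⟩ | ⟨b1, b2, b3⟩ <;>
      linarith

end

/-- Affine substitution on one edge. Only the interior of the interval matters, so `Γ` need not be
differentiable at the corners. -/
theorem integral_comp_mul_deriv_eq_of_eqOn {h : ℂ → ℂ} {Γ : ℝ → ℂ} {a b k d : ℝ} {P e : ℂ}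
    (hab : a ≤ b) (hΓ : ∀ t ∈ Icc a b, Γ t = P + (k * t + d : ℝ) * e) :
    ∫ t in a..b, h (Γ t) * deriv Γ t = e * ∫ x in k * a + d..k * b + d, h (P + x * e) := by
  rw [← intervalIntegral.smul_integral_comp_mul_add (fun x : ℝ => h (P + x * e)),
    Complex.real_smul, ← mul_assoc, ← intervalIntegral.integral_const_mul]
  refine intervalIntegral.integral_congr_Ioo_of_le hab fun t ht => ?_
  have hd : HasDerivAt (fun t : ℝ => P + (k * t + d : ℝ) * e) (k * e) t := by
    have := (((hasDerivAt_id t).const_mul k).add_const d).ofReal_comp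
    simpa using (this.mul_const e).const_add P
  have he : Γ =ᶠ[𝓝 t] fun t => P + (k * t + d : ℝ) * e := by
    filter_upwards [Ioo_mem_nhds ht.1 ht.2] with s hs using hΓ s (Ioo_subset_Icc_self hs)
  rw [he.deriv_eq, hd.deriv, hΓ t (Ioo_subset_Icc_self ht)]
  ring

theorem integral_rectangleCurve {h : ℂ → ℂ} {z w : ℂ}
    (hi : IntervalIntegrable (fun t => h (rectangleCurve z w t) * deriv (rectangleCurve z w) t)
      volume 0 1) :
    ∫ t in (0 : ℝ)..1, h (rectangleCurve z w t) * deriv (rectangleCurve z w) t =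
      Complex.wedgeIntegral z w h + Complex.wedgeIntegral w z h := by
  have hi' {a b : ℝ} (ha : 0 ≤ a) (hab : a ≤ b) (hb : b ≤ 1) := hi.mono_set (c := a) (d := b) (by
    rw [uIcc_of_le hab, uIcc_of_le zero_le_one]
    exact Icc_subset_Icc ha hb)
  -- On each quarter, `k * t + d` is the moving coordinate, `P` carries the fixed one and `e` is the
  -- direction `1` or `I`. The first two edges form the wedge from `z` to `w`, the last two the
  -- wedge back.
  rw [← intervalIntegral.integral_add_adjacent_intervals
      (hi' (a := 0) (b := 1 / 2) (by norm_num) (by norm_num) (by norm_num))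
      (hi' (a := 1 / 2) (b := 1) (by norm_num) (by norm_num) (by norm_num)),
    ← intervalIntegral.integral_add_adjacent_intervals
      (hi' (a := 0) (b := 1 / 4) (by norm_num) (by norm_num) (by norm_num))
      (hi' (a := 1 / 4) (b := 1 / 2) (by norm_num) (by norm_num) (by norm_num)),
    ← intervalIntegral.integral_add_adjacent_intervals
      (hi' (a := 1 / 2) (b := 3 / 4) (by norm_num) (by norm_num) (by norm_num))
      (hi' (a := 3 / 4) (b := 1) (by norm_num) (by norm_num) (by norm_num)),
    integral_comp_mul_deriv_eq_of_eqOn (k := 4 * (w.re - z.re)) (d := z.re) (P := z.im * Complex.I)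
      (e := 1) (by norm_num) fun t ht => ?_,
    integral_comp_mul_deriv_eq_of_eqOn (k := 4 * (w.im - z.im)) (d := 2 * z.im - w.im)
      (P := w.re) (e := Complex.I) (by norm_num) fun t ht => ?_,
    integral_comp_mul_deriv_eq_of_eqOn (k := 4 * (z.re - w.re)) (d := 3 * w.re - 2 * z.re)
      (P := w.im * Complex.I) (e := 1) (by norm_num) fun t ht => ?_,
    integral_comp_mul_deriv_eq_of_eqOn (k := 4 * (z.im - w.im)) (d := 4 * w.im - 3 * z.im)
      (P := z.re) (e := Complex.I) (by norm_num) fun t ht => ?_]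
  · rw [Complex.wedgeIntegral, Complex.wedgeIntegral, smul_eq_mul, smul_eq_mul]
    simp only [one_mul, mul_one, add_comm ((z.im : ℂ) * Complex.I),
      add_comm ((w.im : ℂ) * Complex.I)]
    rw [show 4 * (w.re - z.re) * 0 + z.re = z.re by ring,
      show 4 * (w.re - z.re) * (1 / 4) + z.re = w.re by ring,
      show 4 * (w.im - z.im) * (1 / 4) + (2 * z.im - w.im) = z.im by ring,
      show 4 * (w.im - z.im) * (1 / 2) + (2 * z.im - w.im) = w.im by ring,
      show 4 * (z.re - w.re) * (1 / 2) + (3 * w.re - 2 * z.re) = w.re by ring,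
      show 4 * (z.re - w.re) * (3 / 4) + (3 * w.re - 2 * z.re) = z.re by ring,
      show 4 * (z.im - w.im) * (3 / 4) + (4 * w.im - 3 * z.im) = w.im by ring,
      show 4 * (z.im - w.im) + (4 * w.im - 3 * z.im) = z.im by ring]
  · obtain ⟨h1, h2⟩ := trapezoid_of_mem_fourth ht
    apply Complex.ext <;> simp [rectangleCurve, h1, h2]
    ring
  · obtain ⟨h1, h2⟩ := trapezoid_of_mem_third ht
    apply Complex.ext <;> simp [rectangleCurve, h1, h2]
    ring
  · obtain ⟨h1, h2⟩ := trapezoid_of_mem_second ht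
    apply Complex.ext <;> simp [rectangleCurve, h1, h2]
    ring
  · obtain ⟨h1, h2⟩ := trapezoid_of_mem_first ht
    apply Complex.ext <;> simp [rectangleCurve, h1, h2]
    ring

/-- **Morera's theorem**: a continuous function is holomorphic if its integral along absolutely
continuous Jordan curves vanishes. -/
theorem differentiableOn_of_hasContourIntegral_eq_zero {V : Set ℂ} (hV : IsOpen V) {h : ℂ → ℂ}
    (hh : ContinuousOn h V)
    (H : ∀ Γ : ℝ → ℂ, IsJordanCurveIn Γ V → AbsolutelyContinuousOnInterval Γ 0 1 →
      ∀ I, HasContourIntegral h id Γ I → I = 0) : DifferentiableOn ℂ h V := by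
  intro x hx
  obtain ⟨r, hr0, hr⟩ := Metric.isOpen_iff.1 hV x hx
  have hc : Complex.IsConservativeOn h (Metric.ball x r) := by
    intro z w hzw
    rw [← add_eq_zero_iff_eq_neg]
    -- Degenerate rectangles do not bound Jordan curves; their wedge integrals cancel directly.
    by_cases hre : z.re = w.re
    · rw [Complex.wedgeIntegral_add_wedgeIntegral_eq]
      simp [hre]
    by_cases him : z.im = w.im
    · rw [Complex.wedgeIntegral_add_wedgeIntegral_eq]
      simp [him]
    have hJ := isJordanCurveIn_rectangleCurve hre him (hzw.trans hr)
    have hac := absolutelyContinuousOnInterval_rectangleCurve z w 0 1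
    obtain ⟨hi, hI⟩ := hasContourIntegral_of_absolutelyContinuous (f := h) (g := id)
      (hh.comp hJ.1 hJ.2.2.2) hac
    rw [← integral_rectangleCurve hi]
    exact H _ hJ hac _ hI
  exact ((hc.isExactOn_ball (hh.mono hr)).differentiableOn Metric.isOpen_ball).differentiableAt
    (Metric.ball_mem_nhds x hr0) |>.differentiableWithinAt

/-! ### Morera's theorem for the Beltrami equation -/

theorem IsJordanCurveIn.comp_of_injOn {V Ω : Set ℂ} {Γ : ℝ → ℂ} {g : ℂ → ℂ}
    (hΓ : IsJordanCurveIn Γ V) (hg : ContinuousOn g V) (hgi : InjOn g V) (hgΩ : MapsTo g V Ω) :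
    IsJordanCurveIn (g ∘ Γ) Ω :=
  ⟨hg.comp hΓ.1 hΓ.2.2.2, congrArg g hΓ.2.1,
    hgi.comp hΓ.2.2.1 fun _ ht => hΓ.2.2.2 (Ico_subset_Icc_self ht), hgΩ.comp hΓ.2.2.2⟩

/-- **Morera's theorem** for the Beltrami equation: if the contour integrals of `φ` with respect to
an injective solution `f` vanish, then `φ` is a solution. -/
theorem IsContinuousBeltramiSolution.isBeltramiSolution_of_hasContourIntegral_eq_zero
    {Ω : Set ℂ} {μ f p q φ : ℂ → ℂ} (hΩ : IsOpen Ω) (hf : IsContinuousBeltramiSolution Ω μ f p q)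
    (hμ : ∀ᵐ z ∂volume.restrict Ω, ‖μ z‖ < 1) (hfi : InjOn f Ω) (hφ : ContinuousOn φ Ω)
    (H : ∀ γ : ℝ → ℂ, IsJordanCurveIn γ Ω → BoundedVariationOn (f ∘ γ) (Icc 0 1) →
      ∀ I, HasContourIntegral φ f γ I → I = 0) : IsBeltramiSolution Ω μ φ := by
  have hV : IsOpen (f '' Ω) := hf.isOpen_image hΩ hμ hfi hΩ subset_rfl
  have hgc := hf.continuousOn_invFunOn hΩ hμ hfi
  have hinv : LeftInvOn (Function.invFunOn f Ω) f Ω := hfi.leftInvOn_invFunOn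
  have hright : RightInvOn (Function.invFunOn f Ω) f (f '' Ω) :=
    (surjOn_image f Ω).rightInvOn_invFunOn
  have hmaps : MapsTo (Function.invFunOn f Ω) (f '' Ω) Ω := (surjOn_image f Ω).mapsTo_invFunOn
  refine hf.isBeltramiSolution_comp hΩ hV (mapsTo_image f Ω)
    (h := fun w => φ (Function.invFunOn f Ω w)) ?_ fun z hz => congrArg φ (hinv hz).symm
  -- A Jordan curve `Γ` in the image is pulled back to `γ = f⁻¹ ∘ Γ`. Then `f ∘ γ = Γ` on `[0, 1]`,
  -- which is absolutely continuous and so rectifiable, and the integral of `φ df` along `γ` is that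
  -- of `h dw` along `Γ`.
  refine differentiableOn_of_hasContourIntegral_eq_zero hV (hφ.comp hgc hmaps)
    fun Γ hΓ hac I hI => ?_
  have he (t : ℝ) (ht : t ∈ Icc (0 : ℝ) 1) : f (Function.invFunOn f Ω (Γ t)) = Γ t :=
    hright (hΓ.2.2.2 ht)
  refine H _ (hΓ.comp_of_injOn hgc hright.injOn hmaps) ?_ I
    (hI.congr (Γ := Function.invFunOn f Ω ∘ Γ) (fun _ _ => rfl) he)
  have hbv := hac.boundedVariationOn
  rw [uIcc_of_le zero_le_one] at hbv
  rwa [BoundedVariationOn, eVariationOn.congr (f := f ∘ Function.invFunOn f Ω ∘ Γ) he]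

/-! ### The main theorem -/

theorem mainTheorem4 (Ω : Set ℂ) (hΩ : IsOpen Ω) (hΩsc : IsSimplyConnected Ω)
    (μ : ℂ → ℂ) (hμ : IsPiecewiseContinuousOn μ Ω)
    (hμ1 : eLpNorm μ ⊤ (volume.restrict Ω) < 1)
    (φ₀ : ℂ → ℂ) (hφ₀c : ContinuousOn φ₀ Ω) (hφ₀i : InjOn φ₀ Ω)
    (hφ₀ : IsBeltramiSolution Ω μ φ₀)
    (φ : ℂ → ℂ) (hφc : ContinuousOn φ Ω) (hφi : InjOn φ Ω) :
    -- vanishing of the contour integral along the Jordan curves with rectifiable image under `φ₀`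
    (IsBeltramiSolution Ω μ φ ↔
      ∀ γ : ℝ → ℂ, IsJordanCurveIn γ Ω → BoundedVariationOn (φ₀ ∘ γ) (Icc 0 1) →
        HasContourIntegral φ φ₀ γ 0) ∧
    -- vanishing of the contour integral along all Jordan curves for which it exists
    (IsBeltramiSolution Ω μ φ ↔
      ∀ γ : ℝ → ℂ, IsJordanCurveIn γ Ω → ∀ I : ℂ, HasContourIntegral φ φ₀ γ I → I = 0) ∧
    -- the contour integral as a line integral, where the integrand of the latter makes sense
    (∀ γ : ℝ → ℂ, IsJordanCurveIn γ Ω →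
      AbsolutelyContinuousOnInterval γ 0 1 → AbsolutelyContinuousOnInterval (φ₀ ∘ γ) 0 1 →
      (∀ᵐ t ∂(volume.restrict (Icc (0 : ℝ) 1)),
        DifferentiableAt ℝ φ₀ (γ t) ∧ dzbar φ₀ (γ t) = μ (γ t) * dz φ₀ (γ t)) →
      IntervalIntegrable (fun t => φ (γ t) * dz φ₀ (γ t) *
        (deriv γ t + μ (γ t) * (starRingEnd ℂ) (deriv γ t))) volume 0 1 ∧
      HasContourIntegral φ φ₀ γ (∫ t in (0 : ℝ)..1, φ (γ t) * dz φ₀ (γ t) *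
        (deriv γ t + μ (γ t) * (starRingEnd ℂ) (deriv γ t)))) := by
  have hμ' : ∀ᵐ z ∂volume.restrict Ω, ‖μ z‖ < 1 := by
    rw [eLpNorm_exponent_top] at hμ1
    filter_upwards [ae_lt_of_essSup_lt hμ1] with z hz
    rwa [← ofReal_norm, ENNReal.ofReal_lt_one] at hz
  obtain ⟨-, p₀, q₀, hp₀, hq₀, hpw₀, hqw₀, he₀⟩ := hφ₀
  have hf : IsContinuousBeltramiSolution Ω μ φ₀ p₀ q₀ := ⟨hφ₀c, hp₀, hq₀, hpw₀, hqw₀, he₀⟩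
  have hV : IsOpen (φ₀ '' Ω) := hf.isOpen_image hΩ hμ' hφ₀i hΩ subset_rfl
  have hinv : LeftInvOn (Function.invFunOn φ₀ Ω) φ₀ Ω := hφ₀i.leftInvOn_invFunOn
  have hmaps := mapsTo_image φ₀ Ω
  have hφh (z : ℂ) (hz : z ∈ Ω) : φ z = (fun w => φ (Function.invFunOn φ₀ Ω w)) (φ₀ z) :=
    congrArg φ (hinv hz).symm
  -- Injectivity of `h` is what yields vanishing along curves whose image under `φ₀` may fail to be
  -- rectifiable.
  have hhi : InjOn (fun w => φ (Function.invFunOn φ₀ Ω w)) (φ₀ '' Ω) := by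
    rintro _ ⟨x, hx, rfl⟩ _ ⟨y, hy, rfl⟩ hxy
    rw [← hφh x hx, ← hφh y hy] at hxy
    rw [hφi hx hy hxy]
  have hh (h : IsBeltramiSolution Ω μ φ) :
      DifferentiableOn ℂ (fun w => φ (Function.invFunOn φ₀ Ω w)) (φ₀ '' Ω) := by
    obtain ⟨-, p, q, hp, hq, hpw, hqw, he⟩ := h
    exact hf.differentiableOn_comp_invFunOn hΩ hμ' hφ₀i ⟨hφc, hp, hq, hpw, hqw, he⟩
  refine ⟨⟨fun h γ hγ hbv => ?_, fun h => ?_⟩, ⟨fun h γ hγ I hI => ?_, fun h => ?_⟩,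
    fun γ hγ hac hac₀ hd => ?_⟩
  · exact hasContourIntegral_zero_of_boundedVariationOn hΩsc hV (hh h) hφ₀c hmaps hφh hγ.1 hγ.2.1
      hγ.2.2.2 hbv
  · exact hf.isBeltramiSolution_of_hasContourIntegral_eq_zero hΩ hμ' hφ₀i hφc
      fun γ hγ hbv I hI => hI.unique (h γ hγ hbv)
  · exact hI.eq_zero_of_injOn hΩsc hV (hh h) hhi hφ₀c hmaps hφh hγ.1 hγ.2.1 hγ.2.2.2
  · exact hf.isBeltramiSolution_of_hasContourIntegral_eq_zero hΩ hμ' hφ₀i hφc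
      fun γ hγ _ I hI => h γ hγ I hI
  · exact hasContourIntegral_of_ae_differentiableAt (hφc.comp hγ.1 hγ.2.2.2) hac hac₀ hd
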